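/- Let $\mathbb D=\{z\in\mathbb C:|z|<1\}$ carry the Poincaré metric $\frac{4|dz|^2}{(1-|z|^2)^2}$ and let $G=\mathrm{PSU}(1,1)=\mathrm{SU}(1,1)/\{\pm\mathrm{Id}\}$ act on $\mathbb D$ by linear fractional transformations. Let $S$ be a connected, oriented smooth surface (without boundary), and let $\mathrm{Hyp}(S)$ be the set of complete Riemannian metrics on $S$ of constant sectional curvature $-1$; assume $\mathrm{Hyp}(S)\neq\emptyset$. Let $\mathrm{Diff}_0^+(S)$ be the group of orientation preserving diffeomorphisms of $S$ that are homotopic to the identity, acting on $\mathrm{Hyp}(S)$ by pullback. Let $p:D\to S$ be a universal covering, with the lifted smooth structure and orientation, let $d_0\in D$, $*=p(d_0)$, and fix $0\neq v\in T_{d_0}D$. For $\gamma\in\pi_1(S,*)$ (with product given by concatenation) let $T_\gamma$ be the covering transformation sending $d_0$ to the endpoint of the lift of $\gamma$ starting at $d_0$. Then for every $h\in\mathrm{Hyp}(S)$ there is exactly one homomorphism $\delta(h):\pi_1(S,*)\to G$ such that $\delta(h)(\gamma)=f_h\circ T_\gamma\circ f_h^{-1}$ on $\mathbb D$ for all $\gamma$,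 where $f_h:(D,p^*h)\to\mathbb D$ is the orientation preserving isometry with $f_h(d_0)=0$ and $df_h(v)\in\mathbb R^+$. The map $\delta$ induces a well-defined map $$\delta':\ \mathrm{Diff}^+_0(S)\backslash\mathrm{Hyp}(S)\longrightarrow \mathrm{Hom}(\pi_1(S,*),G)/G,\qquad [h]\longmapsto[\delta(h)],$$ where $G$ acts on $\mathrm{Hom}(\pi_1(S,*),G)$ by conjugation, and $\delta'$ is injective. -/

import Mathlib

open scoped Manifold ContDiff Topology Bundle Matrix

noncomputable section

/-! ### The group `PSU(1,1)` and its action by linear fractional transformations -/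

/-- The Hermitian form of signature `(1,1)` on `ℂ²`. -/
def formJ : Matrix (Fin 2) (Fin 2) ℂ := !![1, 0; 0, -1]

/-- `SU(1,1)`: the matrices of determinant one preserving the Hermitian form `|z₁|² - |z₂|²`. -/
def SU11 : Subgroup (Matrix.SpecialLinearGroup (Fin 2) ℂ) where
  carrier := {A | (A : Matrix (Fin 2) (Fin 2) ℂ)ᴴ * formJ * (A : Matrix (Fin 2) (Fin 2) ℂ) = formJ}
  one_mem' := by simp
  mul_mem' := by
    intro A B hA hB
    simp only [Set.mem_ofPred_eq, Matrix.SpecialLinearGroup.coe_mul,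
      Matrix.conjTranspose_mul] at *
    calc _ = (B : Matrix (Fin 2) (Fin 2) ℂ)ᴴ * ((A : Matrix (Fin 2) (Fin 2) ℂ)ᴴ * formJ *
            (A : Matrix (Fin 2) (Fin 2) ℂ)) * (B : Matrix (Fin 2) (Fin 2) ℂ) := by
          simp only [Matrix.mul_assoc]
      _ = formJ := by rw [hA, hB]
  inv_mem' := by
    intro A hA
    simp only [Set.mem_ofPred_eq] at *
    have h1 : (A : Matrix (Fin 2) (Fin 2) ℂ) * ((A⁻¹ : Matrix.SpecialLinearGroup (Fin 2) ℂ) :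
        Matrix (Fin 2) (Fin 2) ℂ) = 1 := by
      rw [← Matrix.SpecialLinearGroup.coe_mul, mul_inv_cancel, Matrix.SpecialLinearGroup.coe_one]
    set M := (A : Matrix (Fin 2) (Fin 2) ℂ)
    set N := ((A⁻¹ : Matrix.SpecialLinearGroup (Fin 2) ℂ) : Matrix (Fin 2) (Fin 2) ℂ)
    have h2 : Nᴴ * Mᴴ = 1 := by
      rw [← Matrix.conjTranspose_mul, h1, Matrix.conjTranspose_one]
    calc Nᴴ * formJ * N = Nᴴ * (Mᴴ * formJ * M) * N := by rw [hA]
      _ = (Nᴴ * Mᴴ) * formJ * (M * N) := by simp only [Matrix.mul_assoc]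
      _ = formJ := by rw [h1, h2, Matrix.one_mul, Matrix.mul_one]

/-- The subgroup `{Id, -Id}` of `SU(1,1)`. -/
def SU11.signs : Subgroup SU11 where
  carrier := {A | A.1 = 1 ∨ A.1 = -1}
  one_mem' := Or.inl rfl
  mul_mem' := by
    rintro A B (hA | hA) (hB | hB)
    · left; rw [Subgroup.coe_mul, hA, hB, mul_one]
    · right; rw [Subgroup.coe_mul, hA, hB, one_mul]
    · right; rw [Subgroup.coe_mul, hA, hB, mul_one]
    · left; rw [Subgroup.coe_mul, hA, hB, neg_mul_neg, mul_one]
  inv_mem' := by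
    rintro A (hA | hA)
    · left; simp [hA]
    · right
      rw [Subgroup.coe_inv, hA, inv_eq_iff_mul_eq_one]
      simp

instance SU11.signs_normal : SU11.signs.Normal where
  conj_mem := by
    rintro A (hA | hA) B
    · left; simp [hA]
    · right; simp [hA]

/-- `PSU(1,1) = SU(1,1) / {± Id}`. -/
abbrev PSU11 : Type := SU11 ⧸ SU11.signs

/-- The linear fractional transformation `z ↦ (a z + b) / (c z + d)` given by a `2 × 2` matrix. -/
def moebius (A : Matrix (Fin 2) (Fin 2) ℂ) (z : ℂ) : ℂ :=
  (A 0 0 * z + A 0 1) / (A 1 0 * z + A 1 1)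

/-- The action of `PSU(1,1)` by linear fractional transformations (it is used on the open
unit disk only, where the denominators do not vanish). -/
def PSU11.act (g : PSU11) : ℂ → ℂ :=
  Quotient.liftOn' g (fun A => moebius (A.1 : Matrix (Fin 2) (Fin 2) ℂ)) (by
    intro A B h
    rw [QuotientGroup.leftRel_apply] at h
    funext z
    rcases h with h | h
    · have : B.1 = A.1 := by
        rw [Subgroup.coe_mul, Subgroup.coe_inv, inv_mul_eq_iff_eq_mul, mul_one] at h
        exact h
      rw [this]
    · have : B.1 = -A.1 := by
        rw [Subgroup.coe_mul, Subgroup.coe_inv, inv_mul_eq_iff_eq_mul, mul_neg, mul_one] at h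
        exact h
      rw [this]
      simp only [moebius, Matrix.SpecialLinearGroup.coe_neg, Matrix.neg_apply]
      rw [← neg_div_neg_eq]
      congr 1 <;> ring)

/-- The Poincaré metric `4 |dz|² / (1 - |z|²)²` of the open unit disk at the point `z`. -/
def poincareForm (z v w : ℂ) : ℝ := 4 / (1 - ‖z‖ ^ 2) ^ 2 * inner ℝ v w

/-! ### Oriented surfaces

A smooth surface is a smooth manifold modelled on the real plane `ℂ = ℝ²`. -/

/-- An orientation of a smooth surface, given by an oriented atlas: all changes of charts have
positive Jacobian determinant. -/
class OrientedSurface (M : Type*) [TopologicalSpace M] [ChartedSpace ℂ M] : Prop where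
  det_pos : ∀ e ∈ atlas ℂ M, ∀ e' ∈ atlas ℂ M, ∀ z ∈ (e.symm ≫ₕ e').source,
    0 < (fderiv ℝ (e.symm ≫ₕ e') z).det

section Surfaces

variable {M N : Type*} [TopologicalSpace M] [ChartedSpace ℂ M]
  [TopologicalSpace N] [ChartedSpace ℂ N]

/-- The differential of a map between surfaces, `TangentSpace` at a point being the plane `ℂ`
(through the preferred chart at that point, which belongs to the given atlas). -/
def surfDeriv (f : M → N) (x : M) : ℂ →L[ℝ] ℂ := mfderiv 𝓘(ℝ, ℂ) 𝓘(ℝ, ℂ) f x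

/-- For oriented surfaces: the differential of `f` preserves the orientation at every point. -/
def IsOrientationPreserving (f : M → N) : Prop := ∀ x, 0 < (surfDeriv f x).det

end Surfaces

/-- A smooth Riemannian metric on the surface `M`. -/
abbrev SurfaceMetric (M : Type*) [TopologicalSpace M] [ChartedSpace ℂ M]
    [IsManifold 𝓘(ℝ, ℂ) ∞ M] :=
  Bundle.ContMDiffRiemannianMetric 𝓘(ℝ, ℂ) ∞ ℂ (fun x : M => TangentSpace 𝓘(ℝ, ℂ) x)

/-! ### Curvature in charts -/

/-- The standard basis `1, i` of the real plane `ℂ`. -/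
def planeBasis : Fin 2 → ℂ := ![1, Complex.I]

/-- The partial derivative `∂ₖ f` of a function of two real variables. -/
def partialD (k : Fin 2) (f : ℂ → ℝ) (z : ℂ) : ℝ := fderiv ℝ f z (planeBasis k)

/-- Christoffel symbols `Γᵏᵢⱼ` of a metric `G = (gᵢⱼ)` on a domain of the plane. -/
def christoffel (G : ℂ → Matrix (Fin 2) (Fin 2) ℝ) (k i j : Fin 2) (z : ℂ) : ℝ :=
  (1 / 2) * ∑ l, (G z)⁻¹ k l * (partialD i (fun w => G w j l) z + partialD j (fun w => G w i l) z
    - partialD l (fun w => G w i j) z)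

/-- The components of the curvature tensor: `R(∂ᵢ, ∂ⱼ) ∂ₖ = ∑ₗ (riemannTensor G l k i j) ∂ₗ`. -/
def riemannTensor (G : ℂ → Matrix (Fin 2) (Fin 2) ℝ) (l k i j : Fin 2) (z : ℂ) : ℝ :=
  partialD i (christoffel G l j k) z - partialD j (christoffel G l i k) z
    + ∑ m, (christoffel G l i m z * christoffel G m j k z
      - christoffel G l j m z * christoffel G m i k z)

/-- The sectional curvature `⟨R(∂₀, ∂₁) ∂₁, ∂₀⟩ / det G` of the metric `G`. -/
def sectionalCurvature (G : ℂ → Matrix (Fin 2) (Fin 2) ℝ) (z : ℂ) : ℝ :=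
  (∑ l, G z 0 l * riemannTensor G l 1 0 1 z) / (G z).det

section Metrics

variable {M : Type*} [TopologicalSpace M] [ChartedSpace ℂ M] [IsManifold 𝓘(ℝ, ℂ) ∞ M]

/-- The value of the metric `g` at the point `x`. -/
def SurfaceMetric.val (g : SurfaceMetric M) (x : M) (v w : ℂ) : ℝ :=
  g.inner x (v : TangentSpace 𝓘(ℝ, ℂ) x) (w : TangentSpace 𝓘(ℝ, ℂ) x)

/-- The matrix `gᵢⱼ = g(∂ᵢ, ∂ⱼ)` of the metric in the chart `e`; it is meaningful on
`e.target`. -/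
def SurfaceMetric.inChart (g : SurfaceMetric M) (e : OpenPartialHomeomorph M ℂ) (z : ℂ) :
    Matrix (Fin 2) (Fin 2) ℝ :=
  Matrix.of fun i j => g.val (e.symm z) (surfDeriv e.symm z (planeBasis i))
    (surfDeriv e.symm z (planeBasis j))

/-- A hyperbolic metric: the sectional curvature is `-1` everywhere. -/
def SurfaceMetric.IsHyperbolic (g : SurfaceMetric M) : Prop :=
  ∀ e ∈ atlas ℂ M, ∀ z ∈ e.target, sectionalCurvature (g.inChart e) z = -1

/-- The Riemannian distance of `g`: the infimum of the `g`-lengths of `C¹` paths. -/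
def SurfaceMetric.dist (g : SurfaceMetric M) (x y : M) : ENNReal :=
  letI : Bundle.RiemannianBundle (fun x : M => TangentSpace 𝓘(ℝ, ℂ) x) := ⟨g.toRiemannianMetric⟩
  Manifold.riemannianEDist 𝓘(ℝ, ℂ) x y

/-- Completeness: Cauchy sequences for the Riemannian distance converge. -/
def SurfaceMetric.IsComplete (g : SurfaceMetric M) : Prop :=
  ∀ u : ℕ → M, (∀ ε > 0, ∃ n₀, ∀ m ≥ n₀, ∀ n ≥ n₀, g.dist (u m) (u n) < ε) →
    ∃ x, Filter.Tendsto (fun n => g.dist (u n) x) Filter.atTop (𝓝 0)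

end Metrics

/-! ### The Fricke space -/

/-- The set `Hyp(S)` of complete hyperbolic metrics on `S`. -/
def Hyp (S : Type*) [TopologicalSpace S] [ChartedSpace ℂ S] [IsManifold 𝓘(ℝ, ℂ) ∞ S] : Type _ :=
  {g : SurfaceMetric S // g.IsHyperbolic ∧ g.IsComplete}

/-- `Diff⁺₀(S)`: the orientation preserving diffeomorphisms homotopic to the identity. -/
def diffPlusZero (S : Type*) [TopologicalSpace S] [ChartedSpace ℂ S] :
    Set (S ≃ₘ^∞⟮𝓘(ℝ, ℂ), 𝓘(ℝ, ℂ)⟯ S) :=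
  {φ | IsOrientationPreserving φ ∧
    ContinuousMap.Homotopic (⟨φ, φ.continuous⟩ : C(S, S)) (ContinuousMap.id S)}

section Fricke

variable {S : Type*} [TopologicalSpace S] [ChartedSpace ℂ S]

lemma surfDeriv_id (x : S) : surfDeriv (id : S → S) x = ContinuousLinearMap.id ℝ ℂ :=
  mfderiv_id

lemma surfDeriv_comp (φ ψ : S ≃ₘ^∞⟮𝓘(ℝ, ℂ), 𝓘(ℝ, ℂ)⟯ S) (x : S) :
    surfDeriv (φ ∘ ψ) x = (surfDeriv φ (ψ x)).comp (surfDeriv ψ x) :=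
  mfderiv_comp x (φ.mdifferentiable (by simp) _) (ψ.mdifferentiable (by simp) _)

lemma surfDeriv_comp_symm (φ : S ≃ₘ^∞⟮𝓘(ℝ, ℂ), 𝓘(ℝ, ℂ)⟯ S) (x : S) :
    (surfDeriv φ (φ.symm x)).comp (surfDeriv φ.symm x) = ContinuousLinearMap.id ℝ ℂ := by
  rw [← surfDeriv_comp, ← surfDeriv_id x]
  congr 1
  funext y
  simp

lemma det_comp' (A B : ℂ →L[ℝ] ℂ) : (A.comp B).det = A.det * B.det :=
  LinearMap.det_comp (A : ℂ →ₗ[ℝ] ℂ) (B : ℂ →ₗ[ℝ] ℂ)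

lemma det_id' : (ContinuousLinearMap.id ℝ ℂ).det = 1 :=
  LinearMap.det_id

lemma refl_mem_diffPlusZero :
    Diffeomorph.refl 𝓘(ℝ, ℂ) S ∞ ∈ diffPlusZero S := by
  refine ⟨fun x => ?_, ?_⟩
  · change 0 < (surfDeriv (id : S → S) x).det
    rw [surfDeriv_id, det_id']
    exact one_pos
  · exact ContinuousMap.Homotopic.refl _

lemma trans_mem_diffPlusZero {φ ψ : S ≃ₘ^∞⟮𝓘(ℝ, ℂ), 𝓘(ℝ, ℂ)⟯ S} (hφ : φ ∈ diffPlusZero S)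
    (hψ : ψ ∈ diffPlusZero S) : φ.trans ψ ∈ diffPlusZero S := by
  refine ⟨fun x => ?_, ?_⟩
  · change 0 < (surfDeriv (ψ ∘ φ) x).det
    rw [surfDeriv_comp, det_comp']
    exact mul_pos (hψ.1 _) (hφ.1 _)
  · exact ContinuousMap.Homotopic.comp hψ.2 hφ.2

lemma symm_mem_diffPlusZero {φ : S ≃ₘ^∞⟮𝓘(ℝ, ℂ), 𝓘(ℝ, ℂ)⟯ S} (hφ : φ ∈ diffPlusZero S) :
    φ.symm ∈ diffPlusZero S := by
  refine ⟨fun x => ?_, ?_⟩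
  · have h := congrArg ContinuousLinearMap.det (surfDeriv_comp_symm φ x)
    rw [det_comp', det_id'] at h
    have h0 := hφ.1 (φ.symm x)
    exact (pos_iff_pos_of_mul_pos (h ▸ one_pos)).1 h0
  · have h := ContinuousMap.Homotopic.comp
      (ContinuousMap.Homotopic.refl (⟨φ.symm, φ.symm.continuous⟩ : C(S, S))) hφ.2
    have e : (⟨φ.symm, φ.symm.continuous⟩ : C(S, S)).comp ⟨φ, φ.continuous⟩
        = ContinuousMap.id S := by
      ext x
      exact φ.symm_apply_apply x
    rw [e, ContinuousMap.comp_id] at h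
    exact h.symm

variable [IsManifold 𝓘(ℝ, ℂ) ∞ S]

/-- `h₁ = φ^* h₂`: the metric `h₁` is the pullback of `h₂` by `φ`. -/
def IsPullback (φ : S → S) (h₁ h₂ : SurfaceMetric S) : Prop :=
  ∀ x v w, h₁.val x v w = h₂.val (φ x) (surfDeriv φ x v) (surfDeriv φ x w)

/-- The orbit equivalence relation of the action of `Diff⁺₀(S)` on `Hyp(S)` by pullback. -/
def Hyp.orbitSetoid (S : Type*) [TopologicalSpace S] [ChartedSpace ℂ S]
    [IsManifold 𝓘(ℝ, ℂ) ∞ S] : Setoid (Hyp S) where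
  r h₁ h₂ := ∃ φ ∈ diffPlusZero S, IsPullback φ h₁.1 h₂.1
  iseqv :=
    { refl := fun h => ⟨_, refl_mem_diffPlusZero, fun x v w => by
        change h.1.val x v w = h.1.val x (surfDeriv (id : S → S) x v) (surfDeriv (id : S → S) x w)
        rw [surfDeriv_id]
        rfl⟩
      symm := by
        rintro h₁ h₂ ⟨φ, hφ, hh⟩
        refine ⟨φ.symm, symm_mem_diffPlusZero hφ, fun x v w => ?_⟩
        have e := surfDeriv_comp_symm φ x
        have ev : ∀ v, surfDeriv φ (φ.symm x) (surfDeriv φ.symm x v) = v := fun v =>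
          congrArg (fun L : ℂ →L[ℝ] ℂ => L v) e
        rw [hh, ev, ev, φ.apply_symm_apply]
      trans := by
        rintro h₁ h₂ h₃ ⟨φ, hφ, hh⟩ ⟨ψ, hψ, hk⟩
        refine ⟨φ.trans ψ, trans_mem_diffPlusZero hφ hψ, fun x v w => ?_⟩
        change _ = h₃.1.val (ψ (φ x)) (surfDeriv (ψ ∘ φ) x v) (surfDeriv (ψ ∘ φ) x w)
        rw [surfDeriv_comp, hh, hk]
        rfl }

/-- The Fricke space `Diff⁺₀(S) \ Hyp(S)`. -/
def FrickeSpace (S : Type*) [TopologicalSpace S] [ChartedSpace ℂ S]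
    [IsManifold 𝓘(ℝ, ℂ) ∞ S] : Type _ :=
  Quotient (Hyp.orbitSetoid S)

/-- The class of a complete hyperbolic metric in the Fricke space. -/
def FrickeSpace.mk (h : Hyp S) : FrickeSpace S := Quotient.mk (Hyp.orbitSetoid S) h

end Fricke

/-! ### Representations of the fundamental group -/

/-- The fundamental group with the product given by concatenation: `γ * η` is first `γ`, then `η`.
(The product of Mathlib's `FundamentalGroup` is in the order of composition of arrows.) -/
abbrev PiOne (X : Type*) [TopologicalSpace X] (x : X) : Type _ := (FundamentalGroup X x)ᵐᵒᵖ

/-- Two homomorphisms to `PSU(1,1)` are equivalent if they are conjugate by an element of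
`PSU(1,1)`. -/
def conjSetoid (P : Type*) [Group P] : Setoid (P →* PSU11) where
  r ρ₁ ρ₂ := ∃ g : PSU11, ∀ γ, ρ₂ γ = g * ρ₁ γ * g⁻¹
  iseqv :=
    { refl := fun ρ => ⟨1, fun γ => by simp⟩
      symm := by
        rintro ρ₁ ρ₂ ⟨g, hg⟩
        exact ⟨g⁻¹, fun γ => by rw [hg]; group⟩
      trans := by
        rintro ρ₁ ρ₂ ρ₃ ⟨g, hg⟩ ⟨k, hk⟩
        exact ⟨k * g, fun γ => by rw [hk, hg]; group⟩ }

/-- The representation space `Hom(P, PSU(1,1)) / PSU(1,1)`. -/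
def RepSpace (P : Type*) [Group P] : Type _ := Quotient (conjSetoid P)

/-- The conjugacy class of a homomorphism. -/
def RepSpace.mk {P : Type*} [Group P] (ρ : P →* PSU11) : RepSpace P :=
  Quotient.mk (conjSetoid P) ρ

/-! ### Universal coverings and holonomy -/

section Holonomy

variable {S D : Type*} [TopologicalSpace S] [ChartedSpace ℂ S]
  [TopologicalSpace D] [ChartedSpace ℂ D]

/-- A smooth, orientation preserving universal covering of an oriented surface. -/
structure IsUniversalCovering (p : D → S) : Prop where
  simplyConnected : SimplyConnectedSpace D
  isCoveringMap : IsCoveringMap p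
  isLocalDiffeomorph : IsLocalDiffeomorph 𝓘(ℝ, ℂ) 𝓘(ℝ, ℂ) ∞ p
  isOrientationPreserving : IsOrientationPreserving p

/-- `T = T_γ`: the covering transformation of `p` sending the base point `d₀` to the endpoint of
the lift of the loop `γ` starting at `d₀`. -/
structure IsCoveringTransformation {p : D → S} (hp : IsUniversalCovering p) (d₀ : D)
    (γ : PiOne S (p d₀)) (T : D ≃ₜ D) : Prop where
  proj : ∀ x, p (T x) = p x
  base : T d₀ = (hp.isCoveringMap.monodromy γ.unop ⟨d₀, rfl⟩ : p ⁻¹' {p d₀}).1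

variable [IsManifold 𝓘(ℝ, ℂ) ∞ S]

/-- `f = f_h`: the orientation preserving isometry from `D` with the metric `p^* h` onto the unit
disk with the Poincaré metric, normalised by `f d₀ = 0` and `df(v) ∈ ℝ⁺` for a
fixed tangent vector `v` at `d₀`. (By the isometry condition the differential of `f` is invertible
everywhere, so that `f` is a diffeomorphism onto the disk.) -/
structure IsNormalizedIsometry (p : D → S) (h : SurfaceMetric S) (d₀ : D)
    (v : TangentSpace 𝓘(ℝ, ℂ) d₀) (f : D → ℂ) : Prop where
  smooth : ContMDiff 𝓘(ℝ, ℂ) 𝓘(ℝ, ℂ) ∞ f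
  bijOn : Set.BijOn f Set.univ (Metric.ball 0 1)
  isometry : ∀ x a b, poincareForm (f x) (surfDeriv f x a) (surfDeriv f x b) =
    h.val (p x) (surfDeriv p x a) (surfDeriv p x b)
  orientation : IsOrientationPreserving f
  base : f d₀ = 0
  direction : ∃ r : ℝ, 0 < r ∧ surfDeriv f d₀ v = (r : ℂ)

/-- `ρ` is the holonomy homomorphism of `h`: for every `γ`, the element `ρ γ` of `PSU(1,1)` acts on
the disk as `f ∘ T_γ ∘ f⁻¹`, where `f` is the normalised isometry of `h`. -/
def IsHolonomy {p : D → S} (hp : IsUniversalCovering p) (d₀ : D) (v : TangentSpace 𝓘(ℝ, ℂ) d₀)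
    (h : Hyp S) (ρ : PiOne S (p d₀) →* PSU11) : Prop :=
  ∃ f : D → ℂ, IsNormalizedIsometry p h.1 d₀ v f ∧
    ∀ γ, ∃ T : D ≃ₜ D, IsCoveringTransformation hp d₀ γ T ∧ ∀ x, f (T x) = (ρ γ).act (f x)

end Holonomy

end

noncomputable section

/-! ### The action of `PSU(1,1)` on the disk -/

open ComplexConjugate

/-! The proof rests on the rigidity of the disk. Two germs of orientation preserving isometries into
the Poincaré disk, for the same metric, differ by a unique element of `PSU11`
(`IsDiskIsometryAt.exists_act_eq`, `PSU11.eq_of_act_comp_eventuallyEq`). Indeed, one germ composed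
with the inverse of the other is holomorphic; once translations make it fix the origin, the equality
case of the Schwarz lemma turns it into a rotation.

Existence of `f_h`: a metric of curvature -1 is locally the metric induced on the hyperboloid of
Minkowski space. The Gauss formula is a linear system for the frame `(u, ∂₀u, ∂₁u)`, and it is
integrable because of metric compatibility and the curvature condition
(`exists_local_isometry_plane`). On the simply connected `D` the local isometries differ by a
locally constant cocycle, which splits, so they glue to a developing map (`exists_developing_map`).
Completeness allows the rays of the disk to be lifted, and the endpoints of the lifts invert the
developing map (`bijOn_ball_of_isComplete`). An element of `PSU11` achieves the normalisation. If
`T` is a covering transformation, `f_h ∘ T` is an isometry for the same metric, and rigidity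
produces the holonomy element.

Well-definedness: if `h₁ = φ^* h₂`, lifting a homotopy from the identity to `φ` gives a lift `ψ` of
`φ` that commutes with all covering transformations. Rigidity gives `f₂ ∘ ψ = g ∘ f₁`, and this `g`
conjugates the holonomies.

Injectivity: if `ρ₂ = g ρ₁ g⁻¹`, the maps `g ∘ f₁` and `f₂` have the same equivariance, so `ψ = f₂⁻¹
∘ g ∘ f₁` commutes with covering transformations and descends to an isometry `φ` of `S`. Moving
points along the geodesics of the disk, which `PSU11` permutes, is an equivariant homotopy from the
identity to `ψ`; it descends too, and `φ` is homotopic to the identity. -/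

/-- Since `det A = 1`, the adjugate is the inverse, and the relation `Aᴴ J A = J` becomes `Aᴴ J = J
adj A`. The first row of this identity is the claim. -/
lemma SU11.apply_one_one (A : SU11) : A.1 1 1 = conj (A.1 0 0) ∧ A.1 1 0 = conj (A.1 0 1) := by
  have hA : (A.1 : Matrix (Fin 2) (Fin 2) ℂ)ᴴ * formJ * A.1 = formJ := A.2
  have h1 : (A.1 : Matrix (Fin 2) (Fin 2) ℂ) * (A.1 : Matrix (Fin 2) (Fin 2) ℂ).adjugate = 1 := by
    rw [Matrix.mul_adjugate, A.1.det_coe, one_smul]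
  have h2 : (A.1 : Matrix (Fin 2) (Fin 2) ℂ)ᴴ * formJ =
      formJ * (A.1 : Matrix (Fin 2) (Fin 2) ℂ).adjugate := by
    calc _ = (A.1 : Matrix (Fin 2) (Fin 2) ℂ)ᴴ * formJ *
          ((A.1 : Matrix (Fin 2) (Fin 2) ℂ) * (A.1 : Matrix (Fin 2) (Fin 2) ℂ).adjugate) := by
          rw [h1, Matrix.mul_one]
      _ = _ := by rw [← Matrix.mul_assoc, hA]
  have e00 := congrFun (congrFun h2 0) 0
  have e01 := congrFun (congrFun h2 0) 1
  simp [formJ, Matrix.mul_apply, Fin.sum_univ_two, Matrix.adjugate_fin_two] at e00 e01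
  refine ⟨e00.symm, ?_⟩
  have := congrArg conj e01
  simpa using this

/-- The normal form through which explicit computations with the action pass, free of the choice of
sign in the quotient. -/
lemma PSU11.exists_rep (g : PSU11) : ∃ a b : ℂ, ‖a‖ ^ 2 - ‖b‖ ^ 2 = 1 ∧
    ∀ z, g.act z = (a * z + b) / (conj b * z + conj a) := by
  induction g using QuotientGroup.induction_on with
  | H A =>
    obtain ⟨h1, h2⟩ := SU11.apply_one_one A
    refine ⟨A.1 0 0, A.1 0 1, ?_, fun z => ?_⟩
    · have := A.1.det_coe
      rw [Matrix.det_fin_two, h1, h2, Complex.mul_conj, Complex.mul_conj,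
        Complex.normSq_eq_norm_sq, Complex.normSq_eq_norm_sq] at this
      exact_mod_cast this
    · rw [← h1, ← h2]; rfl

lemma PSU11.exists_of_coeff (a b : ℂ) (h : ‖a‖ ^ 2 - ‖b‖ ^ 2 = 1) :
    ∃ g : PSU11, ∀ z, g.act z = (a * z + b) / (conj b * z + conj a) := by
  have h' : a * conj a - b * conj b = 1 := by
    rw [Complex.mul_conj, Complex.mul_conj, Complex.normSq_eq_norm_sq, Complex.normSq_eq_norm_sq]
    exact_mod_cast h
  let A : Matrix.SpecialLinearGroup (Fin 2) ℂ :=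
    ⟨!![a, b; conj b, conj a], by rw [Matrix.det_fin_two_of]; exact h'⟩
  have hA : A ∈ SU11 := by
    change (!![a, b; conj b, conj a] : Matrix (Fin 2) (Fin 2) ℂ)ᴴ * formJ *
      !![a, b; conj b, conj a] = formJ
    ext i j
    fin_cases i <;> fin_cases j <;>
      simp [formJ, Matrix.mul_apply, Fin.sum_univ_two] <;>
      first | linear_combination h' | linear_combination -h' | ring
  exact ⟨QuotientGroup.mk ⟨A, hA⟩, fun z => rfl⟩

/-- A zero would give `‖a‖ = ‖b‖ ‖z‖ ≤ ‖b‖`, against `‖a‖ ^ 2 - ‖b‖ ^ 2 = 1`. -/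
lemma disk_denom_ne_zero {a b z : ℂ} (h : ‖a‖ ^ 2 - ‖b‖ ^ 2 = 1) (hz : ‖z‖ < 1) :
    conj b * z + conj a ≠ 0 := by
  intro h0
  have h1 : conj a = -(conj b * z) := by linear_combination h0
  have h2 : ‖a‖ = ‖b‖ * ‖z‖ := by
    rw [← Complex.norm_conj a, h1, norm_neg, norm_mul, Complex.norm_conj]
  rw [h2] at h
  nlinarith [mul_nonneg (sq_nonneg ‖b‖) (by nlinarith [norm_nonneg z] : (0 : ℝ) ≤ 1 - ‖z‖ ^ 2)]

lemma disk_one_sub {a b z : ℂ} (h : ‖a‖ ^ 2 - ‖b‖ ^ 2 = 1) (hz : ‖z‖ < 1) :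
    1 - ‖(a * z + b) / (conj b * z + conj a)‖ ^ 2 =
      (1 - ‖z‖ ^ 2) / ‖conj b * z + conj a‖ ^ 2 := by
  have h0 : ‖conj b * z + conj a‖ ^ 2 ≠ 0 := by
    simpa using disk_denom_ne_zero h hz
  rw [norm_div, div_pow, eq_div_iff h0, sub_mul, div_mul_cancel₀ _ h0]
  rw [← Complex.normSq_eq_norm_sq, ← Complex.normSq_eq_norm_sq] at *
  rw [← Complex.normSq_eq_norm_sq] at *
  simp only [Complex.normSq_apply, Complex.add_re, Complex.add_im, Complex.mul_re, Complex.mul_im,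
    Complex.conj_re, Complex.conj_im] at *
  linear_combination (1 - (z.re * z.re + z.im * z.im)) * h

/-- The last clause is equality in the Schwarz–Pick inequality, that is, the invariance of the
Poincaré metric; it is used in this form from here on. -/
lemma PSU11.hasDerivAt_act (g : PSU11) {z : ℂ} (hz : ‖z‖ < 1) :
    ∃ c : ℂ, c ≠ 0 ∧ HasDerivAt g.act c z ∧
      1 - ‖g.act z‖ ^ 2 = ‖c‖ * (1 - ‖z‖ ^ 2) := by
  obtain ⟨a, b, h, hg⟩ := g.exists_rep
  have h0 := disk_denom_ne_zero h hz
  have h' : a * conj a - b * conj b = 1 := by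
    rw [Complex.mul_conj, Complex.mul_conj, Complex.normSq_eq_norm_sq, Complex.normSq_eq_norm_sq]
    exact_mod_cast h
  refine ⟨1 / (conj b * z + conj a) ^ 2, by simpa using h0, ?_, ?_⟩
  · have e : g.act = fun z => (a * z + b) / (conj b * z + conj a) := funext hg
    rw [e]
    have h1 : HasDerivAt (fun z => a * z + b) a z := by
      simpa using ((hasDerivAt_id z).const_mul a).add_const b
    have h2 : HasDerivAt (fun z => conj b * z + conj a) (conj b) z := by
      simpa using ((hasDerivAt_id z).const_mul (conj b)).add_const (conj a)
    refine (h1.div h2 h0).congr_deriv ?_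
    congr 1
    linear_combination h'
  · rw [hg, disk_one_sub h hz, norm_div, norm_one, norm_pow]
    ring

lemma PSU11.norm_act_lt (g : PSU11) {z : ℂ} (hz : ‖z‖ < 1) : ‖g.act z‖ < 1 := by
  obtain ⟨c, hc, -, h⟩ := g.hasDerivAt_act hz
  have h1 : 0 < ‖c‖ * (1 - ‖z‖ ^ 2) :=
    mul_pos (by simpa using hc) (by nlinarith [norm_nonneg z])
  rw [← h] at h1
  nlinarith [norm_nonneg (g.act z)]

lemma PSU11.act_one (z : ℂ) : (1 : PSU11).act z = z := by
  change moebius ((1 : SU11).1 : Matrix (Fin 2) (Fin 2) ℂ) z = z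
  simp [moebius]

lemma div_comp_div {K : Type*} [Field K] {a b c d a' b' c' d' z : K} (hB : c' * z + d' ≠ 0) :
    ((a * a' + b * c') * z + (a * b' + b * d')) / ((c * a' + d * c') * z + (c * b' + d * d')) =
      (a * ((a' * z + b') / (c' * z + d')) + b) / (c * ((a' * z + b') / (c' * z + d')) + d) := by
  rw [← mul_div_mul_right (a * ((a' * z + b') / (c' * z + d')) + b) _ hB]
  congr 1
  · linear_combination -a * div_mul_cancel₀ (a' * z + b') hB
  · linear_combination -c * div_mul_cancel₀ (a' * z + b') hB

/-- Confined to the disk: outside it a denominator may vanish, and division by zero then spoils the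
composition rule. -/
lemma PSU11.act_mul (g h : PSU11) {z : ℂ} (hz : ‖z‖ < 1) :
    (g * h).act z = g.act (h.act z) := by
  induction g using QuotientGroup.induction_on with
  | H A =>
  induction h using QuotientGroup.induction_on with
  | H B =>
    have key : ∀ (C : SU11) (w : ℂ), ‖w‖ < 1 → C.1 1 0 * w + C.1 1 1 ≠ 0 := by
      intro C w hw'
      obtain ⟨h1, h2⟩ := SU11.apply_one_one C
      rw [h1, h2]
      refine disk_denom_ne_zero ?_ hw'
      have := C.1.det_coe
      rw [Matrix.det_fin_two, h1, h2, Complex.mul_conj, Complex.mul_conj,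
        Complex.normSq_eq_norm_sq, Complex.normSq_eq_norm_sq] at this
      exact_mod_cast this
    change moebius ((A * B : SU11).1 : Matrix (Fin 2) (Fin 2) ℂ) z =
      moebius A.1 (moebius B.1 z)
    have hB := key B z hz
    simp only [moebius, Subgroup.coe_mul, Matrix.SpecialLinearGroup.coe_mul, Matrix.mul_apply,
      Fin.sum_univ_two] at *
    exact div_comp_div hB

lemma PSU11.act_inv_act (g : PSU11) {z : ℂ} (hz : ‖z‖ < 1) : g⁻¹.act (g.act z) = z := by
  rw [← PSU11.act_mul _ _ hz, inv_mul_cancel, PSU11.act_one]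

lemma PSU11.act_act_inv (g : PSU11) {z : ℂ} (hz : ‖z‖ < 1) : g.act (g⁻¹.act z) = z := by
  rw [← PSU11.act_mul _ _ hz, mul_inv_cancel, PSU11.act_one]

/-- Fixed points are roots of `c z² + (d - a) z - b`. Infinitely many of them force this polynomial
to vanish, so the matrix is scalar, and determinant one leaves `±1`. -/
lemma PSU11.eq_one_of_act {g : PSU11} {z : ℂ} (hz : ‖z‖ < 1)
    (h : ∀ᶠ w in 𝓝 z, g.act w = w) : g = 1 := by
  induction g using QuotientGroup.induction_on with
  | H A =>
    obtain ⟨h1, h2⟩ := SU11.apply_one_one A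
    have hdet := A.1.det_coe
    rw [Matrix.det_fin_two] at hdet
    have hn : ‖A.1 0 0‖ ^ 2 - ‖A.1 0 1‖ ^ 2 = 1 := by
      have := hdet
      rw [h1, h2, Complex.mul_conj, Complex.mul_conj,
        Complex.normSq_eq_norm_sq, Complex.normSq_eq_norm_sq] at this
      exact_mod_cast this
    have hlt : ∀ᶠ w in 𝓝 z, ‖w‖ < 1 := (continuous_norm.tendsto z).eventually_lt_const hz
    let P : Polynomial ℂ := Polynomial.C (A.1 1 0) * Polynomial.X ^ 2 +
      Polynomial.C (A.1 1 1 - A.1 0 0) * Polynomial.X + Polynomial.C (-A.1 0 1)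
    have hP : P = 0 := by
      apply Polynomial.eq_zero_of_infinite_isRoot
      refine Set.Infinite.mono ?_ (infinite_of_mem_nhds z (h.and hlt))
      rintro w ⟨hw, hw1⟩
      have hd := disk_denom_ne_zero hn hw1
      rw [← h1, ← h2] at hd
      change (A.1 0 0 * w + A.1 0 1) / (A.1 1 0 * w + A.1 1 1) = w at hw
      rw [div_eq_iff hd] at hw
      simp [P, Polynomial.IsRoot]
      linear_combination -hw
    have c2 := congrArg (fun p => Polynomial.coeff p 2) hP
    have c1 := congrArg (fun p => Polynomial.coeff p 1) hP
    have c0 := congrArg (fun p => Polynomial.coeff p 0) hP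
    simp [P, Polynomial.coeff_X, Polynomial.coeff_C, Polynomial.coeff_X_pow] at c2 c1 c0
    rw [QuotientGroup.eq_one_iff]
    have hs : (A.1 0 0 - 1) * (A.1 0 0 + 1) = 0 := by
      rw [c0, sub_eq_zero.1 c1] at hdet
      linear_combination hdet
    rcases mul_eq_zero.1 hs with hs | hs
    · left
      ext i j
      fin_cases i <;> fin_cases j
      · simpa using sub_eq_zero.1 hs
      · simpa using c0
      · simpa using c2
      · simp [sub_eq_zero.1 c1, sub_eq_zero.1 hs]
    · right
      ext i j
      fin_cases i <;> fin_cases j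
      · simpa using eq_neg_of_add_eq_zero_left hs
      · simpa using c0
      · simpa using c2
      · simp [sub_eq_zero.1 c1, eq_neg_of_add_eq_zero_left hs]

lemma PSU11.eq_of_act {g h : PSU11} {z : ℂ} (hz : ‖z‖ < 1)
    (H : ∀ᶠ w in 𝓝 z, g.act w = h.act w) : g = h := by
  have : h⁻¹ * g = 1 := by
    apply PSU11.eq_one_of_act hz
    filter_upwards [H, (continuous_norm.tendsto z).eventually_lt_const hz] with w hw hw1
    rw [PSU11.act_mul _ _ hw1, hw, h.act_inv_act hw1]
  exact (inv_mul_eq_one.1 this).symm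

/-- The rotation by `c ^ 2` composed with the translation sending `w` to the origin. -/
lemma PSU11.exists_translate {w : ℂ} (hw : ‖w‖ < 1) {c : ℂ} (hc : ‖c‖ = 1) :
    ∃ g : PSU11, ∀ z, ‖z‖ < 1 → g.act z = c ^ 2 * ((z - w) / (1 - conj w * z)) := by
  have hpos : 0 < 1 - ‖w‖ ^ 2 := by nlinarith [norm_nonneg w]
  set s : ℝ := √(1 - ‖w‖ ^ 2) with hs
  have hs0 : 0 < s := Real.sqrt_pos.2 hpos
  have hs2 : s ^ 2 = 1 - ‖w‖ ^ 2 := Real.sq_sqrt hpos.le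
  -- Division by `s = √(1 - ‖w‖ ^ 2)` makes the determinant one. The factor `c ^ 2` of the rotation
  -- appears as `c / conj c`.
  obtain ⟨g, hg⟩ := PSU11.exists_of_coeff (c / s) (-(c * w) / s) (by
    simp only [norm_div, norm_neg, norm_mul, hc, Complex.norm_real, Real.norm_eq_abs,
      abs_of_pos hs0]
    field_simp
    rw [hs2])
  refine ⟨g, fun z hz => ?_⟩
  have hcc : c * conj c = 1 := by
    rw [Complex.mul_conj, Complex.normSq_eq_norm_sq, hc]; norm_num
  have hc0 : conj c ≠ 0 := right_ne_zero_of_mul (hcc ▸ one_ne_zero)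
  have hsc : (s : ℂ) ≠ 0 := by exact_mod_cast hs0.ne'
  have hd : 1 - conj w * z ≠ 0 := by
    intro h0
    have h1 : ‖conj w * z‖ = 1 := by rw [← sub_eq_zero.1 h0, norm_one]
    rw [norm_mul, Complex.norm_conj] at h1
    nlinarith [norm_nonneg w, norm_nonneg z]
  rw [hg]
  have e1 : conj (-(c * w) / (s : ℂ)) * z + conj (c / (s : ℂ)) =
      conj c / s * (1 - conj w * z) := by
    simp only [map_div₀, map_neg, map_mul, Complex.conj_ofReal]
    ring
  have e2 : c / s * z + -(c * w) / s = c / s * (z - w) := by ring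
  rw [e1, e2, mul_div_mul_comm]
  congr 1
  rw [div_div_div_cancel_right₀ hsc, div_eq_iff hc0]
  linear_combination -c * hcc

/-- The translation of `w` to the origin followed by a rotation by `c ^ 2` has derivative `c ^ 2 /
(1 - ‖w‖ ^ 2)` at `w`. Taking for `c` a square root of `conj u / ‖u‖` turns `u` into a positive real
number. -/
lemma PSU11.exists_normalize {w : ℂ} (hw : ‖w‖ < 1) {u : ℂ} (hu : u ≠ 0) :
    ∃ g : PSU11, g.act w = 0 ∧ ∀ c, HasDerivAt g.act c w → ∃ r : ℝ, 0 < r ∧ c * u = r := by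
  obtain ⟨c, hc⟩ : ∃ c : ℂ, c ^ 2 = conj u / ‖u‖ := IsAlgClosed.exists_pow_nat_eq _ two_pos
  have hu' : ‖u‖ ≠ 0 := by simpa using hu
  have hc1 : ‖c‖ = 1 := by
    have := congrArg norm hc
    rw [norm_pow, norm_div, Complex.norm_conj, Complex.norm_real, norm_norm, div_self hu'] at this
    nlinarith [norm_nonneg c]
  obtain ⟨g, hg⟩ := PSU11.exists_translate hw hc1
  have hpos : 0 < 1 - ‖w‖ ^ 2 := by nlinarith [norm_nonneg w]
  have hw2 : (1 - conj w * w : ℂ) = ((1 - ‖w‖ ^ 2 : ℝ) : ℂ) := by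
    rw [mul_comm, Complex.mul_conj, Complex.normSq_eq_norm_sq]; push_cast; ring
  have hne : (1 - conj w * w : ℂ) ≠ 0 := by rw [hw2]; exact_mod_cast hpos.ne'
  refine ⟨g, by rw [hg w hw]; simp, fun d hd => ?_⟩
  have hd' : HasDerivAt g.act (c ^ 2 * (1 / (1 - conj w * w))) w := by
    have h1 : HasDerivAt (fun z : ℂ => z - w) 1 w := (hasDerivAt_id w).sub_const w
    have h2 : HasDerivAt (fun z => 1 - conj w * z) (-conj w) w := by
      simpa using ((hasDerivAt_id w).const_mul (conj w)).const_sub 1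
    have h3 := (h1.div h2 hne).const_mul (c ^ 2)
    refine (h3.congr_deriv ?_).congr_of_eventuallyEq ?_
    · field_simp; ring
    · filter_upwards [(continuous_norm.tendsto w).eventually_lt_const hw] with z hz
      exact hg z hz
  refine ⟨‖u‖ / (1 - ‖w‖ ^ 2), by positivity, ?_⟩
  rw [hd.unique hd', hc, hw2]
  have : conj u * u = (‖u‖ : ℂ) ^ 2 := by
    rw [mul_comm, Complex.mul_conj, Complex.normSq_eq_norm_sq]; push_cast; ring
  have hu'' : (‖u‖ : ℂ) ≠ 0 := by exact_mod_cast hu'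
  rw [Complex.ofReal_div, div_mul_div_comm, mul_one, div_mul_eq_mul_div, this]
  rw [hw2] at hne
  field_simp

/-! ### Differentials of maps between surfaces -/

section SurfDeriv

variable {M N P : Type*} [TopologicalSpace M] [ChartedSpace ℂ M]
  [TopologicalSpace N] [ChartedSpace ℂ N] [TopologicalSpace P] [ChartedSpace ℂ P]

lemma surfDeriv_comp_at {g : N → P} {f : M → N} (x : M)
    (hg : MDifferentiableAt 𝓘(ℝ, ℂ) 𝓘(ℝ, ℂ) g (f x))
    (hf : MDifferentiableAt 𝓘(ℝ, ℂ) 𝓘(ℝ, ℂ) f x) :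
    surfDeriv (g ∘ f) x = (surfDeriv g (f x)).comp (surfDeriv f x) :=
  mfderiv_comp x hg hf

lemma surfDeriv_congr {f g : M → N} {x : M} (h : f =ᶠ[𝓝 x] g) : surfDeriv f x = surfDeriv g x :=
  h.mfderiv_eq

lemma surfDeriv_eq_fderiv (f : ℂ → ℂ) (z : ℂ) : surfDeriv f z = fderiv ℝ f z :=
  mfderiv_eq_fderiv

lemma surfDeriv_eq_id {f : M → M} {x : M} (h : f =ᶠ[𝓝 x] id) :
    surfDeriv f x = ContinuousLinearMap.id ℝ ℂ := by
  rw [surfDeriv_congr h]; exact mfderiv_id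

lemma ContMDiffAt.mdiffAt {f : M → N} {x : M} (h : ContMDiffAt 𝓘(ℝ, ℂ) 𝓘(ℝ, ℂ) ∞ f x) :
    MDifferentiableAt 𝓘(ℝ, ℂ) 𝓘(ℝ, ℂ) f x :=
  h.mdifferentiableAt (by simp)

end SurfDeriv

lemma clm_det_eq (L : ℂ →L[ℝ] ℂ) :
    L.det = (L 1).re * (L Complex.I).im - (L 1).im * (L Complex.I).re := by
  change LinearMap.det (L : ℂ →ₗ[ℝ] ℂ) = _
  rw [← LinearMap.det_toMatrix Complex.basisOneI, Matrix.det_fin_two]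
  simp [LinearMap.toMatrix_apply]
  ring

lemma clm_apply_eq (L : ℂ →L[ℝ] ℂ) (v : ℂ) : L v = v.re * L 1 + v.im * L Complex.I := by
  conv_lhs => rw [← Complex.re_add_im v, map_add, mul_comm (v.im : ℂ)]
  have h1 : L (v.re : ℂ) = v.re * L 1 := by
    have := L.map_smul v.re 1
    simpa using this
  have h2 : L (Complex.I * (v.im : ℂ)) = v.im * L Complex.I := by
    have := L.map_smul v.im Complex.I
    simpa [mul_comm] using this
  rw [h1, h2]

/-- An orientation preserving conformal linear map is the multiplication by a complex number. -/
lemma exists_mul_of_conformal {L : ℂ →L[ℝ] ℂ} (hL : 0 < L.det) {k : ℝ}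
    (h : ∀ a b, inner ℝ (L a) (L b) = k * inner ℝ a b) :
    ∃ c : ℂ, ‖c‖ ^ 2 = k ∧ ∀ v, L v = c * v := by
  have h11 := h 1 1
  have h1I := h 1 Complex.I
  have hII := h Complex.I Complex.I
  rw [clm_det_eq] at hL
  simp only [Complex.inner, Complex.mul_re, Complex.conj_re, Complex.conj_im, map_one,
    Complex.one_re, Complex.one_im, Complex.I_re, Complex.I_im] at h11 h1I hII
  set p := (L 1).re
  set q := (L 1).im
  set r := (L Complex.I).re
  set s := (L Complex.I).im
  have hpq : 0 < p ^ 2 + q ^ 2 := by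
    rcases eq_or_ne p 0 with hp | hp
    · rcases eq_or_ne q 0 with hq | hq
      · rw [hp, hq] at hL; simp at hL
      · positivity
    · positivity
  have e1 : p * r + q * s = 0 := by linarith
  have e2 : p * p + q * q = r * r + s * s := by linarith
  -- By Lagrange's identity the determinant is `±(p ^ 2 + q ^ 2)`. Positive orientation selects the
  -- plus sign and so excludes the antilinear case.
  have hk : p ^ 2 + q ^ 2 = p * s - q * r := by
    have : (p * s - q * r) ^ 2 = (p ^ 2 + q ^ 2) ^ 2 := by
      linear_combination (-(p * r + q * s)) * e1 - (p ^ 2 + q ^ 2) * e2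
    exact ((pow_left_inj₀ hL.le hpq.le two_ne_zero).1 this).symm
  have hr : r = -q := by
    have : (p ^ 2 + q ^ 2) * (r + q) = 0 := by
      linear_combination p * e1 + q * hk
    rcases mul_eq_zero.1 this with h0 | h0
    · exact absurd h0 hpq.ne'
    · linarith
  have hs : s = p := by
    have : (p ^ 2 + q ^ 2) * (s - p) = 0 := by
      linear_combination q * e1 - p * hk
    rcases mul_eq_zero.1 this with h0 | h0
    · exact absurd h0 hpq.ne'
    · linarith
  refine ⟨L 1, ?_, fun v => ?_⟩
  · rw [← Complex.normSq_eq_norm_sq, Complex.normSq_apply]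
    linarith
  · have : L Complex.I = Complex.I * L 1 := by
      apply Complex.ext
      · simpa using hr
      · simpa using hs
    rw [clm_apply_eq, this]
    conv_rhs => rw [← Complex.re_add_im v]
    ring

/-! ### The inverse function theorem on surfaces -/

section Inverse

variable {M : Type*} [TopologicalSpace M] [ChartedSpace ℂ M]

/-- The inverse function theorem, restricted to an open set where the derivative stays invertible,
so that the inverse is smooth on its whole domain and not only at `F z`. -/
lemma isLocalDiffeomorphAt_of_det_ne_zero_plane {F : ℂ → ℂ} {z : ℂ}
    (h : ∀ᶠ w in 𝓝 z, ContDiffAt ℝ ∞ F w ∧ (fderiv ℝ F w).det ≠ 0) :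
    IsLocalDiffeomorphAt 𝓘(ℝ, ℂ) 𝓘(ℝ, ℂ) ∞ F z := by
  obtain ⟨W, hW, hWo, hzW⟩ := eventually_nhds_iff.1 h
  have key : ∀ w (hw : w ∈ W), HasFDerivAt F
      (((fderiv ℝ F w).toContinuousLinearEquivOfDetNeZero (hW w hw).2 : ℂ ≃L[ℝ] ℂ) : ℂ →L[ℝ] ℂ)
      w := by
    intro w hw
    rw [ContinuousLinearMap.coe_toContinuousLinearEquivOfDetNeZero]
    exact ((hW w hw).1.differentiableAt (by simp)).hasFDerivAt
  let e := ((hW z hzW).1.toOpenPartialHomeomorph F (key z hzW) (by simp)).restrOpen W hWo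
  have hsrc : ∀ w ∈ e.source, w ∈ W := fun w hw => by
    rw [OpenPartialHomeomorph.restrOpen_source] at hw
    exact hw.2
  refine ⟨⟨e.toPartialEquiv, e.open_source, e.open_target, ?_, ?_⟩, ?_, fun w _ => rfl⟩
  · intro w hw
    exact ((hW w (hsrc w hw)).1.contMDiffAt).contMDiffWithinAt
  · intro w hw
    have hw' : e.symm w ∈ W := hsrc _ (e.map_target hw)
    exact ((e.contDiffAt_symm hw (key _ hw') (hW _ hw').1).contMDiffAt).contMDiffWithinAt
  · change z ∈ e.source
    rw [OpenPartialHomeomorph.restrOpen_source]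
    exact ⟨ContDiffAt.mem_toOpenPartialHomeomorph_source _ _ _, hzW⟩

variable [IsManifold 𝓘(ℝ, ℂ) ∞ M]

lemma contMDiffAt_chart {e : OpenPartialHomeomorph M ℂ} (he : e ∈ atlas ℂ M) {x : M}
    (hx : x ∈ e.source) : ContMDiffAt 𝓘(ℝ, ℂ) 𝓘(ℝ, ℂ) ∞ e x :=
  (contMDiffOn_of_mem_maximalAtlas
    (IsManifold.subset_maximalAtlas he)).contMDiffAt (e.open_source.mem_nhds hx)

lemma contMDiffAt_chart_symm {e : OpenPartialHomeomorph M ℂ} (he : e ∈ atlas ℂ M) {z : ℂ}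
    (hz : z ∈ e.target) : ContMDiffAt 𝓘(ℝ, ℂ) 𝓘(ℝ, ℂ) ∞ e.symm z :=
  (contMDiffOn_symm_of_mem_maximalAtlas
    (IsManifold.subset_maximalAtlas he)).contMDiffAt (e.open_target.mem_nhds hz)

lemma isLocalDiffeomorphAt_chart {e : OpenPartialHomeomorph M ℂ} (he : e ∈ atlas ℂ M) {x : M}
    (hx : x ∈ e.source) : IsLocalDiffeomorphAt 𝓘(ℝ, ℂ) 𝓘(ℝ, ℂ) ∞ e x :=
  ⟨⟨e.toPartialEquiv, e.open_source, e.open_target,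
    fun _ hy => (contMDiffAt_chart he hy).contMDiffWithinAt,
    fun _ hy => (contMDiffAt_chart_symm he hy).contMDiffWithinAt⟩, hx, fun _ _ => rfl⟩

lemma surfDeriv_chart_comp_symm {e : OpenPartialHomeomorph M ℂ} (he : e ∈ atlas ℂ M) {z : ℂ}
    (hz : z ∈ e.target) :
    (surfDeriv e (e.symm z)).comp (surfDeriv e.symm z) = ContinuousLinearMap.id ℝ ℂ := by
  rw [← surfDeriv_comp_at z (contMDiffAt_chart he (e.map_target hz)).mdiffAt
    (contMDiffAt_chart_symm he hz).mdiffAt]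
  apply surfDeriv_eq_id
  filter_upwards [e.open_target.mem_nhds hz] with w hw using e.right_inv hw

lemma isLocalDiffeomorphAt_of_det_ne_zero {f : M → ℂ} {x : M}
    (h : ∀ᶠ y in 𝓝 x, ContMDiffAt 𝓘(ℝ, ℂ) 𝓘(ℝ, ℂ) ∞ f y ∧ (surfDeriv f y).det ≠ 0) :
    IsLocalDiffeomorphAt 𝓘(ℝ, ℂ) 𝓘(ℝ, ℂ) ∞ f x := by
  set e := chartAt ℂ x
  have he : e ∈ atlas ℂ M := chart_mem_atlas ℂ x
  have hx : x ∈ e.source := mem_chart_source ℂ x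
  have h1 : ∀ᶠ w in 𝓝 (e x), ContDiffAt ℝ ∞ (f ∘ e.symm) w ∧
      (fderiv ℝ (f ∘ e.symm) w).det ≠ 0 := by
    have ht : Filter.Tendsto e.symm (𝓝 (e x)) (𝓝 x) := e.tendsto_symm hx
    filter_upwards [ht.eventually h, e.open_target.mem_nhds (e.map_source hx)] with w hw hwt
    have hs := contMDiffAt_chart_symm he hwt
    refine ⟨contMDiffAt_iff_contDiffAt.1 (hw.1.comp w hs), ?_⟩
    rw [← surfDeriv_eq_fderiv, surfDeriv_comp_at w hw.1.mdiffAt hs.mdiffAt, det_comp']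
    refine mul_ne_zero hw.2 fun h0 => ?_
    have := congrArg ContinuousLinearMap.det (surfDeriv_chart_comp_symm he hwt)
    rw [det_comp', det_id', h0, mul_zero] at this
    exact zero_ne_one this
  have h2 := (isLocalDiffeomorphAt_chart he hx).comp (K := 𝓘(ℝ, ℂ)) (P := ℂ)
    (isLocalDiffeomorphAt_of_det_ne_zero_plane h1)
  obtain ⟨Φ, hΦ, hE⟩ := h2
  -- The composite `(f ∘ e.symm) ∘ e` equals `f` only on the source of the chart.
  let Ψ := Φ.toOpenPartialHomeomorph.restrOpen e.source e.open_source
  refine ⟨⟨Ψ.toPartialEquiv, Ψ.open_source, Ψ.open_target,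
    Φ.contMDiffOn_toFun.mono ?_, Φ.contMDiffOn_invFun.mono ?_⟩, ?_, ?_⟩
  · intro y hy; exact hy.1
  · intro y hy; exact hy.1
  · exact ⟨hΦ, hx⟩
  · intro y hy
    have := hE hy.1
    simp only [Function.comp_apply, e.left_inv hy.2] at this
    exact this

end Inverse

/-! ### Local isometries to the disk and their rigidity -/

/-- The map `f` is near `x` a smooth, orientation preserving map to the unit disk, pulling the
Poincaré metric back to the bilinear form `Q` at the point `x`. -/
structure IsDiskIsometryAt {M : Type*} [TopologicalSpace M] [ChartedSpace ℂ M]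
    (Q : M → ℂ → ℂ → ℝ) (f : M → ℂ) (x : M) : Prop where
  smooth : ContMDiffAt 𝓘(ℝ, ℂ) 𝓘(ℝ, ℂ) ∞ f x
  norm_lt : ‖f x‖ < 1
  det_pos : 0 < (surfDeriv f x).det
  isometry : ∀ a b, poincareForm (f x) (surfDeriv f x a) (surfDeriv f x b) = Q x a b

section DiskIsometry

variable {M N : Type*} [TopologicalSpace M] [ChartedSpace ℂ M]
  [TopologicalSpace N] [ChartedSpace ℂ N] {Q : M → ℂ → ℂ → ℝ}

lemma IsDiskIsometryAt.congr {f g : M → ℂ} {x : M} (hf : IsDiskIsometryAt Q f x)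
    (h : f =ᶠ[𝓝 x] g) : IsDiskIsometryAt Q g x := by
  have h1 := surfDeriv_congr h
  have h2 := h.eq_of_nhds
  exact ⟨hf.smooth.congr_of_eventuallyEq h.symm, h2 ▸ hf.norm_lt, h1 ▸ hf.det_pos,
    fun a b => by rw [← h1, ← h2]; exact hf.isometry a b⟩

lemma IsDiskIsometryAt.comp {f : M → ℂ} {ψ : N → M} {y : N} (hf : IsDiskIsometryAt Q f (ψ y))
    (hψ : ContMDiffAt 𝓘(ℝ, ℂ) 𝓘(ℝ, ℂ) ∞ ψ y) (hdet : 0 < (surfDeriv ψ y).det) :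
    IsDiskIsometryAt (fun y a b => Q (ψ y) (surfDeriv ψ y a) (surfDeriv ψ y b)) (f ∘ ψ) y where
  smooth := hf.smooth.comp y hψ
  norm_lt := hf.norm_lt
  det_pos := by
    rw [surfDeriv_comp_at y hf.smooth.mdiffAt hψ.mdiffAt, det_comp']
    exact mul_pos hf.det_pos hdet
  isometry a b := by
    rw [surfDeriv_comp_at y hf.smooth.mdiffAt hψ.mdiffAt, ← hf.isometry]
    rfl

/-- The factor `‖c‖ ^ 2` gained by the inner product cancels the change of the conformal factor. -/
lemma poincareForm_mul {z w c : ℂ} (hz : ‖z‖ < 1) (hc : c ≠ 0)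
    (h : 1 - ‖w‖ ^ 2 = ‖c‖ * (1 - ‖z‖ ^ 2)) (a b : ℂ) :
    poincareForm w (c * a) (c * b) = poincareForm z a b := by
  have h1 : inner ℝ (c * a) (c * b) = ‖c‖ ^ 2 * inner ℝ a b := by
    rw [← Complex.normSq_eq_norm_sq]
    simp only [Complex.inner, Complex.normSq_apply, Complex.mul_re, Complex.mul_im,
      Complex.conj_re, Complex.conj_im, map_mul]
    ring
  have h2 : ‖c‖ ≠ 0 := by simpa using hc
  have h3 : 1 - ‖z‖ ^ 2 ≠ 0 := by nlinarith [norm_nonneg z]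
  rw [poincareForm, poincareForm, h, h1]
  field_simp

lemma HasDerivAt.fderiv_real_apply {h : ℂ → ℂ} {c z : ℂ} (hc : HasDerivAt h c z) (v : ℂ) :
    fderiv ℝ h z v = c * v := by
  rw [(hc.hasFDerivAt.restrictScalars ℝ).fderiv]
  simp [mul_comm]

lemma det_pos_of_mul {L : ℂ →L[ℝ] ℂ} {c : ℂ} (hc : c ≠ 0) (h : ∀ v, L v = c * v) :
    0 < L.det := by
  rw [clm_det_eq, h, h]
  simp only [Complex.mul_re, Complex.mul_im, Complex.one_re, Complex.one_im, Complex.I_re,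
    Complex.I_im]
  have : 0 < Complex.normSq c := Complex.normSq_pos.2 hc
  rw [Complex.normSq_apply] at this
  linarith

lemma PSU11.contDiffAt_act (g : PSU11) {z : ℂ} (hz : ‖z‖ < 1) : ContDiffAt ℝ ∞ g.act z := by
  obtain ⟨a, b, h, hg⟩ := g.exists_rep
  rw [show g.act = _ from funext hg]
  have h1 : ∀ c d : ℂ, ContDiff ℂ ∞ fun z => c * z + d := fun c d => by fun_prop
  exact ((h1 a b).contDiffAt.fun_div (h1 _ _).contDiffAt (disk_denom_ne_zero h hz)).restrict_scalars ℝ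

lemma IsDiskIsometryAt.act_comp (g : PSU11) {f : M → ℂ} {x : M} (hf : IsDiskIsometryAt Q f x) :
    IsDiskIsometryAt Q (g.act ∘ f) x := by
  obtain ⟨c, hc, hd, he⟩ := g.hasDerivAt_act hf.norm_lt
  have hg := (g.contDiffAt_act hf.norm_lt).contMDiffAt
  have hL : ∀ v, surfDeriv g.act (f x) v = c * v := fun v => by
    rw [surfDeriv_eq_fderiv, hd.fderiv_real_apply]
  have hcomp := surfDeriv_comp_at x hg.mdiffAt hf.smooth.mdiffAt
  refine ⟨hg.comp x hf.smooth, g.norm_act_lt hf.norm_lt, ?_, fun a b => ?_⟩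
  · rw [hcomp, det_comp']
    exact mul_pos (det_pos_of_mul hc hL) hf.det_pos
  · rw [hcomp, ContinuousLinearMap.comp_apply, ContinuousLinearMap.comp_apply, hL, hL,
      Function.comp_apply, poincareForm_mul hf.norm_lt hc he, hf.isometry]

/-- A germ of a holomorphic isometry of the disk fixing the origin is a rotation. -/
lemma eventually_eq_mul_of_isometry {h : ℂ → ℂ} (h0 : h 0 = 0)
    (hh : ∀ᶠ z in 𝓝 (0 : ℂ), ‖h z‖ < 1 ∧ ∃ c, HasDerivAt h c z ∧
      1 - ‖h z‖ ^ 2 = ‖c‖ * (1 - ‖z‖ ^ 2)) :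
    ∃ c : ℂ, ‖c‖ = 1 ∧ ∀ᶠ z in 𝓝 0, h z = c * z := by
  obtain ⟨r', hr', hball'⟩ := Metric.eventually_nhds_iff_ball.1 hh
  set r := min r' 1 with hr
  have hr0 : 0 < r := lt_min hr' one_pos
  have hball : ∀ z : ℂ, ‖z‖ < r → ‖h z‖ < 1 ∧ ∃ c, HasDerivAt h c z ∧
      1 - ‖h z‖ ^ 2 = ‖c‖ * (1 - ‖z‖ ^ 2) := fun z hz =>
    hball' z (by simpa using hz.trans_le (min_le_left _ _))
  choose! hlt d hd hnorm using hball
  have hz1 : ∀ z : ℂ, ‖z‖ < r → ‖z‖ < 1 := fun z hz => hz.trans_le (min_le_right _ _)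
  have key : ∀ z : ℂ, ‖z‖ < r → ‖h z‖ ≤ ‖z‖ := by
    intro z hz
    rcases eq_or_ne z 0 with rfl | hz0
    · simp [h0]
    have hzpos : 0 < ‖z‖ := norm_pos_iff.2 hz0
    -- The bound is propagated along the radius to `z`. Where `‖h (t z)‖ = K t ‖z‖` the value is at
    -- least as large as `‖t z‖`, so the isometry relation gives `‖d (t z)‖ ≤ 1 < K` and the norm
    -- cannot cross the line. The strict `K > 1` supplies the strict inequality this comparison
    -- needs; afterwards `K` tends to one.
    have claim : ∀ K : ℝ, 1 < K → ‖h z‖ ≤ K * ‖z‖ := by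
      intro K hK
      have htz : ∀ t ∈ Set.Icc (0 : ℝ) 1, ‖(t : ℂ) * z‖ < r := by
        intro t ht
        rw [norm_mul, Complex.norm_real, Real.norm_of_nonneg ht.1]
        exact (mul_le_of_le_one_left hzpos.le ht.2).trans_lt hz
      have hder : ∀ t ∈ Set.Icc (0 : ℝ) 1,
          HasDerivAt (fun t : ℝ => h (t * z)) (d (t * z) * z) t := by
        intro t ht
        have h1 : HasDerivAt (fun t : ℝ => (t : ℂ) * z) z t := by
          simpa using (Complex.ofRealCLM.hasDerivAt (x := t)).mul_const z
        exact (hd _ (htz t ht)).comp t h1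
      have := image_norm_le_of_norm_deriv_right_lt_deriv_boundary (a := 0) (b := 1)
        (f := fun t : ℝ => h (t * z)) (f' := fun t => d (t * z) * z)
        (fun t ht => (hder t ht).continuousAt.continuousWithinAt)
        (fun t ht => (hder t (Set.Ico_subset_Icc_self ht)).hasDerivWithinAt)
        (B := fun t => t * (K * ‖z‖)) (B' := fun _ => K * ‖z‖) (by simp [h0])
        (fun t => by simpa using (hasDerivAt_id t).mul_const (K * ‖z‖)) ?_
        (Set.right_mem_Icc.2 zero_le_one)
      · simpa using this
      · intro t ht hB
        have ht' := Set.Ico_subset_Icc_self ht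
        have e := hnorm _ (htz t ht')
        rw [hB] at e
        have h2 := hz1 _ (htz t ht')
        have h3 : ‖(t : ℂ) * z‖ = t * ‖z‖ := by
          rw [norm_mul, Complex.norm_real, Real.norm_of_nonneg ht.1]
        rw [h3] at e h2
        have h4 : ‖d (t * z)‖ ≤ 1 := by
          have h5 : 0 ≤ t * ‖z‖ := mul_nonneg ht.1 hzpos.le
          by_contra hcon
          have h6 : (t * ‖z‖) ^ 2 ≤ (t * (K * ‖z‖)) ^ 2 := by
            apply pow_le_pow_left₀ h5
            nlinarith
          have h7 : (t * ‖z‖) ^ 2 < 1 := by nlinarith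
          nlinarith [mul_pos (sub_pos.2 (not_le.1 hcon)) (sub_pos.2 h7)]
        rw [norm_mul]
        nlinarith
    refine le_of_forall_pos_le_add fun ε hε => ?_
    have := claim (1 + ε / ‖z‖) (by linarith [div_pos hε hzpos])
    rwa [add_mul, one_mul, div_mul_cancel₀ _ hzpos.ne'] at this
  -- At the origin the isometry relation reads `1 = ‖d 0‖`; this is the equality case of the Schwarz
  -- lemma, in which the map is affine.
  have hd0 : ‖d 0‖ = 1 := by
    have := hnorm 0 (by simpa using hr0)
    simpa [h0] using this.symm
  obtain ⟨C, hC, hE⟩ := Complex.affine_of_mapsTo_ball_of_exists_norm_dslope_eq_div' (f := h)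
    (c := 0) (R₁ := r) (R₂ := r)
    (fun z hz => ((hd z (by simpa using hz)).differentiableAt).differentiableWithinAt)
    (fun z hz => by
      have hz' : ‖z‖ < r := by simpa using hz
      simpa [h0] using (key z hz').trans hz'.le)
    ⟨0, by simpa using hr0, by
      rw [dslope_same, (hd 0 (by simpa using hr0)).deriv, hd0, div_self hr0.ne']⟩
  refine ⟨C, by rw [hC, div_self hr0.ne'], ?_⟩
  filter_upwards [Metric.ball_mem_nhds (0 : ℂ) hr0] with z hz
  have := hE hz
  simpa [h0, mul_comm] using this

variable [IsManifold 𝓘(ℝ, ℂ) ∞ M]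

lemma IsDiskIsometryAt.isLocalDiffeomorphAt {f : M → ℂ} {x : M}
    (hf : ∀ᶠ y in 𝓝 x, IsDiskIsometryAt Q f y) :
    IsLocalDiffeomorphAt 𝓘(ℝ, ℂ) 𝓘(ℝ, ℂ) ∞ f x :=
  isLocalDiffeomorphAt_of_det_ne_zero (hf.mono fun _ hy => ⟨hy.smooth, hy.det_pos.ne'⟩)

/-- The transition map `f₂ ∘ f₁⁻¹` fixes the origin and is conformal and orientation preserving.
Hence it is holomorphic, with derivative of modulus the ratio of the conformal factors, and
`eventually_eq_mul_of_isometry` applies. -/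
lemma exists_act_eq_of_base_eq_zero {f₁ f₂ : M → ℂ} {x : M}
    (h₁ : ∀ᶠ y in 𝓝 x, IsDiskIsometryAt Q f₁ y) (h₂ : ∀ᶠ y in 𝓝 x, IsDiskIsometryAt Q f₂ y)
    (e₁ : f₁ x = 0) (e₂ : f₂ x = 0) :
    ∃ c : ℂ, ‖c‖ = 1 ∧ ∀ᶠ y in 𝓝 x, f₂ y = c * f₁ y := by
  have hloc := IsDiskIsometryAt.isLocalDiffeomorphAt h₁
  set s := hloc.localInverse with hs
  have hs0 : s (f₁ x) = x := hloc.localInverse_left_inv hloc.localInverse_mem_target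
  have hsm := hloc.localInverse_contMDiffAt
  have hsmooth : ∀ᶠ w in 𝓝 (0 : ℂ), ContMDiffAt 𝓘(ℝ, ℂ) 𝓘(ℝ, ℂ) ∞ s w := by
    have := hloc.localInverse_contMDiffOn
    filter_upwards [hloc.localInverse_open_source.mem_nhds (e₁ ▸ hloc.localInverse_mem_source)]
      with w hw
    exact this.contMDiffAt (hloc.localInverse_open_source.mem_nhds hw)
  have hright : ∀ᶠ w in 𝓝 (0 : ℂ), f₁ (s w) = w := by
    have := hloc.localInverse_eventuallyEq_right
    rw [e₁] at this
    exact this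
  have htend : Filter.Tendsto s (𝓝 0) (𝓝 x) := by
    have := hsm.continuousAt.tendsto
    rwa [← hs, hs0, e₁] at this
  obtain ⟨c, hc, hE⟩ := eventually_eq_mul_of_isometry (h := f₂ ∘ s)
    (by rw [Function.comp_apply, show s 0 = x from e₁ ▸ hs0, e₂]) (by
    filter_upwards [hsmooth, htend.eventually h₁, htend.eventually h₂,
      hright.eventually_nhds] with w hw1 hw2 hw3 hw4
    refine ⟨hw3.norm_lt, ?_⟩
    have k1 : (surfDeriv f₁ (s w)).comp (surfDeriv s w) = ContinuousLinearMap.id ℝ ℂ := by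
      rw [← surfDeriv_comp_at w hw2.smooth.mdiffAt hw1.mdiffAt]
      exact surfDeriv_eq_id hw4
    have k1' : ∀ a, surfDeriv f₁ (s w) (surfDeriv s w a) = a := fun a =>
      congrArg (fun L : ℂ →L[ℝ] ℂ => L a) k1
    have k2 := surfDeriv_comp_at w hw3.smooth.mdiffAt hw1.mdiffAt
    have hw : f₁ (s w) = w := hw4.self_of_nhds
    have hdet : 0 < (surfDeriv (f₂ ∘ s) w).det := by
      have := congrArg ContinuousLinearMap.det k1
      rw [det_comp', det_id'] at this
      rw [k2, det_comp']
      exact mul_pos hw3.det_pos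
        ((pos_iff_pos_of_mul_pos (this ▸ one_pos)).1 hw2.det_pos)
    have hwn : ‖w‖ < 1 := hw ▸ hw2.norm_lt
    have p1 : 0 < 1 - ‖w‖ ^ 2 := by nlinarith [norm_nonneg w]
    have p2 : 0 < 1 - ‖f₂ (s w)‖ ^ 2 := by nlinarith [norm_nonneg (f₂ (s w)), hw3.norm_lt]
    have hiso : ∀ a b, inner ℝ (surfDeriv (f₂ ∘ s) w a) (surfDeriv (f₂ ∘ s) w b) =
        ((1 - ‖f₂ (s w)‖ ^ 2) / (1 - ‖w‖ ^ 2)) ^ 2 * inner ℝ a b := by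
      intro a b
      have i1 := hw2.isometry (surfDeriv s w a) (surfDeriv s w b)
      rw [← hw3.isometry, k1', k1', hw, poincareForm, poincareForm] at i1
      rw [k2, ContinuousLinearMap.comp_apply, ContinuousLinearMap.comp_apply]
      field_simp at i1 ⊢
      linear_combination -i1
    obtain ⟨c, hc, hL⟩ := exists_mul_of_conformal hdet hiso
    have hc' : ‖c‖ = (1 - ‖f₂ (s w)‖ ^ 2) / (1 - ‖w‖ ^ 2) :=
      (pow_left_inj₀ (norm_nonneg _) (by positivity) two_ne_zero).1 hc
    refine ⟨c, ?_, ?_⟩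
    · have hdiff : DifferentiableAt ℝ (f₂ ∘ s) w :=
        mdifferentiableAt_iff_differentiableAt.1
          ((hw3.smooth.comp w hw1).mdiffAt)
      -- The real differential is multiplication by `c`, which is complex linear: this is the
      -- Cauchy–Riemann condition.
      rw [hasDerivAt_iff_hasFDerivAt]
      refine hasFDerivAt_of_restrictScalars ℝ hdiff.hasFDerivAt ?_
      ext v
      rw [← surfDeriv_eq_fderiv, hL]
      simp [mul_comm]
    · rw [hc', div_mul_cancel₀ _ p1.ne']; rfl)
  refine ⟨c, hc, ?_⟩
  have hcont : Filter.Tendsto f₁ (𝓝 x) (𝓝 0) := by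
    have := h₁.self_of_nhds.smooth.continuousAt.tendsto
    rwa [e₁] at this
  filter_upwards [hcont.eventually hE, hloc.localInverse_eventuallyEq_left] with y hy hy'
  have hy'' : s (f₁ y) = y := hy'
  rwa [Function.comp_apply, hy''] at hy

/-- Germs of orientation preserving isometries to the disk differ by an element of `PSU(1,1)`. -/
lemma IsDiskIsometryAt.exists_act_eq {f₁ f₂ : M → ℂ} {x : M}
    (h₁ : ∀ᶠ y in 𝓝 x, IsDiskIsometryAt Q f₁ y) (h₂ : ∀ᶠ y in 𝓝 x, IsDiskIsometryAt Q f₂ y) :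
    ∃ g : PSU11, ∀ᶠ y in 𝓝 x, f₂ y = g.act (f₁ y) := by
  obtain ⟨g₁, hg₁, -⟩ := PSU11.exists_normalize h₁.self_of_nhds.norm_lt one_ne_zero
  obtain ⟨g₂, hg₂, -⟩ := PSU11.exists_normalize h₂.self_of_nhds.norm_lt one_ne_zero
  obtain ⟨c, hc, hE⟩ := exists_act_eq_of_base_eq_zero (h₁.mono fun y hy => hy.act_comp g₁)
    (h₂.mono fun y hy => hy.act_comp g₂) hg₁ hg₂
  -- `PSU11.exists_translate` rotates by the square of its parameter.
  obtain ⟨k, hk⟩ : ∃ k : ℂ, k ^ 2 = c := IsAlgClosed.exists_pow_nat_eq _ two_pos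
  have hk1 : ‖k‖ = 1 := by
    have := congrArg norm hk
    rw [norm_pow, hc] at this
    nlinarith [norm_nonneg k]
  obtain ⟨ρ, hρ⟩ := PSU11.exists_translate (w := 0) (by simp) hk1
  refine ⟨g₂⁻¹ * (ρ * g₁), ?_⟩
  filter_upwards [hE, h₁, h₂] with y hy hy1 hy2
  have n1 := g₁.norm_act_lt hy1.norm_lt
  rw [PSU11.act_mul _ _ hy1.norm_lt, PSU11.act_mul _ _ hy1.norm_lt, hρ _ n1, hk]
  simp only [Function.comp_apply] at hy
  simp only [sub_zero, map_zero, zero_mul, div_one]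
  rw [← hy, g₂.act_inv_act hy2.norm_lt]

/-- An isometry is a local diffeomorphism, so agreement near `x` is agreement on an open set of the
disk, where an element of `PSU11` is determined. -/
lemma PSU11.eq_of_act_comp_eventuallyEq {f : M → ℂ} {x : M} {g h : PSU11}
    (hf : ∀ᶠ y in 𝓝 x, IsDiskIsometryAt Q f y) (H : ∀ᶠ y in 𝓝 x, g.act (f y) = h.act (f y)) :
    g = h := by
  have hloc := IsDiskIsometryAt.isLocalDiffeomorphAt hf
  refine PSU11.eq_of_act hf.self_of_nhds.norm_lt ?_
  have hs0 : hloc.localInverse (f x) = x :=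
    hloc.localInverse_left_inv hloc.localInverse_mem_target
  have htend : Filter.Tendsto hloc.localInverse (𝓝 (f x)) (𝓝 x) := by
    have := hloc.localInverse_contMDiffAt.continuousAt.tendsto
    rwa [hs0] at this
  filter_upwards [htend.eventually H, hloc.localInverse_eventuallyEq_right] with w hw hw'
  have hw'' : f (hloc.localInverse w) = w := hw'
  rwa [hw''] at hw

end DiskIsometry

/-! ### Linear total differential equations -/

section TotalDifferential

variable {E : Type*} [NormedAddCommGroup E] [NormedSpace ℝ E]
  {R : Type*} [NormedRing R] [NormedAlgebra ℝ R]

lemma exists_linear_ode_solution [CompleteSpace R] {B : ℝ → R}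
    (hB : ContinuousOn B (Set.Icc 0 1)) (hK : ∀ t ∈ Set.Icc (0 : ℝ) 1, ‖B t‖ ≤ 1 / 2) (y₀ : R) :
    ∃ y : ℝ → R, y 0 = y₀ ∧
      ∀ t ∈ Set.Icc (0 : ℝ) 1, HasDerivWithinAt y (B t * y t) (Set.Icc 0 1) t := by
  -- On the ball of radius `‖y₀‖` about `y₀` the norm is at most `2 * ‖y₀‖`, so the speed is at most
  -- `‖y₀‖`. The solution therefore stays in the ball for time one, and the interval need not be
  -- shortened.
  have hp : IsPicardLindelof (fun t y => B t * y)
      (⟨0, Set.left_mem_Icc.2 zero_le_one⟩ : Set.Icc (0 : ℝ) 1) y₀ ‖y₀‖₊ 0 ‖y₀‖₊ (1 / 2) := by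
    refine ⟨fun t ht => ?_, fun x _ => hB.mul continuousOn_const, fun t ht x hx => ?_, ?_⟩
    · refine LipschitzOnWith.of_dist_le_mul fun x _ y _ => ?_
      rw [dist_eq_norm, dist_eq_norm, ← mul_sub]
      refine (norm_mul_le _ _).trans ?_
      gcongr
      simpa using hK t ht
    · have h1 : ‖x‖ ≤ 2 * ‖y₀‖ := by
        have : ‖x - y₀‖ ≤ ‖y₀‖ := by simpa [dist_eq_norm] using hx
        linarith [norm_le_norm_add_norm_sub' x y₀]
      calc ‖B t * x‖ ≤ ‖B t‖ * ‖x‖ := norm_mul_le _ _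
        _ ≤ 1 / 2 * (2 * ‖y₀‖) := by
            gcongr
            exact hK t ht
        _ = _ := by simp
    · simp
  exact hp.exists_eq_forall_mem_Icc_hasDerivWithinAt₀

lemma hasDerivWithinAt_Ici_of_Icc {F : Type*} [NormedAddCommGroup F] [NormedSpace ℝ F]
    {y : ℝ → F} {y' : F} {t : ℝ} (ht : t ∈ Set.Ico (0 : ℝ) 1)
    (h : HasDerivWithinAt y y' (Set.Icc 0 1) t) : HasDerivWithinAt y y' (Set.Ici t) t :=
  h.mono_of_mem_nhdsWithin (Icc_mem_nhdsGE_of_mem ht)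

/-- Differentiability with respect to a parameter, uniformly over a compact interval. -/
lemma eventually_uniform_differentiable {F : Type*} [NormedAddCommGroup F] [NormedSpace ℝ F]
    {β : ℝ → E → F} {β' : ℝ → E → E →L[ℝ] F} {x : E} {U : Set E} (hU : U ∈ 𝓝 x)
    (hβ : ∀ t ∈ Set.Icc (0 : ℝ) 1, ∀ y ∈ U, HasFDerivAt (β t) (β' t y) y)
    (hβ' : ∀ t ∈ Set.Icc (0 : ℝ) 1, ContinuousAt (fun q : E × ℝ => β' q.2 q.1) (x, t))
    {η : ℝ} (hη : 0 < η) :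
    ∀ᶠ w in 𝓝 (0 : E), ∀ t ∈ Set.Icc (0 : ℝ) 1,
      ‖β t (x + w) - β t x - β' t x w‖ ≤ η * ‖w‖ := by
  have h1 : ∀ᶠ y in 𝓝 x, ∀ t ∈ Set.Icc (0 : ℝ) 1, ‖β' t y - β' t x‖ < η := by
    refine isCompact_Icc.eventually_forall_of_forall_eventually fun t ht => ?_
    have hc := hβ' t ht
    have hc2 : ContinuousAt (fun q : E × ℝ => β' q.2 x) (x, t) := by
      have : ContinuousAt (fun q : E × ℝ => (x, q.2)) (x, t) := by fun_prop
      exact ContinuousAt.comp (g := fun q : E × ℝ => β' q.2 q.1) (by exact hc) this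
    have h3 := (hc.sub hc2).norm
    have h4 : Filter.Tendsto (fun q : E × ℝ => ‖β' q.2 q.1 - β' q.2 x‖) (𝓝 (x, t)) (𝓝 0) := by
      have := h3.tendsto
      simpa using this
    exact h4.eventually_lt_const hη
  obtain ⟨r, hr, hball⟩ := Metric.eventually_nhds_iff_ball.1 (h1.and hU)
  filter_upwards [Metric.ball_mem_nhds (0 : E) hr] with w hw t ht
  have hxw : x + w ∈ Metric.ball x r := by simpa using hw
  have := (convex_ball x r).norm_image_sub_le_of_norm_hasFDerivWithin_le' (f := β t)
    (f' := fun y => β' t y) (φ := β' t x) (C := η)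
    (fun y hy => (hβ t ht y (hball y hy).2).hasFDerivWithinAt)
    (fun y hy => ((hball y hy).1 t ht).le) (Metric.mem_ball_self hr) hxw
  simpa using this

set_option maxHeartbeats 800000 in
/-- A linear total differential equation `dY = A Y` with vanishing curvature has a solution near
any point, with any prescribed value at the point. -/
theorem exists_solution_total_differential [CompleteSpace R] {A : E → E →L[ℝ] R} {z₀ : E}
    {r : ℝ} (hr : 0 < r) (hA : ∀ z ∈ Metric.ball z₀ r, ContDiffAt ℝ 1 A z)
    (hflat : ∀ z ∈ Metric.ball z₀ r, ∀ u v,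
      fderiv ℝ A z u v - fderiv ℝ A z v u = A z u * A z v - A z v * A z u) :
    ∃ ρ, 0 < ρ ∧ ρ ≤ r ∧ ∀ y₀ : R, ∃ Y : E → R, Y z₀ = y₀ ∧
      ∀ z ∈ Metric.ball z₀ ρ, HasFDerivAt Y (((ContinuousLinearMap.mul ℝ R).flip (Y z)).comp (A z)) z := by
  have hcont : ContinuousAt A z₀ := (hA z₀ (Metric.mem_ball_self hr)).continuousAt
  obtain ⟨r₁, hr₁, hM⟩ := Metric.eventually_nhds_iff_ball.1
    (hcont.norm.eventually_lt_const (lt_add_one ‖A z₀‖))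
  set M := ‖A z₀‖ + 1 with hMdef
  have hM0 : 0 < M := by positivity
  -- On this ball `‖A‖ ≤ M`, and the coefficient `A (z₀ + t • x) x` of the equation along a ray has
  -- norm at most `1 / 2`, as `exists_linear_ode_solution` requires.
  set ρ := min r (min r₁ (1 / (2 * M))) with hρ
  have hρ0 : 0 < ρ := lt_min hr (lt_min hr₁ (by positivity))
  refine ⟨ρ, hρ0, min_le_left _ _, fun y₀ => ?_⟩
  have hmem : ∀ x ∈ Metric.ball (0 : E) ρ, ∀ t ∈ Set.Icc (0 : ℝ) 1,
      z₀ + t • x ∈ Metric.ball z₀ ρ := by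
    intro x hx t ht
    have hx' : ‖x‖ < ρ := by simpa using hx
    have : ‖t • x‖ < ρ := by
      rw [norm_smul, Real.norm_of_nonneg ht.1]
      exact (mul_le_of_le_one_left (norm_nonneg _) ht.2).trans_lt hx'
    simpa using this
  have hAd : ∀ z ∈ Metric.ball z₀ ρ, ContDiffAt ℝ 1 A z := fun z hz =>
    hA z (Metric.ball_subset_ball (min_le_left _ _) hz)
  have hAn : ∀ z ∈ Metric.ball z₀ ρ, ‖A z‖ ≤ M := fun z hz =>
    (hM z (Metric.ball_subset_ball ((min_le_right _ _).trans (min_le_left _ _)) hz)).le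
  -- the equation along the rays
  let β : ℝ → E → R := fun t x => A (z₀ + t • x) x
  have hβn : ∀ x ∈ Metric.ball (0 : E) ρ, ∀ t ∈ Set.Icc (0 : ℝ) 1, ‖β t x‖ ≤ 1 / 2 := by
    intro x hx t ht
    have hx' : ‖x‖ ≤ 1 / (2 * M) := by
      have h1 : ‖x‖ < ρ := by simpa using hx
      exact h1.le.trans ((min_le_right _ _).trans (min_le_right _ _))
    calc ‖β t x‖ ≤ ‖A (z₀ + t • x)‖ * ‖x‖ := (A (z₀ + t • x)).le_opNorm x
      _ ≤ M * (1 / (2 * M)) := by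
          gcongr
          exact hAn _ (hmem x hx t ht)
      _ = 1 / 2 := by field_simp
  have hAray : ∀ x ∈ Metric.ball (0 : E) ρ, ∀ t ∈ Set.Icc (0 : ℝ) 1,
      HasDerivAt (fun t : ℝ => A (z₀ + t • x)) (fderiv ℝ A (z₀ + t • x) x) t := by
    intro x hx t ht
    have h1 := ((hAd _ (hmem x hx t ht)).differentiableAt one_ne_zero).hasFDerivAt
    have h2 : HasDerivAt (fun t : ℝ => z₀ + t • x) x t := by
      simpa using ((hasDerivAt_id t).smul_const x).const_add z₀
    exact h1.comp_hasDerivAt t h2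
  have hsol : ∀ x ∈ Metric.ball (0 : E) ρ, ∃ y : ℝ → R, y 0 = y₀ ∧
      ∀ t ∈ Set.Icc (0 : ℝ) 1, HasDerivWithinAt y (β t x * y t) (Set.Icc 0 1) t := by
    intro x hx
    refine exists_linear_ode_solution (fun t ht => ?_) (hβn x hx) y₀
    exact ((hAray x hx t ht).continuousAt.clm_apply continuousAt_const).continuousWithinAt
  choose! y hy0 hy using hsol
  -- The value at `z` is found by integrating along the segment from `z₀`. It remains to see that
  -- the differential is right in directions across the ray.
  refine ⟨fun z => y (z - z₀) 1, ?_, fun z hz => ?_⟩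
  · have h0 : (0 : E) ∈ Metric.ball (0 : E) ρ := Metric.mem_ball_self hρ0
    change y (z₀ - z₀) 1 = y₀
    rw [sub_self, ← hy0 0 h0]
    have := constant_of_has_deriv_right_zero (f := y 0) (a := 0) (b := 1)
      (fun t ht => (hy 0 h0 t ht).continuousWithinAt) (fun t ht => by
        have := hasDerivWithinAt_Ici_of_Icc ht (hy 0 h0 t (Set.Ico_subset_Icc_self ht))
        simpa [β] using this)
    exact this 1 (Set.right_mem_Icc.2 zero_le_one)
  obtain ⟨x, rfl⟩ : ∃ x, z = z₀ + x := ⟨z - z₀, by abel⟩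
  have hx : x ∈ Metric.ball (0 : E) ρ := by simpa using hz
  let β' : ℝ → E → E →L[ℝ] R := fun t x =>
    A (z₀ + t • x) + t • ((fderiv ℝ A (z₀ + t • x)).flip x)
  have hβ' : ∀ t ∈ Set.Icc (0 : ℝ) 1, ∀ x ∈ Metric.ball (0 : E) ρ,
      HasFDerivAt (β t) (β' t x) x := by
    intro t ht x hx
    have h1 := ((hAd _ (hmem x hx t ht)).differentiableAt one_ne_zero).hasFDerivAt
    have h2 : HasFDerivAt (fun x : E => z₀ + t • x) (t • ContinuousLinearMap.id ℝ E) x := by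
      simpa using ((hasFDerivAt_id x).const_smul t).const_add z₀
    refine ((h1.comp x h2).clm_apply (hasFDerivAt_id x)).congr_fderiv ?_
    ext w
    simp [β']
  have hβ'c : ∀ t ∈ Set.Icc (0 : ℝ) 1,
      ContinuousAt (fun q : E × ℝ => β' q.2 q.1) (x, t) := by
    intro t ht
    have h0 : ContinuousAt (fun q : E × ℝ => z₀ + q.2 • q.1) (x, t) := by fun_prop
    have hz := hAd _ (hmem x hx t ht)
    have h1 : ContinuousAt (fun q : E × ℝ => A (z₀ + q.2 • q.1)) (x, t) :=
      ContinuousAt.comp (f := fun q : E × ℝ => z₀ + q.2 • q.1) (by exact hz.continuousAt) h0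
    have h2 : ContinuousAt (fun q : E × ℝ => fderiv ℝ A (z₀ + q.2 • q.1)) (x, t) :=
      ContinuousAt.comp (f := fun q : E × ℝ => z₀ + q.2 • q.1)
        (by exact (hz.fderiv_right (m := 0) (by simp)).continuousAt) h0
    have h3 : ContinuousAt (fun q : E × ℝ => (fderiv ℝ A (z₀ + q.2 • q.1)).flip q.1) (x, t) := by
      have h4 : ContinuousAt (fun q : E × ℝ => (fderiv ℝ A (z₀ + q.2 • q.1)).flip) (x, t) :=
        (ContinuousLinearMap.flipₗᵢ ℝ E E R).continuous.continuousAt.comp h2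
      exact h4.clm_apply continuousAt_fst
    exact h1.add (continuousAt_snd.smul h3)
  -- bounds
  have hyc : ContinuousOn (y x) (Set.Icc 0 1) := fun t ht => (hy x hx t ht).continuousWithinAt
  obtain ⟨C, hC⟩ := isCompact_Icc.exists_bound_of_continuousOn hyc
  have hβ'cc : ContinuousOn (fun t => β' t x) (Set.Icc 0 1) := fun t ht => by
    have : ContinuousAt (fun t : ℝ => (x, t)) t := by fun_prop
    exact (ContinuousAt.comp (g := fun q : E × ℝ => β' q.2 q.1) (f := fun t : ℝ => (x, t))
      (hβ'c t ht) this).continuousWithinAt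
  obtain ⟨C', hC'⟩ := isCompact_Icc.exists_bound_of_continuousOn hβ'cc
  have h01 : (0 : ℝ) ∈ Set.Icc (0 : ℝ) 1 := Set.left_mem_Icc.2 zero_le_one
  have hC0 : 0 ≤ C := (norm_nonneg _).trans (hC 0 h01)
  have hC'0 : 0 ≤ C' := (norm_nonneg _).trans (hC' 0 h01)
  have hc0 : 0 < 2 * (Real.exp (1 / 2) - 1) := by
    have : 1 < Real.exp (1 / 2) := Real.one_lt_exp_iff.2 (by norm_num)
    linarith
  set c₀ := 2 * (Real.exp (1 / 2) - 1) with hc₀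
  rw [hasFDerivAt_iff_isLittleO_nhds_zero, Asymptotics.isLittleO_iff]
  intro ε hε
  -- choice of the small parameter
  set η := ε / (c₀ * (2 * C + 1)) with hη
  have hη0 : 0 < η := by positivity
  have hsmall : ∀ᶠ w in 𝓝 (0 : E), (C' + η) * ‖w‖ * M ≤ η := by
    have : Filter.Tendsto (fun w : E => (C' + η) * ‖w‖ * M) (𝓝 0) (𝓝 0) := by
      have : Continuous (fun w : E => (C' + η) * ‖w‖ * M) := by fun_prop
      simpa using this.tendsto 0
    exact (this.eventually_lt_const hη0).mono fun _ h => h.le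
  have hxw : ∀ᶠ w in 𝓝 (0 : E), x + w ∈ Metric.ball (0 : E) ρ := by
    have : Filter.Tendsto (fun w : E => x + w) (𝓝 0) (𝓝 x) := by
      have : Continuous (fun w : E => x + w) := by fun_prop
      simpa using this.tendsto 0
    exact this.eventually (Metric.isOpen_ball.mem_nhds hx)
  filter_upwards [eventually_uniform_differentiable (Metric.isOpen_ball.mem_nhds hx) hβ' hβ'c hη0,
    hsmall, hxw] with w hw hwsmall hxw
  let a : ℝ → E →L[ℝ] R := fun t => A (z₀ + t • x)
  -- `W` is the expected first variation of the ray solution in the direction `w`, and `W 1` is the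
  -- desired differential. The error `Δ` will be small compared with `w` by Grönwall.
  let W : ℝ → R := fun t => t • (a t w * y x t)
  let Δ : ℝ → R := fun t => y (x + w) t - y x t - W t
  have hW : ∀ t ∈ Set.Icc (0 : ℝ) 1,
      HasDerivWithinAt W (β' t x w * y x t + β t x * W t) (Set.Icc 0 1) t := by
    intro t ht
    have h1 : HasDerivWithinAt a (fderiv ℝ A (z₀ + t • x) x) (Set.Icc 0 1) t :=
      (hAray x hx t ht).hasDerivWithinAt
    have h2 := (h1.clm_apply (hasDerivWithinAt_const t _ w)).mul (hy x hx t ht)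
    have h3 := (hasDerivWithinAt_id t (Set.Icc (0 : ℝ) 1)).smul h2
    refine h3.congr_deriv ?_
    -- Flatness exchanges the directions `x` and `w` in the derivative of `A`; this is exactly what
    -- makes `W` a solution of the linearised equation.
    have hf := hflat _ (Metric.ball_subset_ball (min_le_left _ _) (hmem x hx t ht)) x w
    rw [sub_eq_iff_eq_add] at hf
    simp only [β', β, W, a, add_apply, smul_apply,
      ContinuousLinearMap.flip_apply, id, map_zero, add_zero, one_smul]
    rw [hf]
    simp only [add_mul, sub_mul, smul_mul_assoc, mul_smul_comm, smul_add, smul_sub, mul_assoc]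
    abel
  have hΔ : ∀ t ∈ Set.Icc (0 : ℝ) 1, HasDerivWithinAt Δ
      (β t (x + w) * y (x + w) t - β t x * y x t - (β' t x w * y x t + β t x * W t))
      (Set.Icc 0 1) t := fun t ht =>
    ((hy _ hxw t ht).sub (hy x hx t ht)).sub (hW t ht)
  have hbound : ∀ t ∈ Set.Icc (0 : ℝ) 1,
      ‖β t (x + w) * y (x + w) t - β t x * y x t - (β' t x w * y x t + β t x * W t)‖ ≤
        1 / 2 * ‖Δ t‖ + (2 * C) * η * ‖w‖ := by
    intro t ht
    have e : β t (x + w) * y (x + w) t - β t x * y x t - (β' t x w * y x t + β t x * W t) =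
        β t (x + w) * Δ t + (β t (x + w) - β t x - β' t x w) * y x t +
          (β t (x + w) - β t x) * W t := by
      simp only [Δ]
      noncomm_ring
    have n1 : ‖β t (x + w) * Δ t‖ ≤ 1 / 2 * ‖Δ t‖ :=
      (norm_mul_le _ _).trans (by gcongr; exact hβn _ hxw t ht)
    have n2 : ‖(β t (x + w) - β t x - β' t x w) * y x t‖ ≤ η * ‖w‖ * C :=
      (norm_mul_le _ _).trans (by
        gcongr
        · exact hw t ht
        · exact hC t ht)
    have n3 : ‖β t (x + w) - β t x‖ ≤ (C' + η) * ‖w‖ := by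
      calc ‖β t (x + w) - β t x‖
          = ‖(β t (x + w) - β t x - β' t x w) + β' t x w‖ := by rw [sub_add_cancel]
        _ ≤ η * ‖w‖ + C' * ‖w‖ := (norm_add_le _ _).trans (add_le_add (hw t ht)
            ((ContinuousLinearMap.le_opNorm _ _).trans (by gcongr; exact hC' t ht)))
        _ = _ := by ring
    have n4 : ‖W t‖ ≤ M * ‖w‖ * C := by
      calc ‖W t‖ ≤ 1 * ‖a t w * y x t‖ := by
            rw [norm_smul, Real.norm_of_nonneg ht.1]
            gcongr
            exact ht.2
        _ ≤ 1 * (‖a t‖ * ‖w‖ * ‖y x t‖) := by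
            gcongr
            exact (norm_mul_le _ _).trans (by gcongr; exact ContinuousLinearMap.le_opNorm _ _)
        _ ≤ 1 * (M * ‖w‖ * C) := by
            gcongr
            · exact hAn _ (hmem x hx t ht)
            · exact hC t ht
        _ = _ := one_mul _
    have n5 : ‖(β t (x + w) - β t x) * W t‖ ≤ η * ‖w‖ * C := by
      calc _ ≤ ‖β t (x + w) - β t x‖ * ‖W t‖ := norm_mul_le _ _
        _ ≤ ((C' + η) * ‖w‖) * (M * ‖w‖ * C) := by gcongr
        _ = ((C' + η) * ‖w‖ * M) * (‖w‖ * C) := by ring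
        _ ≤ η * (‖w‖ * C) := by gcongr
        _ = _ := by ring
    rw [e]
    calc _ ≤ 1 / 2 * ‖Δ t‖ + η * ‖w‖ * C + η * ‖w‖ * C :=
          (norm_add_le _ _).trans (add_le_add ((norm_add_le _ _).trans (add_le_add n1 n2)) n5)
      _ = _ := by ring
  have hG := norm_le_gronwallBound_of_norm_deriv_right_le (f := Δ) (δ := 0) (K := 1 / 2)
    (ε := (2 * C) * η * ‖w‖) (a := 0) (b := 1)
    (fun t ht => (hΔ t ht).continuousWithinAt)
    (fun t ht => hasDerivWithinAt_Ici_of_Icc ht (hΔ t (Set.Ico_subset_Icc_self ht)))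
    (by simp [Δ, W, hy0 _ hxw, hy0 x hx])
    (fun t ht => hbound t (Set.Ico_subset_Icc_self ht)) 1 (Set.right_mem_Icc.2 zero_le_one)
  rw [gronwallBound_of_K_ne_0 (by norm_num)] at hG
  have e1 : y (z₀ + x + w - z₀) 1 - y (z₀ + x - z₀) 1 -
      (((ContinuousLinearMap.mul ℝ R).flip (y (z₀ + x - z₀) 1)).comp (A (z₀ + x))) w = Δ 1 := by
    have a1 : z₀ + x + w - z₀ = x + w := by abel
    have a2 : z₀ + x - z₀ = x := by abel
    rw [a1, a2]
    simp [Δ, W, a]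
  rw [e1]
  refine hG.trans ?_
  beta_reduce
  have : (0 : ℝ) * Real.exp (1 / 2 * (1 - 0)) +
      2 * C * η * ‖w‖ / (1 / 2) * (Real.exp (1 / 2 * (1 - 0)) - 1) =
      (2 * C) * η * ‖w‖ * c₀ := by
    rw [hc₀]; ring_nf
  rw [this]
  have h2 : 2 * C * η * c₀ ≤ ε := by
    calc 2 * C * η * c₀ ≤ (2 * C + 1) * η * c₀ := by gcongr; linarith
      _ = ε := by rw [hη]; field_simp
  calc 2 * C * η * ‖w‖ * c₀ = 2 * C * η * c₀ * ‖w‖ := by ring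
    _ ≤ ε * ‖w‖ := by gcongr

/-- A function vanishing at the centre of a ball, whose differential is bounded by the function
itself, vanishes on the ball. -/
lemma eq_zero_of_norm_fderiv_le {V : Type*} [NormedAddCommGroup V] [NormedSpace ℝ V]
    {P : E → V} {P' : E → E →L[ℝ] V} {z₀ : E} {ρ K : ℝ}
    (hP : ∀ z ∈ Metric.ball z₀ ρ, HasFDerivAt P (P' z) z) (h0 : P z₀ = 0)
    (hK : ∀ z ∈ Metric.ball z₀ ρ, ‖P' z‖ ≤ K * ‖P z‖) : ∀ z ∈ Metric.ball z₀ ρ, P z = 0 := by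
  intro z hz
  obtain ⟨x, rfl⟩ : ∃ x, z = z₀ + x := ⟨z - z₀, by abel⟩
  have hx : ‖x‖ < ρ := by simpa using hz
  have hmem : ∀ t ∈ Set.Icc (0 : ℝ) 1, z₀ + t • x ∈ Metric.ball z₀ ρ := by
    intro t ht
    have : ‖t • x‖ < ρ := by
      rw [norm_smul, Real.norm_of_nonneg ht.1]
      exact (mul_le_of_le_one_left (norm_nonneg _) ht.2).trans_lt hx
    simpa using this
  have hd : ∀ t ∈ Set.Icc (0 : ℝ) 1,
      HasDerivAt (fun t : ℝ => P (z₀ + t • x)) (P' (z₀ + t • x) x) t := by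
    intro t ht
    have h2 : HasDerivAt (fun t : ℝ => z₀ + t • x) x t := by
      simpa using ((hasDerivAt_id t).smul_const x).const_add z₀
    exact (hP _ (hmem t ht)).comp_hasDerivAt t h2
  have := eq_zero_of_abs_deriv_le_mul_abs_self_of_eq_zero_right
    (f := fun t : ℝ => P (z₀ + t • x)) (f' := fun t => P' (z₀ + t • x) x) (K := K * ‖x‖)
    (a := 0) (b := 1) (fun t ht => (hd t ht).continuousAt.continuousWithinAt)
    (fun t ht => (hd t (Set.Ico_subset_Icc_self ht)).hasDerivWithinAt) (by simp [h0])
    (fun t ht => by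
      have ht' := hmem t (Set.Ico_subset_Icc_self ht)
      calc _ ≤ ‖P' (z₀ + t • x)‖ * ‖x‖ := ContinuousLinearMap.le_opNorm _ _
        _ ≤ K * ‖P (z₀ + t • x)‖ * ‖x‖ := by gcongr; exact hK _ ht'
        _ = _ := by ring) 1 (Set.right_mem_Icc.2 zero_le_one)
  simpa using this

end TotalDifferential

/-! ### Flat systems of linear equations in the plane -/

/-- A flat system `∂₀ Y = a₀ Y`, `∂₁ Y = a₁ Y` in a Banach algebra has solutions near any point. -/
lemma exists_solution_flat_system {R : Type*} [NormedRing R] [NormedAlgebra ℝ R] [CompleteSpace R]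
    {a₀ a₁ : ℂ → R} {z₀ : ℂ} {r : ℝ} (hr : 0 < r)
    (h₀ : ∀ z ∈ Metric.ball z₀ r, ContDiffAt ℝ ∞ a₀ z)
    (h₁ : ∀ z ∈ Metric.ball z₀ r, ContDiffAt ℝ ∞ a₁ z)
    (hflat : ∀ z ∈ Metric.ball z₀ r, fderiv ℝ a₁ z 1 - fderiv ℝ a₀ z Complex.I =
      a₀ z * a₁ z - a₁ z * a₀ z) :
    ∃ ρ, 0 < ρ ∧ ρ ≤ r ∧ ∀ y₀ : R, ∃ Y : ℂ → R, Y z₀ = y₀ ∧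
      ∀ z ∈ Metric.ball z₀ ρ, HasFDerivAt Y
        (Complex.reCLM.smulRight (a₀ z * Y z) + Complex.imCLM.smulRight (a₁ z * Y z)) z := by
  let T (e : ℂ →L[ℝ] ℝ) : R →L[ℝ] ℂ →L[ℝ] R := ContinuousLinearMap.smulRightL ℝ ℂ R e
  let A : ℂ → ℂ →L[ℝ] R := fun z => T Complex.reCLM (a₀ z) + T Complex.imCLM (a₁ z)
  have hA : ∀ z ∈ Metric.ball z₀ r, ContDiffAt ℝ 1 A z := fun z hz => by
    have c0 := (h₀ z hz).of_le (m := 1) (by simp)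
    have c1 := (h₁ z hz).of_le (m := 1) (by simp)
    exact ((T Complex.reCLM).contDiff.contDiffAt.comp z c0).add
      ((T Complex.imCLM).contDiff.contDiffAt.comp z c1)
  have hAapp : ∀ z u, A z u = u.re • a₀ z + u.im • a₁ z := fun z u => rfl
  have hAder : ∀ z ∈ Metric.ball z₀ r, ∀ u v, fderiv ℝ A z u v =
      v.re • fderiv ℝ a₀ z u + v.im • fderiv ℝ a₁ z u := by
    intro z hz u v
    have c0 := (h₀ z hz).differentiableAt (by simp)
    have c1 := (h₁ z hz).differentiableAt (by simp)
    have : HasFDerivAt A ((T Complex.reCLM).comp (fderiv ℝ a₀ z) +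
        (T Complex.imCLM).comp (fderiv ℝ a₁ z)) z :=
      ((T Complex.reCLM).hasFDerivAt.comp z c0.hasFDerivAt).add
        ((T Complex.imCLM).hasFDerivAt.comp z c1.hasFDerivAt)
    rw [this.fderiv]
    rfl
  have hlin : ∀ (L : ℂ →L[ℝ] R) (u : ℂ), L u = u.re • L 1 + u.im • L Complex.I := by
    intro L u
    rw [← map_smul, ← map_smul, ← map_add]
    congr 1
    apply Complex.ext <;> simp
  -- Both sides of the flatness condition are bilinear and alternating in `u, v`, so in the plane
  -- the single pair `1, I` suffices.
  obtain ⟨ρ, hρ, hρr, H⟩ := exists_solution_total_differential hr hA (by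
    intro z hz u v
    have key := hflat z hz
    rw [hAder z hz, hAder z hz, hAapp, hAapp, hlin (fderiv ℝ a₀ z) u, hlin (fderiv ℝ a₀ z) v,
      hlin (fderiv ℝ a₁ z) u, hlin (fderiv ℝ a₁ z) v]
    rw [sub_eq_iff_eq_add] at key
    rw [key]
    simp only [add_mul, mul_add, smul_mul_assoc, mul_smul_comm]
    module)
  refine ⟨ρ, hρ, hρr, fun Y₀ => ?_⟩
  obtain ⟨Y, hY0, hY⟩ := H Y₀
  refine ⟨Y, hY0, fun z hz => (hY z hz).congr_fderiv ?_⟩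
  ext1 u
  have e1 : (((ContinuousLinearMap.mul ℝ R).flip (Y z)).comp (A z)) u = A z u * Y z := rfl
  rw [e1, hAapp, add_mul, smul_mul_assoc, smul_mul_assoc]
  rfl

/-- The total differential equation is solved in a complete normed algebra. The isomorphism `e`
carries the matrix system there, and continuous linear functionals read the entries of the solution
back. -/
lemma exists_fundamental_matrix_of_algEquiv {n : Type*} [Fintype n] [DecidableEq n]
    {R : Type*} [NormedRing R] [NormedAlgebra ℝ R] [CompleteSpace R] [FiniteDimensional ℝ R]
    (e : Matrix n n ℝ ≃ₐ[ℝ] R)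
    {A₀ A₁ : ℂ → Matrix n n ℝ} {z₀ : ℂ} {r : ℝ}
    (hr : 0 < r) (h₀ : ∀ z ∈ Metric.ball z₀ r, ∀ i j, ContDiffAt ℝ ∞ (fun w => A₀ w i j) z)
    (h₁ : ∀ z ∈ Metric.ball z₀ r, ∀ i j, ContDiffAt ℝ ∞ (fun w => A₁ w i j) z)
    (hflat : ∀ z ∈ Metric.ball z₀ r, ∀ i j, partialD 0 (fun w => A₁ w i j) z -
      partialD 1 (fun w => A₀ w i j) z = (A₀ z * A₁ z - A₁ z * A₀ z) i j) :
    ∃ ρ, 0 < ρ ∧ ρ ≤ r ∧ ∀ Y₀ : Matrix n n ℝ, ∃ Y : ℂ → Matrix n n ℝ, Y z₀ = Y₀ ∧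
      ∀ z ∈ Metric.ball z₀ ρ, ∀ i j, HasFDerivAt (fun w => Y w i j)
        (∑ k, Y z k j • (A₀ z i k • Complex.reCLM + A₁ z i k • Complex.imCLM)) z := by
  have hlin : ∀ (f : ℂ → Matrix n n ℝ) z,
      e (f z) = ∑ i, ∑ j, f z i j • e (Matrix.single i j (1 : ℝ)) := by
    intro f z
    conv_lhs => rw [Matrix.matrix_eq_sum_single (f z)]
    simp_rw [map_sum, ← map_smul]
    simp
  have hsm : ∀ (f : ℂ → Matrix n n ℝ) z, (∀ i j, ContDiffAt ℝ ∞ (fun w => f w i j) z) →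
      ContDiffAt ℝ ∞ (fun w => e (f w)) z := by
    intro f z hf
    rw [funext (hlin f)]
    exact ContDiffAt.sum fun i _ => ContDiffAt.sum fun j _ => (hf i j).smul contDiffAt_const
  have hder : ∀ (f : ℂ → Matrix n n ℝ) z, (∀ i j, ContDiffAt ℝ ∞ (fun w => f w i j) z) →
      ∀ u, fderiv ℝ (fun w => e (f w)) z u =
        e (Matrix.of fun i j => fderiv ℝ (fun w => f w i j) z u) := by
    intro f z hf u
    have h : HasFDerivAt (fun w => ∑ i, ∑ j, f w i j • e (Matrix.single i j (1 : ℝ)))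
        (∑ i, ∑ j, (fderiv ℝ (fun w => f w i j) z).smulRight (e (Matrix.single i j (1 : ℝ)))) z :=
      HasFDerivAt.fun_sum fun i _ => HasFDerivAt.fun_sum fun j _ =>
        ((hf i j).differentiableAt (by simp)).hasFDerivAt.smul_const _
    rw [funext (hlin f), h.fderiv,
      hlin (fun _ => Matrix.of fun i j => fderiv ℝ (fun w => f w i j) z u) 0]
    simp only [sum_apply, ContinuousLinearMap.smulRight_apply, Matrix.of_apply]
  obtain ⟨ρ, hρ, hρr, H⟩ := exists_solution_flat_system (a₀ := fun z => e (A₀ z))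
    (a₁ := fun z => e (A₁ z)) hr
    (fun z hz => hsm A₀ z (h₀ z hz)) (fun z hz => hsm A₁ z (h₁ z hz))
    (fun z hz => by
      have key : (Matrix.of fun i j => fderiv ℝ (fun w => A₁ w i j) z 1) -
          (Matrix.of fun i j => fderiv ℝ (fun w => A₀ w i j) z Complex.I) =
          A₀ z * A₁ z - A₁ z * A₀ z := by
        ext i j
        exact hflat z hz i j
      rw [hder A₁ z (h₁ z hz), hder A₀ z (h₀ z hz), ← map_sub e, key, map_sub e, map_mul, map_mul])
  refine ⟨ρ, hρ, hρr, fun Y₀ => ?_⟩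
  obtain ⟨Y, hY0, hY⟩ := H (e Y₀)
  refine ⟨fun z => e.symm (Y z), by simp [hY0], fun z hz i j => ?_⟩
  let φ : R →L[ℝ] ℝ := LinearMap.toContinuousLinearMap
    { toFun := fun x => e.symm x i j
      map_add' := fun x y => by rw [map_add, Matrix.add_apply]
      map_smul' := fun c x => by rw [map_smul, Matrix.smul_apply]; rfl }
  have hφ : ∀ x, φ x = e.symm x i j := fun x => rfl
  refine (φ.hasFDerivAt.comp z (hY z hz)).congr_fderiv ?_
  ext1 u
  have hmul : ∀ M : Matrix n n ℝ, φ (e M * Y z) = ∑ k, M i k * e.symm (Y z) k j := by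
    intro M
    rw [hφ, map_mul, AlgEquiv.symm_apply_apply, Matrix.mul_apply]
  rw [ContinuousLinearMap.comp_apply, add_apply, map_add, ContinuousLinearMap.smulRight_apply,
    ContinuousLinearMap.smulRight_apply, map_smul, map_smul, hmul, hmul, sum_apply,
    Finset.smul_sum, Finset.smul_sum, ← Finset.sum_add_distrib]
  refine Finset.sum_congr rfl fun k _ => ?_
  simp only [smul_eq_mul, smul_apply, add_apply, Complex.reCLM_apply, Complex.imCLM_apply]
  ring

lemma exists_fundamental_matrix_differentiable {n : Type*} [Fintype n] [DecidableEq n]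
    {A₀ A₁ : ℂ → Matrix n n ℝ} {z₀ : ℂ} {r : ℝ}
    (hr : 0 < r) (h₀ : ∀ z ∈ Metric.ball z₀ r, ∀ i j, ContDiffAt ℝ ∞ (fun w => A₀ w i j) z)
    (h₁ : ∀ z ∈ Metric.ball z₀ r, ∀ i j, ContDiffAt ℝ ∞ (fun w => A₁ w i j) z)
    (hflat : ∀ z ∈ Metric.ball z₀ r, ∀ i j, partialD 0 (fun w => A₁ w i j) z -
      partialD 1 (fun w => A₀ w i j) z = (A₀ z * A₁ z - A₁ z * A₀ z) i j) :
    ∃ ρ, 0 < ρ ∧ ρ ≤ r ∧ ∀ Y₀ : Matrix n n ℝ, ∃ Y : ℂ → Matrix n n ℝ, Y z₀ = Y₀ ∧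
      ∀ z ∈ Metric.ball z₀ ρ, ∀ i j, HasFDerivAt (fun w => Y w i j)
        (∑ k, Y z k j • (A₀ z i k • Complex.reCLM + A₁ z i k • Complex.imCLM)) z :=
  exists_fundamental_matrix_of_algEquiv
    (Matrix.toEuclideanCLM (n := n) (𝕜 := ℝ)).toAlgEquiv hr h₀ h₁ hflat

/-- A flat system of linear equations in the plane with smooth coefficients has, near any point,
smooth fundamental matrices. -/
theorem exists_fundamental_matrix {n : Type*} [Fintype n] [DecidableEq n]
    {A₀ A₁ : ℂ → Matrix n n ℝ} {z₀ : ℂ} {r : ℝ}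
    (hr : 0 < r) (h₀ : ∀ z ∈ Metric.ball z₀ r, ∀ i j, ContDiffAt ℝ ∞ (fun w => A₀ w i j) z)
    (h₁ : ∀ z ∈ Metric.ball z₀ r, ∀ i j, ContDiffAt ℝ ∞ (fun w => A₁ w i j) z)
    (hflat : ∀ z ∈ Metric.ball z₀ r, ∀ i j, partialD 0 (fun w => A₁ w i j) z -
      partialD 1 (fun w => A₀ w i j) z = (A₀ z * A₁ z - A₁ z * A₀ z) i j) (Y₀ : Matrix n n ℝ) :
    ∃ ρ, 0 < ρ ∧ ρ ≤ r ∧ ∃ Y : ℂ → Matrix n n ℝ, Y z₀ = Y₀ ∧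
      ∀ z ∈ Metric.ball z₀ ρ, ∀ i j, ContDiffAt ℝ ∞ (fun w => Y w i j) z ∧
        HasFDerivAt (fun w => Y w i j)
          (∑ k, Y z k j • (A₀ z i k • Complex.reCLM + A₁ z i k • Complex.imCLM)) z := by
  obtain ⟨ρ, hρ, hρr, H⟩ := exists_fundamental_matrix_differentiable hr h₀ h₁ hflat
  obtain ⟨Y, hY0, hY⟩ := H Y₀
  refine ⟨ρ, hρ, hρr, Y, hY0, fun z hz i j => ⟨?_, hY z hz i j⟩⟩
  -- Bootstrapping: the differential of `Y` is linear in `Y` with smooth coefficients, so each order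
  -- of smoothness of `Y` yields the next.
  have key : ∀ m : ℕ, ∀ i j, ContDiffOn ℝ m (fun w => Y w i j) (Metric.ball z₀ ρ) := by
    intro m
    induction m with
    | zero =>
      intro i j
      rw [Nat.cast_zero, contDiffOn_zero]
      exact fun w hw => (hY w hw i j).continuousAt.continuousWithinAt
    | succ m ih =>
      intro i j
      rw [Nat.cast_succ, contDiffOn_succ_iff_fderiv_of_isOpen Metric.isOpen_ball]
      refine ⟨fun w hw => (hY w hw i j).differentiableAt.differentiableWithinAt, by simp, ?_⟩
      have : ContDiffOn ℝ m (fun z => ∑ k, Y z k j •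
          (A₀ z i k • Complex.reCLM + A₁ z i k • Complex.imCLM)) (Metric.ball z₀ ρ) := by
        refine ContDiffOn.sum fun k _ => (ih k j).smul ?_
        have c0 : ContDiffOn ℝ m (fun w => A₀ w i k) (Metric.ball z₀ ρ) := fun w hw =>
          ((h₀ w (Metric.ball_subset_ball hρr hw) i k).of_le (mod_cast le_top)).contDiffWithinAt
        have c1 : ContDiffOn ℝ m (fun w => A₁ w i k) (Metric.ball z₀ ρ) := fun w hw =>
          ((h₁ w (Metric.ball_subset_ball hρr hw) i k).of_le (mod_cast le_top)).contDiffWithinAt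
        exact (c0.smul contDiffOn_const).add (c1.smul contDiffOn_const)
      exact this.congr fun w hw => (hY w hw i j).fderiv
  have : ContDiffOn ℝ ∞ (fun w => Y w i j) (Metric.ball z₀ ρ) :=
    contDiffOn_infty.2 fun m => key m i j
  exact this.contDiffAt (Metric.isOpen_ball.mem_nhds hz)

/-! ### The Levi-Civita connection in a chart -/

section Christoffel

variable {G : ℂ → Matrix (Fin 2) (Fin 2) ℝ}

lemma christoffel_symm (hsymm : ∀ z i j, G z i j = G z j i) (k i j : Fin 2) (z : ℂ) :
    christoffel G k i j z = christoffel G k j i z := by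
  have : (fun w => G w i j) = fun w => G w j i := funext fun w => hsymm w i j
  simp only [christoffel, this]
  congr 1
  refine Finset.sum_congr rfl fun l _ => ?_
  ring

/-- Lowering the index cancels the inverse matrix and leaves the Christoffel symbols of the first
kind. -/
lemma sum_mul_christoffel (z : ℂ) (hdet : (G z).det ≠ 0) (m i j : Fin 2) :
    ∑ k, G z m k * christoffel G k i j z = (1 / 2) * (partialD i (fun w => G w j m) z +
      partialD j (fun w => G w i m) z - partialD m (fun w => G w i j) z) := by
  set X : Fin 2 → ℝ := fun l => partialD i (fun w => G w j l) z +
      partialD j (fun w => G w i l) z - partialD l (fun w => G w i j) z with hX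
  have h : G z *ᵥ ((G z)⁻¹ *ᵥ X) = X := by
    rw [Matrix.mulVec_mulVec, Matrix.mul_nonsing_inv _ (isUnit_iff_ne_zero.2 hdet),
      Matrix.one_mulVec]
  have h' := congrFun h m
  calc _ = (1 / 2) * (G z *ᵥ ((G z)⁻¹ *ᵥ X)) m := by
        simp only [Matrix.mulVec, dotProduct, christoffel, Finset.mul_sum]
        refine Finset.sum_congr rfl fun k _ => Finset.sum_congr rfl fun l _ => ?_
        rw [hX]; ring
    _ = _ := by rw [h']

/-- The Levi-Civita connection is compatible with the metric. -/
lemma partialD_metric (hsymm : ∀ z i j, G z i j = G z j i) (z : ℂ) (hdet : (G z).det ≠ 0)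
    (m k l : Fin 2) : partialD m (fun w => G w k l) z =
      ∑ n, (christoffel G n m k z * G z n l + christoffel G n m l z * G z n k) := by
  have h1 := sum_mul_christoffel z hdet l m k
  have h2 := sum_mul_christoffel z hdet k m l
  have e : (fun w => G w l k) = fun w => G w k l := funext fun w => hsymm w l k
  have e1 : (fun w => G w m l) = fun w => G w l m := funext fun w => hsymm w m l
  have e2 : (fun w => G w m k) = fun w => G w k m := funext fun w => hsymm w m k
  rw [e] at h2
  rw [e1] at h1 h2
  rw [e2] at h1 h2
  rw [Finset.sum_add_distrib]
  have a1 : ∑ n, christoffel G n m k z * G z n l = ∑ n, G z l n * christoffel G n m k z :=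
    Finset.sum_congr rfl fun n _ => by rw [hsymm z n l]; ring
  have a2 : ∑ n, christoffel G n m l z * G z n k = ∑ n, G z k n * christoffel G n m l z :=
    Finset.sum_congr rfl fun n _ => by rw [hsymm z n k]; ring
  rw [a1, a2, h1, h2]
  ring

lemma contDiffAt_partialD {f : ℂ → ℝ} {z : ℂ} (hf : ContDiffAt ℝ ∞ f z) (k : Fin 2) :
    ContDiffAt ℝ ∞ (partialD k f) z :=
  (hf.fderiv_right (m := ∞) (by simp)).clm_apply contDiffAt_const

lemma contDiffAt_christoffel {z : ℂ} (hG : ∀ i j, ContDiffAt ℝ ∞ (fun w => G w i j) z)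
    (hdet : (G z).det ≠ 0) (k i j : Fin 2) : ContDiffAt ℝ ∞ (christoffel G k i j) z := by
  have hd : ContDiffAt ℝ ∞ (fun w => (G w).det) z := by
    simp only [Matrix.det_fin_two]
    exact ((hG 0 0).mul (hG 1 1)).sub ((hG 0 1).mul (hG 1 0))
  have hinv : ∀ k l, ContDiffAt ℝ ∞ (fun w => (G w)⁻¹ k l) z := by
    intro k l
    have : (fun w => (G w)⁻¹ k l) = fun w => ((G w).det)⁻¹ * (G w).adjugate k l := by
      funext w
      rw [Matrix.inv_def, Matrix.smul_apply, Ring.inverse_eq_inv', smul_eq_mul]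
    rw [this]
    refine (hd.inv hdet).mul ?_
    simp only [Matrix.adjugate_fin_two]
    fin_cases k <;> fin_cases l
    · exact hG 1 1
    · exact (hG 0 1).neg
    · exact (hG 1 0).neg
    · exact hG 0 0
  unfold christoffel
  refine contDiffAt_const.mul (ContDiffAt.sum fun l _ => (hinv k l).mul ?_)
  exact ((contDiffAt_partialD (hG j l) i).add (contDiffAt_partialD (hG i l) j)).sub
    (contDiffAt_partialD (hG i j) l)

lemma partialD_congr {f g : ℂ → ℝ} {z : ℂ} (h : f =ᶠ[𝓝 z] g) (k : Fin 2) :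
    partialD k f z = partialD k g z := by
  rw [partialD, partialD, h.fderiv_eq]

lemma partialD_add {f g : ℂ → ℝ} {z : ℂ} (hf : DifferentiableAt ℝ f z)
    (hg : DifferentiableAt ℝ g z) (k : Fin 2) :
    partialD k (fun w => f w + g w) z = partialD k f z + partialD k g z := by
  rw [partialD, fderiv_fun_add hf hg]; rfl

lemma partialD_mul {f g : ℂ → ℝ} {z : ℂ} (hf : DifferentiableAt ℝ f z)
    (hg : DifferentiableAt ℝ g z) (k : Fin 2) :
    partialD k (fun w => f w * g w) z = partialD k f z * g z + f z * partialD k g z := by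
  rw [partialD, fderiv_fun_mul hf hg]
  change f z * fderiv ℝ g z _ + g z * fderiv ℝ f z _ = _
  rw [partialD, partialD]
  ring

lemma partialD_comm {f : ℂ → ℝ} {z : ℂ} (hf : ContDiffAt ℝ ∞ f z) :
    partialD 0 (partialD 1 f) z = partialD 1 (partialD 0 f) z := by
  have hd : DifferentiableAt ℝ (fderiv ℝ f) z :=
    (hf.fderiv_right (m := ∞) (by simp)).differentiableAt (by simp)
  have key : ∀ i j, partialD i (partialD j f) z =
      fderiv ℝ (fderiv ℝ f) z (planeBasis i) (planeBasis j) := by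
    intro i j
    have : HasFDerivAt (fun w => fderiv ℝ f w (planeBasis j))
        ((ContinuousLinearMap.apply ℝ ℝ (planeBasis j)).comp (fderiv ℝ (fderiv ℝ f) z)) z :=
      (ContinuousLinearMap.apply ℝ ℝ (planeBasis j)).hasFDerivAt.comp z hd.hasFDerivAt
    change fderiv ℝ (fun w => fderiv ℝ f w (planeBasis j)) z (planeBasis i) = _
    rw [this.fderiv]; rfl
  rw [key, key]
  exact (hf.isSymmSndFDerivAt (by
    rw [minSmoothness_of_isRCLikeNormedField]
    exact WithTop.coe_le_coe.2 (le_top : (2 : ℕ∞) ≤ ⊤))).eq _ _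

/-- The curvature tensor with lowered index is antisymmetric. -/
lemma sum_mul_riemannTensor_antisymm (hsymm : ∀ z i j, G z i j = G z j i) {z : ℂ}
    (hG : ∀ᶠ w in 𝓝 z, (∀ i j, ContDiffAt ℝ ∞ (fun w => G w i j) w) ∧ (G w).det ≠ 0)
    (k l : Fin 2) : ∑ m, (G z l m * riemannTensor G m k 0 1 z +
      G z k m * riemannTensor G m l 0 1 z) = 0 := by
  have hz := hG.self_of_nhds
  have dG : ∀ i j, DifferentiableAt ℝ (fun w => G w i j) z := fun i j =>
    (hz.1 i j).differentiableAt (by simp)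
  have dΓ : ∀ k i j, DifferentiableAt ℝ (christoffel G k i j) z := fun k i j =>
    (contDiffAt_christoffel hz.1 hz.2 k i j).differentiableAt (by simp)
  -- Metric compatibility is differentiated once more. The symmetry of the second derivatives of `G`
  -- then gives the antisymmetry.
  have key : ∀ a b, partialD a (partialD b (fun w => G w k l)) z =
      ∑ n, (partialD a (christoffel G n b k) z * G z n l +
        christoffel G n b k z * partialD a (fun w => G w n l) z +
        (partialD a (christoffel G n b l) z * G z n k +
        christoffel G n b l z * partialD a (fun w => G w n k) z)) := by
    intro a b
    have e : partialD b (fun w => G w k l) =ᶠ[𝓝 z] fun w =>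
        ∑ n, (christoffel G n b k w * G w n l + christoffel G n b l w * G w n k) :=
      hG.mono fun w hw => partialD_metric hsymm w hw.2 b k l
    rw [partialD_congr e]
    simp only [Fin.sum_univ_two]
    have d1 : ∀ n, DifferentiableAt ℝ (fun w => christoffel G n b k w * G w n l) z :=
      fun n => (dΓ n b k).mul (dG n l)
    have d2 : ∀ n, DifferentiableAt ℝ (fun w => christoffel G n b l w * G w n k) z :=
      fun n => (dΓ n b l).mul (dG n k)
    rw [partialD_add ((d1 0).fun_add (d2 0)) ((d1 1).fun_add (d2 1)), partialD_add (d1 0) (d2 0),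
      partialD_add (d1 1) (d2 1), partialD_mul (dΓ 0 b k) (dG 0 l),
      partialD_mul (dΓ 1 b k) (dG 1 l), partialD_mul (dΓ 0 b l) (dG 0 k),
      partialD_mul (dΓ 1 b l) (dG 1 k)]
  have h := partialD_comm (hz.1 k l)
  rw [key, key] at h
  simp only [partialD_metric hsymm z hz.2, Fin.sum_univ_two, hsymm z 1 0] at h
  have s : ∀ n, christoffel G n 1 0 = christoffel G n 0 1 := fun n =>
    funext fun w => christoffel_symm hsymm n 1 0 w
  fin_cases k <;> fin_cases l <;>
  ( simp only [riemannTensor, Fin.sum_univ_two, hsymm z 1 0, Fin.zero_eta, Fin.mk_one,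
      Fin.isValue, s] at h ⊢
    linear_combination h)

/-- The curvature tensor of a metric of curvature `-1`. -/
lemma riemannTensor_of_sectionalCurvature (hsymm : ∀ z i j, G z i j = G z j i) {z : ℂ}
    (hG : ∀ᶠ w in 𝓝 z, (∀ i j, ContDiffAt ℝ ∞ (fun w => G w i j) w) ∧ (G w).det ≠ 0)
    (hK : sectionalCurvature G z = -1) :
    riemannTensor G 0 0 0 1 z = - G z 0 1 ∧ riemannTensor G 1 0 0 1 z = G z 0 0 ∧
      riemannTensor G 0 1 0 1 z = - G z 1 1 ∧ riemannTensor G 1 1 0 1 z = G z 0 1 := by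
  have hdet := hG.self_of_nhds.2
  have h00 := sum_mul_riemannTensor_antisymm hsymm hG 0 0
  have h01 := sum_mul_riemannTensor_antisymm hsymm hG 0 1
  have h11 := sum_mul_riemannTensor_antisymm hsymm hG 1 1
  rw [sectionalCurvature, div_eq_iff hdet] at hK
  simp only [Fin.sum_univ_two, hsymm z 1 0] at h00 h01 h11 hK
  rw [Matrix.det_fin_two, hsymm z 1 0] at hdet hK
  -- By antisymmetry the lowered tensor has one independent component, fixed by `hK`. Raising the
  -- index again is Cramer's rule, whence the factor `det G`.
  refine ⟨mul_left_cancel₀ hdet ?_, mul_left_cancel₀ hdet ?_, mul_left_cancel₀ hdet ?_,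
    mul_left_cancel₀ hdet ?_⟩
  · linear_combination (G z 1 1 / 2) * h00 - G z 0 1 * h01 + G z 0 1 * hK
  · linear_combination (-G z 0 1 / 2) * h00 + G z 0 0 * h01 - G z 0 0 * hK
  · linear_combination G z 1 1 * hK - (G z 0 1 / 2) * h11
  · linear_combination (-G z 0 1) * hK + (G z 0 0 / 2) * h11

end Christoffel

/-! ### Quadratic first integrals -/

/-- The defect between the Gram matrix of the rows of `Y`, for the diagonal form `d`, and `Q` solves
a homogeneous linear equation and vanishes at `z₀`; hence it vanishes nearby. With `d = (-1, 1, 1)`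
this keeps a moving frame of Minkowski space adapted to the metric. -/
lemma eventually_quadratic_eq {n : Type*} [Fintype n] {α : ℂ → n → n → ℂ →L[ℝ] ℝ}
    {Y Q : ℂ → Matrix n n ℝ} {d : n → ℝ} {z₀ : ℂ} {r : ℝ} (hr : 0 < r)
    (hα : ∀ i j, ContinuousAt (fun z => α z i j) z₀)
    (hY : ∀ z ∈ Metric.ball z₀ r, ∀ i j, HasFDerivAt (fun w => Y w i j) (∑ m, Y z m j • α z i m) z)
    (hQ : ∀ z ∈ Metric.ball z₀ r, ∀ i j, HasFDerivAt (fun w => Q w i j)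
      (∑ m, (Q z m j • α z i m + Q z i m • α z j m)) z)
    (h0 : ∀ i j, ∑ k, d k * (Y z₀ i k * Y z₀ j k) = Q z₀ i j) :
    ∀ᶠ z in 𝓝 z₀, ∀ i j, ∑ k, d k * (Y z i k * Y z j k) = Q z i j := by
  let P : ℂ → n → n → ℝ := fun z i j => ∑ k, d k * (Y z i k * Y z j k) - Q z i j
  have hP : ∀ z ∈ Metric.ball z₀ r, ∀ i j, HasFDerivAt (fun w => P w i j)
      (∑ m, (P z m j • α z i m + P z i m • α z j m)) z := by
    intro z hz i j
    have h1 : HasFDerivAt (fun w => ∑ k, d k * (Y w i k * Y w j k))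
        (∑ k, d k • (Y z i k • (∑ m, Y z m k • α z j m) + Y z j k • (∑ m, Y z m k • α z i m))) z :=
      HasFDerivAt.fun_sum fun k _ => ((hY z hz i k).mul (hY z hz j k)).const_mul (d k)
    refine (h1.sub (hQ z hz i j)).congr_fderiv ?_
    ext1 u
    simp only [P, sub_apply, sum_apply, smul_apply, add_apply, smul_eq_mul, sub_mul,
      Finset.mul_sum, Finset.sum_mul, mul_add, Finset.sum_add_distrib, Finset.sum_sub_distrib]
    rw [Finset.sum_comm]
    rw [Finset.sum_comm (f := fun k m => d k * (Y z j k * (Y z m k * α z i m u)))]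
    have e1 : ∀ x k, d k * (Y z i k * (Y z x k * α z j x u)) =
      d k * (Y z i k * Y z x k) * α z j x u := fun x k => by ring
    have e2 : ∀ x k, d k * (Y z j k * (Y z x k * α z i x u)) =
      d k * (Y z x k * Y z j k) * α z i x u := fun x k => by ring
    simp only [e1, e2]
    ring
  obtain ⟨C, hC⟩ : ∃ C : ℝ, ∀ i j, ‖α z₀ i j‖ < C := by
    refine ⟨∑ i, ∑ j, ‖α z₀ i j‖ + 1, fun i j => ?_⟩
    have h1 := Finset.single_le_sum (f := fun j => ‖α z₀ i j‖) (fun _ _ => norm_nonneg _)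
      (Finset.mem_univ j)
    have h2 := Finset.single_le_sum (f := fun i => ∑ j, ‖α z₀ i j‖)
      (fun _ _ => Finset.sum_nonneg fun _ _ => norm_nonneg _) (Finset.mem_univ i)
    linarith
  obtain ⟨s, hs, hCs⟩ := Metric.eventually_nhds_iff_ball.1
    (Filter.eventually_all.2 fun i => Filter.eventually_all.2 fun j =>
      (hα i j).norm.eventually_lt_const (hC i j))
  have hzero := eq_zero_of_norm_fderiv_le (P := P) (z₀ := z₀) (ρ := min r s)
    (K := ∑ _m : n, (C + C))
    (P' := fun z => ContinuousLinearMap.pi fun i => ContinuousLinearMap.pi fun j =>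
      ∑ m, (P z m j • α z i m + P z i m • α z j m))
    (fun z hz => hasFDerivAt_pi.2 fun i => hasFDerivAt_pi.2 fun j =>
      hP z (Metric.ball_subset_ball (min_le_left _ _) hz) i j)
    (by funext i j; simp [P, h0]) (fun z hz => by
      have hz' := hCs z (Metric.ball_subset_ball (min_le_right _ _) hz)
      have hPn : ∀ i j, ‖P z i j‖ ≤ ‖P z‖ := fun i j =>
        (norm_le_pi_norm (P z i) j).trans (norm_le_pi_norm (P z) i)
      have hB : 0 ≤ (∑ _m : n, (C + C)) * ‖P z‖ := by
        refine mul_nonneg (Finset.sum_nonneg fun i _ => ?_) (norm_nonneg _)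
        have := (norm_nonneg _).trans_lt (hC i i)
        linarith
      refine ContinuousLinearMap.opNorm_le_bound _ hB fun u => ?_
      have hB' := mul_nonneg hB (norm_nonneg u)
      refine (pi_norm_le_iff_of_nonneg hB').2 fun i => (pi_norm_le_iff_of_nonneg hB').2 fun j => ?_
      have hle : ‖∑ m, (P z m j • α z i m + P z i m • α z j m)‖ ≤
          (∑ _m : n, (C + C)) * ‖P z‖ := by
        rw [Finset.sum_mul]
        refine norm_sum_le_of_le _ fun m _ => (norm_add_le _ _).trans ?_
        rw [norm_smul, norm_smul, add_mul, mul_comm C]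
        gcongr
        · exact hPn m j
        · exact (hz' i m).le
        · exact hPn i m
        · exact (hz' j m).le
      exact (ContinuousLinearMap.le_opNorm _ u).trans (by gcongr))
  filter_upwards [Metric.ball_mem_nhds z₀ (lt_min hr hs)] with z hz i j
  exact sub_eq_zero.1 (congrFun (congrFun (hzero z hz) i) j)

/-! ### Metrics of curvature `-1` are locally isometric to the Poincaré disk -/

/-- The stereographic projection of the hyperboloid model to the unit disk. -/
lemma poincareForm_hyperboloid {u₀ u₁ u₂ : ℂ → ℝ} {z : ℂ} {u₀' u₁' u₂' : ℂ →L[ℝ] ℝ}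
    (h₀ : HasFDerivAt u₀ u₀' z) (h₁ : HasFDerivAt u₁ u₁' z) (h₂ : HasFDerivAt u₂ u₂' z)
    (hu : u₁ z ^ 2 + u₂ z ^ 2 = u₀ z ^ 2 - 1) (hpos : 0 < u₀ z)
    (hu' : ∀ v, u₁ z * u₁' v + u₂ z * u₂' v = u₀ z * u₀' v) :
    ‖((u₁ z : ℂ) + u₂ z * Complex.I) / (1 + u₀ z)‖ < 1 ∧
    HasFDerivAt (fun w => ((u₁ w : ℂ) + u₂ w * Complex.I) / (1 + u₀ w))
      (((1 + u₀ z)⁻¹ • u₁' - (u₁ z / (1 + u₀ z) ^ 2) • u₀').smulRight 1 +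
        ((1 + u₀ z)⁻¹ • u₂' - (u₂ z / (1 + u₀ z) ^ 2) • u₀').smulRight Complex.I) z ∧
    ∀ v w, poincareForm (((u₁ z : ℂ) + u₂ z * Complex.I) / (1 + u₀ z))
      ((((1 + u₀ z)⁻¹ • u₁' - (u₁ z / (1 + u₀ z) ^ 2) • u₀').smulRight (1 : ℂ) +
        ((1 + u₀ z)⁻¹ • u₂' - (u₂ z / (1 + u₀ z) ^ 2) • u₀').smulRight Complex.I) v)
      ((((1 + u₀ z)⁻¹ • u₁' - (u₁ z / (1 + u₀ z) ^ 2) • u₀').smulRight (1 : ℂ) +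
        ((1 + u₀ z)⁻¹ • u₂' - (u₂ z / (1 + u₀ z) ^ 2) • u₀').smulRight Complex.I) w) =
      u₁' v * u₁' w + u₂' v * u₂' w - u₀' v * u₀' w := by
  have hne : 1 + u₀ z ≠ 0 := by positivity
  have hform : ∀ w, ((u₁ w : ℂ) + u₂ w * Complex.I) / (1 + u₀ w) =
      ((1 + u₀ w)⁻¹ * u₁ w) • (1 : ℂ) + ((1 + u₀ w)⁻¹ * u₂ w) • Complex.I := by
    intro w
    simp only [Complex.real_smul]
    push_cast
    rw [div_eq_mul_inv]
    ring
  -- On the hyperboloid `u₁² + u₂² = (u₀ - 1) (u₀ + 1)`, so the squared norm is `(u₀ - 1) / (u₀ +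
  -- 1)`.
  have hnorm : ‖((u₁ z : ℂ) + u₂ z * Complex.I) / (1 + u₀ z)‖ ^ 2 = 1 - 2 / (1 + u₀ z) := by
    rw [hform, ← Complex.normSq_eq_norm_sq, Complex.normSq_apply]
    simp only [Complex.add_re, Complex.add_im, Complex.real_smul, Complex.mul_re, Complex.mul_im,
      Complex.ofReal_re, Complex.ofReal_im, Complex.one_re, Complex.one_im, Complex.I_re,
      Complex.I_im]
    field_simp
    linear_combination hu
  refine ⟨?_, ?_, fun v w => ?_⟩
  · have : (0 : ℝ) < 2 / (1 + u₀ z) := by positivity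
    have h2 : ‖((u₁ z : ℂ) + u₂ z * Complex.I) / (1 + u₀ z)‖ ^ 2 < 1 := by linarith
    exact (sq_lt_one_iff₀ (norm_nonneg _)).1 h2
  · simp_rw [hform]
    have hinv : HasFDerivAt (fun w => (1 + u₀ w)⁻¹) (-((1 + u₀ z) ^ 2)⁻¹ • u₀') z :=
      (hasDerivAt_inv hne).comp_hasFDerivAt z (h₀.const_add 1)
    refine (((hinv.mul h₁).smul_const (1 : ℂ)).add
      ((hinv.mul h₂).smul_const Complex.I)).congr_fderiv ?_
    ext1 x
    simp only [add_apply, sub_apply, smul_apply, ContinuousLinearMap.smulRight_apply, smul_eq_mul]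
    congr 2 <;> (field_simp; ring)
  · rw [poincareForm, hnorm, Complex.inner]
    simp only [add_apply, sub_apply, smul_apply, ContinuousLinearMap.smulRight_apply, smul_eq_mul,
      Complex.add_re, Complex.add_im, Complex.real_smul, Complex.mul_re, Complex.mul_im,
      Complex.conj_re, Complex.conj_im,
      Complex.ofReal_re, Complex.ofReal_im, Complex.one_re, Complex.one_im, Complex.I_re,
      Complex.I_im]
    have a1 := hu' v
    have a2 := hu' w
    field_simp
    linear_combination (-4 * (1 + u₀ z) * u₀' w) * a1 - (4 * (1 + u₀ z) * u₀' v) * a2 + 4 * u₀' v * u₀' w * hu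

/-- An isometric immersion `u` into the hyperboloid satisfies the Gauss formula `∂ᵢ∂ⱼu = ∑ₖ Γᵏᵢⱼ ∂ₖu
+ gᵢⱼ u`. This is a linear system for the frame with rows `u, ∂₀u, ∂₁u`, with coefficient matrices
`B 0` and `B 1`. It is solved from an adapted initial frame; conservation of the Gram matrix puts
`u` on the hyperboloid with induced metric `G`, and stereographic projection carries it to the disk.
-/
theorem exists_local_isometry_plane {G : ℂ → Matrix (Fin 2) (Fin 2) ℝ} {z₀ : ℂ} {r : ℝ}
    (hr : 0 < r) (hsymm : ∀ z i j, G z i j = G z j i)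
    (hG : ∀ z ∈ Metric.ball z₀ r, ∀ i j, ContDiffAt ℝ ∞ (fun w => G w i j) z)
    (hpos : ∀ z ∈ Metric.ball z₀ r, 0 < G z 0 0) (hdet : ∀ z ∈ Metric.ball z₀ r, 0 < (G z).det)
    (hK : ∀ z ∈ Metric.ball z₀ r, sectionalCurvature G z = -1) :
    ∃ φ : ℂ → ℂ, ∀ᶠ z in 𝓝 z₀, ContDiffAt ℝ ∞ φ z ∧ ‖φ z‖ < 1 ∧ 0 < (fderiv ℝ φ z).det ∧
      ∀ i j, poincareForm (φ z) (fderiv ℝ φ z (planeBasis i)) (fderiv ℝ φ z (planeBasis j)) =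
        G z i j := by
  set Γ := christoffel G with hΓ
  let B : Fin 2 → ℂ → Matrix (Fin 3) (Fin 3) ℝ := fun m z =>
    ![!![0, 1, 0; G z 0 0, Γ 0 0 0 z, Γ 1 0 0 z; G z 0 1, Γ 0 0 1 z, Γ 1 0 1 z],
      !![0, 0, 1; G z 0 1, Γ 0 0 1 z, Γ 1 0 1 z; G z 1 1, Γ 0 1 1 z, Γ 1 1 1 z]] m
  have dG : ∀ z ∈ Metric.ball z₀ r, ∀ i j, DifferentiableAt ℝ (fun w => G w i j) z :=
    fun z hz i j => (hG z hz i j).differentiableAt (by simp)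
  have cΓ : ∀ z ∈ Metric.ball z₀ r, ∀ k i j, ContDiffAt ℝ ∞ (Γ k i j) z :=
    fun z hz => contDiffAt_christoffel (hG z hz) (hdet z hz).ne'
  have hB : ∀ m, ∀ z ∈ Metric.ball z₀ r, ∀ i j, ContDiffAt ℝ ∞ (fun w => B m w i j) z := by
    intro m z hz i j
    fin_cases m <;> fin_cases i <;> fin_cases j <;>
      first
      | exact contDiffAt_const
      | exact hG z hz _ _
      | exact cΓ z hz _ _ _
  have hcompat : ∀ z ∈ Metric.ball z₀ r, ∀ m k l, partialD m (fun w => G w k l) z =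
      ∑ n, (Γ n m k z * G z n l + Γ n m l z * G z n k) := fun z hz m k l =>
    partialD_metric hsymm z (hdet z hz).ne' m k l
  have hΓs : ∀ k, Γ k 1 0 = Γ k 0 1 := fun k => funext fun z => christoffel_symm hsymm k 1 0 z
  have hconst : ∀ (m : Fin 2) (c : ℝ) z, partialD m (fun _ => c) z = 0 := by
    intro m c z; simp [partialD]
  -- The entries of the first column are the Codazzi equations, which follow from metric
  -- compatibility. The remaining entries of the last two rows say that the curvature is -1.
  have hflat : ∀ z ∈ Metric.ball z₀ r, ∀ i j, partialD 0 (fun w => B 1 w i j) z -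
      partialD 1 (fun w => B 0 w i j) z = (B 0 z * B 1 z - B 1 z * B 0 z) i j := by
    intro z hz i j
    obtain ⟨r1, r2, r3, r4⟩ := riemannTensor_of_sectionalCurvature hsymm
      (Filter.eventually_of_mem (Metric.isOpen_ball.mem_nhds hz)
        fun w hw => ⟨hG w hw, (hdet w hw).ne'⟩) (hK z hz)
    simp only [riemannTensor, Fin.sum_univ_two, ← hΓ, hΓs] at r1 r2 r3 r4
    have k1 := hcompat z hz 0 0 1
    have k2 := hcompat z hz 1 0 0
    have k3 := hcompat z hz 0 1 1
    have k4 := hcompat z hz 1 0 1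
    simp only [Fin.sum_univ_two, hΓs, hsymm z 1 0] at k1 k2 k3 k4
    rw [Matrix.sub_apply, Matrix.mul_apply, Matrix.mul_apply, Fin.sum_univ_three,
      Fin.sum_univ_three]
    fin_cases i <;> fin_cases j <;> simp [B, hconst]
    · linear_combination k1 - k2
    · linear_combination r1
    · linear_combination r2
    · linear_combination k3 - k4
    · linear_combination r3
    · linear_combination r4
  set E := G z₀ 0 0 with hE
  set F := G z₀ 0 1 with hF
  have hz₀ : z₀ ∈ Metric.ball z₀ r := Metric.mem_ball_self hr
  have hE0 : 0 < √E := Real.sqrt_pos.2 (hpos z₀ hz₀)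
  have hD0 : 0 < √(G z₀).det := Real.sqrt_pos.2 (hdet z₀ hz₀)
  have hE1 : √E ^ 2 = E := Real.sq_sqrt (hpos z₀ hz₀).le
  have hD1 : √(G z₀).det ^ 2 = E * G z₀ 1 1 - F ^ 2 := by
    rw [Real.sq_sqrt (hdet z₀ hz₀).le, Matrix.det_fin_two, hsymm z₀ 1 0]; ring
  -- The initial frame is based at the apex `(1, 0, 0)` of the hyperboloid. Its tangent block is the
  -- Cholesky factor of `G z₀`, which gives the right Gram matrix and a positive orientation.
  obtain ⟨ρ, hρ, hρr, Y, hY0, hY⟩ := exists_fundamental_matrix hr (hB 0) (hB 1) hflat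
    !![1, 0, 0; 0, √E, 0; 0, F / √E, √(G z₀).det / √E]
  let α : ℂ → Fin 3 → Fin 3 → ℂ →L[ℝ] ℝ := fun z i j =>
    B 0 z i j • Complex.reCLM + B 1 z i j • Complex.imCLM
  let Q : ℂ → Matrix (Fin 3) (Fin 3) ℝ := fun z =>
    !![-1, 0, 0; 0, G z 0 0, G z 0 1; 0, G z 0 1, G z 1 1]
  have hderiv : ∀ {f : ℂ → ℝ} {z : ℂ}, DifferentiableAt ℝ f z →
      HasFDerivAt f (partialD 0 f z • Complex.reCLM + partialD 1 f z • Complex.imCLM) z := by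
    intro f z hf
    refine hf.hasFDerivAt.congr_fderiv ?_
    ext1 u
    have : u = u.re • (1 : ℂ) + u.im • Complex.I := by apply Complex.ext <;> simp
    conv_lhs => rw [this, map_add, map_smul, map_smul]
    simp [partialD, planeBasis, mul_comm]
  have hα : ∀ i j, ContinuousAt (fun z => α z i j) z₀ := fun i j =>
    ((hB 0 z₀ hz₀ i j).continuousAt.smul continuousAt_const).add
      ((hB 1 z₀ hz₀ i j).continuousAt.smul continuousAt_const)
  have hQ : ∀ z ∈ Metric.ball z₀ ρ, ∀ i j, HasFDerivAt (fun w => Q w i j)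
      (∑ m, (Q z m j • α z i m + Q z i m • α z j m)) z := by
    intro z hz i j
    have hz' := Metric.ball_subset_ball hρr hz
    have k := hcompat z hz'
    simp only [Fin.sum_univ_two] at k
    rw [Fin.sum_univ_three]
    fin_cases i <;> fin_cases j <;>
    first
    | (refine (hasFDerivAt_const _ _).congr_fderiv ?_
       ext1 u
       simp [Q, α, B]
       try ring)
    | (refine (hderiv (dG z hz' _ _)).congr_fderiv ?_
       ext1 u
       simp [Q, α, B, k, hΓs, hsymm z 1 0]
       ring)
  have hquad := eventually_quadratic_eq (d := ![-1, 1, 1]) hρ hα (fun z hz i j => (hY z hz i j).2)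
    hQ (by
      intro i j
      rw [hY0, Fin.sum_univ_three]
      fin_cases i <;> fin_cases j <;> simp [Q, ← hE, ← hF]
      · linear_combination hE1
      · field_simp
      · field_simp
      · field_simp
        rw [hD1, hE1]; ring)
  have hu0 : ∀ᶠ z in 𝓝 z₀, 0 < Y z 0 0 := by
    have := (hY z₀ (Metric.mem_ball_self hρ) 0 0).1.continuousAt
    refine this.eventually_const_lt ?_
    simp [hY0]
  have hrow : ∀ z ∈ Metric.ball z₀ ρ, ∀ a, HasFDerivAt (fun w => Y w 0 a)
      (Y z 1 a • Complex.reCLM + Y z 2 a • Complex.imCLM) z := by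
    intro z hz a
    refine (hY z hz 0 a).2.congr_fderiv ?_
    rw [Fin.sum_univ_three]
    simp [B]
  let φ : ℂ → ℂ := fun z => ((Y z 0 1 : ℂ) + Y z 0 2 * Complex.I) / (1 + Y z 0 0)
  have hall : ∀ᶠ z in 𝓝 z₀, ContDiffAt ℝ ∞ φ z ∧ ‖φ z‖ < 1 ∧
      (∀ i j, poincareForm (φ z) (fderiv ℝ φ z (planeBasis i)) (fderiv ℝ φ z (planeBasis j)) =
        G z i j) := by
    filter_upwards [Metric.ball_mem_nhds z₀ hρ, hu0, hquad] with z hz hu hq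
    simp only [Fin.sum_univ_three] at hq
    have q00 := hq 0 0
    have q01 := hq 0 1
    have q02 := hq 0 2
    have q11 := hq 1 1
    have q12 := hq 1 2
    have q22 := hq 2 2
    simp [Q] at q00 q01 q02 q11 q12 q22
    obtain ⟨n1, n2, n3⟩ := poincareForm_hyperboloid (hrow z hz 0) (hrow z hz 1) (hrow z hz 2)
      (by linear_combination q00) hu (by
        intro v
        simp
        linear_combination v.re * q01 + v.im * q02)
    refine ⟨?_, n1, fun i j => ?_⟩
    · have c : ∀ a, ContDiffAt ℝ ∞ (fun w => (Y w 0 a : ℂ)) z := fun a =>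
        Complex.ofRealCLM.contDiff.contDiffAt.comp z (hY z hz 0 a).1
      simp only [φ, div_eq_mul_inv]
      refine ((c 1).add ((c 2).mul contDiffAt_const)).mul
        (((contDiffAt_const (c := (1 : ℂ))).add (c 0)).inv ?_)
      have : (1 + Y z 0 0 : ℝ) ≠ 0 := by positivity
      exact_mod_cast this
    · rw [n2.fderiv, n3]
      fin_cases i <;> fin_cases j <;> simp [planeBasis]
      · linear_combination q11
      · linear_combination q12
      · rw [hsymm z 1 0]; linear_combination q12
      · linear_combination q22
  -- By continuity the orientation need only be checked at `z₀`, where the triangular initial frame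
  -- gives the differential explicitly.
  have hdetc : ∀ᶠ z in 𝓝 z₀, 0 < (fderiv ℝ φ z).det := by
    have h0 := hall.self_of_nhds.1
    have hc : ContinuousAt (fun z => (fderiv ℝ φ z).det) z₀ :=
      ContinuousLinearMap.continuous_det.continuousAt.comp
        (h0.fderiv_right (m := ∞) (by simp)).continuousAt
    refine hc.eventually_const_lt ?_
    obtain ⟨n1, n2, n3⟩ := poincareForm_hyperboloid (hrow z₀ (Metric.mem_ball_self hρ) 0)
      (hrow z₀ (Metric.mem_ball_self hρ) 1) (hrow z₀ (Metric.mem_ball_self hρ) 2)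
      (by simp [hY0]) (by simp [hY0]) (by simp [hY0])
    change 0 < (fderiv ℝ φ z₀).det
    rw [show fderiv ℝ φ z₀ = _ from n2.fderiv, clm_det_eq]
    simp [hY0]
    have : 0 < Complex.normSq (1 + 1) := Complex.normSq_pos.2 (by norm_num)
    positivity
  refine ⟨φ, ?_⟩
  filter_upwards [hall, hdetc] with z h1 h2
  exact ⟨h1.1, h1.2.1, h2, h1.2.2⟩

/-! ### Hyperbolic surfaces are locally isometric to the Poincaré disk -/

section Chart

variable {M : Type*} [TopologicalSpace M] [ChartedSpace ℂ M] [IsManifold 𝓘(ℝ, ℂ) ∞ M]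

/-- The value of a metric at a point as a continuous bilinear form on the plane. -/
def SurfaceMetric.form (g : SurfaceMetric M) (x : M) : ℂ →L[ℝ] ℂ →L[ℝ] ℝ := g.inner x

lemma SurfaceMetric.form_apply (g : SurfaceMetric M) (x : M) (v w : ℂ) :
    g.form x v w = g.val x v w := rfl

lemma SurfaceMetric.val_comm (g : SurfaceMetric M) (x : M) (v w : ℂ) :
    g.val x v w = g.val x w v := g.symm x v w

lemma SurfaceMetric.val_self_pos (g : SurfaceMetric M) (x : M) {v : ℂ} (hv : v ≠ 0) :
    0 < g.val x v v := g.pos x v hv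

lemma surfDeriv_symm_comp_chart {e : OpenPartialHomeomorph M ℂ} (he : e ∈ atlas ℂ M) {x : M}
    (hx : x ∈ e.source) :
    (surfDeriv e.symm (e x)).comp (surfDeriv e x) = ContinuousLinearMap.id ℝ ℂ := by
  rw [← surfDeriv_comp_at x (contMDiffAt_chart_symm he (e.map_source hx)).mdiffAt
    (contMDiffAt_chart he hx).mdiffAt]
  apply surfDeriv_eq_id
  filter_upwards [e.open_source.mem_nhds hx] with w hw using e.left_inv hw

lemma surfDeriv_chart_symm_injective {e : OpenPartialHomeomorph M ℂ} (he : e ∈ atlas ℂ M) {z : ℂ}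
    (hz : z ∈ e.target) : Function.Injective (surfDeriv e.symm z) := by
  refine Function.LeftInverse.injective (g := surfDeriv e (e.symm z)) fun v => ?_
  exact congrArg (fun L : ℂ →L[ℝ] ℂ => L v) (surfDeriv_chart_comp_symm he hz)

/-- The differential on `M` is read in the preferred chart at `x`, so that of `e` is the derivative
of a change of charts of the oriented atlas. -/
lemma det_surfDeriv_chart_pos [OrientedSurface M] {e : OpenPartialHomeomorph M ℂ}
    (he : e ∈ atlas ℂ M) {x : M} (hx : x ∈ e.source) : 0 < (surfDeriv e x).det := by
  have h1 : surfDeriv e x = fderiv ℝ ((chartAt ℂ x).symm ≫ₕ e) (chartAt ℂ x x) := by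
    rw [surfDeriv, (contMDiffAt_chart he hx).mdiffAt.mfderiv]
    simp [writtenInExtChartAt, extChartAt]
    rfl
  rw [h1]
  refine OrientedSurface.det_pos _ (chart_mem_atlas ℂ x) _ he _ ?_
  simp [hx]

lemma SurfaceMetric.inChart_symm (g : SurfaceMetric M) (e : OpenPartialHomeomorph M ℂ) (z : ℂ)
    (i j : Fin 2) : g.inChart e z i j = g.inChart e z j i :=
  g.val_comm _ _ _

lemma planeBasis_ne_zero (i : Fin 2) : planeBasis i ≠ 0 := by
  fin_cases i <;> simp [planeBasis]

lemma SurfaceMetric.inChart_pos (g : SurfaceMetric M) {e : OpenPartialHomeomorph M ℂ}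
    (he : e ∈ atlas ℂ M) {z : ℂ} (hz : z ∈ e.target) (i : Fin 2) : 0 < g.inChart e z i i := by
  refine g.val_self_pos _ fun h => planeBasis_ne_zero i ?_
  exact surfDeriv_chart_symm_injective he hz (h.trans (map_zero _).symm)

lemma SurfaceMetric.inChart_det_pos (g : SurfaceMetric M) {e : OpenPartialHomeomorph M ℂ}
    (he : e ∈ atlas ℂ M) {z : ℂ} (hz : z ∈ e.target) : 0 < (g.inChart e z).det := by
  set L := surfDeriv e.symm z with hL
  have h0 := g.inChart_pos he hz 0
  set a := g.inChart e z 0 0 with ha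
  set b := g.inChart e z 0 1 with hb
  set c := g.inChart e z 1 1 with hc
  -- This vector is orthogonal to the first basis vector, and its squared length is `a (a c - b²)`,
  -- that is, `a` times the determinant.
  have hne : L (a • planeBasis 1 - b • planeBasis 0) ≠ 0 := by
    intro h
    have h2 := surfDeriv_chart_symm_injective he hz (h.trans (map_zero _).symm)
    have h3 := congrArg Complex.im h2
    simp [planeBasis] at h3
    exact h0.ne' h3
  have hpos := g.val_self_pos (e.symm z) hne
  have e1 : g.val (e.symm z) (L (planeBasis 0)) (L (planeBasis 0)) = a := rfl
  have e2 : g.val (e.symm z) (L (planeBasis 0)) (L (planeBasis 1)) = b := rfl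
  have e3 : g.val (e.symm z) (L (planeBasis 1)) (L (planeBasis 1)) = c := rfl
  have e4 : g.val (e.symm z) (L (planeBasis 1)) (L (planeBasis 0)) = b := g.val_comm _ _ _
  rw [← g.form_apply] at hpos e1 e2 e3 e4
  rw [map_sub, map_smul, map_smul] at hpos
  simp only [map_sub, map_smul, sub_apply, smul_apply, smul_eq_mul, e1, e2, e3, e4] at hpos
  rw [Matrix.det_fin_two, g.inChart_symm e z 1 0, ← ha, ← hb, ← hc]
  have : 0 < a * (a * c - b * b) := by linarith
  exact pos_of_mul_pos_right this h0.le

/-- The coordinate fields are images of constant vectors under the tangent map of `e.symm`, hence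
smooth along it; a smooth bundle metric evaluated on two of them is smooth. -/
lemma SurfaceMetric.contDiffAt_inChart (g : SurfaceMetric M) {e : OpenPartialHomeomorph M ℂ}
    (he : e ∈ atlas ℂ M) {z : ℂ} (hz : z ∈ e.target) (i j : Fin 2) :
    ContDiffAt ℝ ∞ (fun w => g.inChart e w i j) z := by
  have hs : ContMDiffOn 𝓘(ℝ, ℂ) 𝓘(ℝ, ℂ) ∞ e.symm e.target := fun w hw =>
    (contMDiffAt_chart_symm he hw).contMDiffWithinAt
  have ht := hs.contMDiffOn_tangentMapWithin (m := ∞) (by simp) e.open_target.uniqueMDiffOn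
  have hv : ∀ v : ℂ, ContMDiffAt 𝓘(ℝ, ℂ) 𝓘(ℝ, ℂ).tangent ∞
      (fun w => (⟨e.symm w, surfDeriv e.symm w v⟩ : TangentBundle 𝓘(ℝ, ℂ) M)) z := by
    intro v
    have hc : ContMDiffAt 𝓘(ℝ, ℂ) 𝓘(ℝ, ℂ).tangent ∞
        (fun w => (⟨w, v⟩ : TangentBundle 𝓘(ℝ, ℂ) ℂ)) z :=
      contMDiffAt_vectorSpace_iff_contDiffAt.2 contDiffAt_const
    have hcomp := (ht ⟨z, v⟩ hz).comp (f := fun w => (⟨w, v⟩ : TangentBundle 𝓘(ℝ, ℂ) ℂ)) z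
      hc.contMDiffWithinAt (s := e.target) (fun w hw => hw)
    refine (hcomp.congr (fun w hw => ?_) ?_).contMDiffAt (e.open_target.mem_nhds hz)
    · simp only [Function.comp_apply, tangentMapWithin, surfDeriv,
        mfderivWithin_of_isOpen e.open_target hw]
      rfl
    · simp only [Function.comp_apply, tangentMapWithin, surfDeriv,
        mfderivWithin_of_isOpen e.open_target hz]
      rfl
  have hg : ContMDiffAt 𝓘(ℝ, ℂ) (𝓘(ℝ, ℂ).prod 𝓘(ℝ, ℂ →L[ℝ] ℂ →L[ℝ] ℝ)) ∞
      (fun w => Bundle.TotalSpace.mk' (ℂ →L[ℝ] ℂ →L[ℝ] ℝ)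
        (E := fun x : M => TangentSpace 𝓘(ℝ, ℂ) x →L[ℝ] TangentSpace 𝓘(ℝ, ℂ) x →L[ℝ] ℝ)
        (e.symm w) (g.inner (e.symm w))) z :=
    g.contMDiff.contMDiffAt.comp z (contMDiffAt_chart_symm he hz)
  have : ContMDiffAt 𝓘(ℝ, ℂ) (𝓘(ℝ, ℂ).prod 𝓘(ℝ)) ∞
      (fun w => Bundle.TotalSpace.mk' ℝ (E := Bundle.Trivial M ℝ) (e.symm w)
        (g.inner (e.symm w) (surfDeriv e.symm w (planeBasis i))
          (surfDeriv e.symm w (planeBasis j)))) z :=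
    ContMDiffAt.clm_bundle_apply₂ (F₁ := ℂ) (F₂ := ℂ) hg (hv (planeBasis i)) (hv (planeBasis j))
  simp only [Bundle.contMDiffAt_totalSpace] at this
  exact contMDiffAt_iff_contDiffAt.1 this.2

/-- A hyperbolic metric is locally isometric to the Poincaré disk. -/
theorem SurfaceMetric.IsHyperbolic.exists_local_isometry [OrientedSurface M] {g : SurfaceMetric M}
    (hg : g.IsHyperbolic) (x : M) : ∃ f : M → ℂ, ∀ᶠ y in 𝓝 x, IsDiskIsometryAt g.val f y := by
  set e := chartAt ℂ x
  have he : e ∈ atlas ℂ M := chart_mem_atlas ℂ x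
  have hx : x ∈ e.source := mem_chart_source ℂ x
  obtain ⟨r, hr, hball⟩ := Metric.isOpen_iff.1 e.open_target _ (e.map_source hx)
  obtain ⟨φ, hφ⟩ := exists_local_isometry_plane (G := g.inChart e) hr (g.inChart_symm e)
    (fun z hz => g.contDiffAt_inChart he (hball hz)) (fun z hz => g.inChart_pos he (hball hz) 0)
    (fun z hz => g.inChart_det_pos he (hball hz)) (fun z hz => hg e he z (hball hz))
  refine ⟨φ ∘ e, ?_⟩
  filter_upwards [(e.continuousAt hx).eventually hφ, e.open_source.mem_nhds hx] with y hy hys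
  obtain ⟨h1, h2, h3, h4⟩ := hy
  have hD : IsDiskIsometryAt (fun z a b => g.val (e.symm z) (surfDeriv e.symm z a)
      (surfDeriv e.symm z b)) φ (e y) := by
    refine ⟨h1.contMDiffAt, h2, by rwa [surfDeriv_eq_fderiv], fun a b => ?_⟩
    rw [surfDeriv_eq_fderiv]
    have hb : ∀ v : ℂ, v = v.re • planeBasis 0 + v.im • planeBasis 1 := fun v => by
      apply Complex.ext <;> simp [planeBasis]
    have k := fun i j => (h4 i j).trans (rfl : _ = g.form (e.symm (e y))
      (surfDeriv e.symm (e y) (planeBasis i)) (surfDeriv e.symm (e y) (planeBasis j)))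
    rw [← g.form_apply]
    conv_lhs => rw [hb a, hb b]
    conv_rhs => rw [hb a, hb b]
    simp only [map_add, map_smul, add_apply, smul_apply, smul_eq_mul, ← k, poincareForm,
      inner_add_left, inner_add_right, inner_smul_left, inner_smul_right, conj_trivial]
    ring
  have := hD.comp (contMDiffAt_chart he hys) (det_surfDeriv_chart_pos he hys)
  refine ⟨this.smooth, this.norm_lt, this.det_pos, fun a b => ?_⟩
  rw [this.isometry]
  have hid : ∀ v, surfDeriv e.symm (e y) (surfDeriv e y v) = v := fun v =>
    congrArg (fun L : ℂ →L[ℝ] ℂ => L v) (surfDeriv_symm_comp_chart he hys)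
  rw [hid, hid, e.left_inv hys]

/-- The pullback of the metric `g` by `p`. -/
def SurfaceMetric.pull {N : Type*} [TopologicalSpace N] [ChartedSpace ℂ N] (g : SurfaceMetric M)
    (p : N → M) (y : N) (a b : ℂ) : ℝ := g.val (p y) (surfDeriv p y a) (surfDeriv p y b)

lemma SurfaceMetric.IsHyperbolic.exists_local_isometry_pull [OrientedSurface M]
    {N : Type*} [TopologicalSpace N] [ChartedSpace ℂ N] {g : SurfaceMetric M}
    (hg : g.IsHyperbolic) {p : N → M} (hp : ContMDiff 𝓘(ℝ, ℂ) 𝓘(ℝ, ℂ) ∞ p)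
    (hdet : IsOrientationPreserving p) (x : N) :
    ∃ f : N → ℂ, ∀ᶠ y in 𝓝 x, IsDiskIsometryAt (g.pull p) f y := by
  obtain ⟨f, hf⟩ := hg.exists_local_isometry (p x)
  exact ⟨f ∘ p, (hp.continuous.continuousAt.eventually hf).mono fun y hy =>
    hy.comp (hp y) (hdet y)⟩

end Chart

/-! ### The developing map -/

/-- A locally constant cocycle on a simply connected space splits. -/
theorem exists_cocycle_splitting {X G : Type*} [TopologicalSpace X] [SimplyConnectedSpace X]
    [LocallyPathConnectedSpace X] [Group G] {U : X → Set X} (hU : ∀ x, IsOpen (U x))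
    (hxU : ∀ x, x ∈ U x) {c : X → X → X → G}
    (hc : ∀ i j, ∀ x ∈ U i ∩ U j, ∀ᶠ y in 𝓝 x, c i j y = c i j x)
    (hcomp : ∀ i j k, ∀ x ∈ U i ∩ U j ∩ U k, c i j x * c j k x = c i k x) :
    ∃ s : X → G, ∀ x, ∀ᶠ y in 𝓝 x, s y * c y x y = s x := by
  let _ : TopologicalSpace G := ⊥
  have _ : DiscreteTopology G := ⟨rfl⟩
  have hself : ∀ i, ∀ x ∈ U i, c i i x = 1 := fun i x hx => by
    have := hcomp i i i x ⟨⟨hx, hx⟩, hx⟩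
    simpa using this
  -- The cocycle glues a bundle with discrete fibre `G`. This is a covering, which has a global
  -- section over a simply connected base; `s` is the section read in the trivialisation indexed by
  -- the point itself.
  let Z : FiberBundleCore X X G :=
    { baseSet := U
      isOpen_baseSet := hU
      indexAt := id
      mem_baseSet_at := hxU
      coordChange := fun i j x v => v * c i j x
      coordChange_self := fun i x hx v => by rw [hself i x hx, mul_one]
      continuousOn_coordChange := by
        rintro i j ⟨x, v⟩ ⟨hx, -⟩
        refine ContinuousAt.continuousWithinAt ?_
        have h1 : ContinuousAt (fun p : X × G => p.2 * c i j x) (x, v) :=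
          (continuous_of_discreteTopology (f := fun w : G => w * c i j x)).continuousAt.comp
            continuousAt_snd
        refine h1.congr ?_
        filter_upwards [continuousAt_fst.eventually (hc i j x hx)] with p hp
        rw [hp]
      coordChange_comp := fun i j k x hx v => by
        rw [mul_assoc, hcomp i j k x hx] }
  have hcov : IsCoveringMap (Bundle.TotalSpace.proj : Bundle.TotalSpace G Z.Fiber → X) :=
    FiberBundle.isCoveringMap
  obtain ⟨x₀⟩ : Nonempty X := inferInstance
  obtain ⟨F, ⟨-, hF⟩, -⟩ := hcov.existsUnique_continuousMap_lifts (ContinuousMap.id X) x₀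
    (⟨x₀, (1 : G)⟩ : Bundle.TotalSpace G Z.Fiber) rfl
  have hF1 : ∀ y, (F y).1 = y := fun y => congrFun hF y
  let s : X → G := fun y => (F y).2
  refine ⟨s, fun x => ?_⟩
  have hcont : ContinuousAt (fun y => (Z.localTriv x (F y)).2) x := by
    refine continuousAt_snd.comp ((Z.localTriv x).continuousAt ?_ |>.comp F.continuous.continuousAt)
    rw [Bundle.Trivialization.mem_source]
    change (F x).1 ∈ U x
    rw [hF1]; exact hxU x
  have hev := hcont.eventually (IsOpen.mem_nhds (isOpen_discrete {(Z.localTriv x (F x)).2}) rfl)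
  filter_upwards [hev] with y hy
  have e : ∀ y, (Z.localTriv x (F y)).2 = s y * c y x y := by
    intro y
    change s y * c (F y).1 x (F y).1 = _
    rw [hF1]
  have hy' : (Z.localTriv x (F y)).2 = (Z.localTriv x (F x)).2 := hy
  rw [e, e, hself x x (hxU x), mul_one] at hy'
  exact hy'

/-- By rigidity the local isometries `f i` and `f j` differ by an element of `PSU11` that is locally
constant on the overlap. A splitting `s` of this cocycle corrects them to one global map. -/
theorem exists_developing_map {M : Type*} [TopologicalSpace M] [ChartedSpace ℂ M]
    [IsManifold 𝓘(ℝ, ℂ) ∞ M] [SimplyConnectedSpace M] [LocallyPathConnectedSpace M]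
    {Q : M → ℂ → ℂ → ℝ}
    (hloc : ∀ x, ∃ f : M → ℂ, ∀ᶠ y in 𝓝 x, IsDiskIsometryAt Q f y) :
    ∃ F : M → ℂ, ∀ y, IsDiskIsometryAt Q F y := by
  choose f hf using hloc
  choose U hUf hU hxU using fun x => eventually_nhds_iff.1 (hf x)
  have hfU : ∀ i, ∀ x ∈ U i, ∀ᶠ y in 𝓝 x, IsDiskIsometryAt Q (f i) y := fun i x hx =>
    Filter.eventually_of_mem ((hU i).mem_nhds hx) (hUf i)
  -- The element depends on the point as well, since an overlap may be disconnected. Off the overlap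
  -- the value is immaterial and set to one.
  have hex : ∀ i j x, ∃ g : PSU11, x ∈ U i ∩ U j → ∀ᶠ y in 𝓝 x, f i y = g.act (f j y) := by
    intro i j x
    by_cases hx : x ∈ U i ∩ U j
    · obtain ⟨g, hg⟩ := IsDiskIsometryAt.exists_act_eq (hfU j x hx.2) (hfU i x hx.1)
      exact ⟨g, fun _ => hg⟩
    · exact ⟨1, fun h => absurd h hx⟩
  choose c hc using hex
  obtain ⟨s, hs⟩ := exists_cocycle_splitting hU hxU (c := c)
    (by
      intro i j x hx
      filter_upwards [(hc i j x hx).eventually_nhds, ((hU i).inter (hU j)).mem_nhds hx] with y hy hyU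
      refine PSU11.eq_of_act_comp_eventuallyEq (hfU j y hyU.2) ?_
      filter_upwards [hy, hc i j y hyU] with w h1 h2
      rw [← h1, ← h2])
    (by
      intro i j k x hx
      refine PSU11.eq_of_act_comp_eventuallyEq (hfU k x hx.2) ?_
      filter_upwards [hc i j x hx.1, hc j k x ⟨hx.1.2, hx.2⟩, hc i k x ⟨hx.1.1, hx.2⟩,
        hfU k x hx.2] with w h1 h2 h3 h4
      rw [PSU11.act_mul _ _ h4.norm_lt, ← h2, ← h1, ← h3])
  refine ⟨fun y => (s y).act (f y y), fun x => ?_⟩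
  refine ((hf x).self_of_nhds.act_comp (s x)).congr ?_
  filter_upwards [hs x, (hU x).mem_nhds (hxU x)] with y hy hyU
  have h1 := (hc y x y ⟨hxU y, hyU⟩).self_of_nhds
  rw [h1, ← PSU11.act_mul _ _ (hUf x y hyU).norm_lt, hy]
  rfl

/-! ### The Riemannian distance of a surface -/

section Distance

variable {M : Type*} [TopologicalSpace M] [ChartedSpace ℂ M] [IsManifold 𝓘(ℝ, ℂ) ∞ M]

lemma SurfaceMetric.dist_comm (g : SurfaceMetric M) (x y : M) : g.dist x y = g.dist y x := by
  let _ : Bundle.RiemannianBundle (fun x : M => TangentSpace 𝓘(ℝ, ℂ) x) := ⟨g.toRiemannianMetric⟩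
  exact Manifold.riemannianEDist_comm

lemma SurfaceMetric.dist_triangle (g : SurfaceMetric M) (x y z : M) :
    g.dist x z ≤ g.dist x y + g.dist y z := by
  let _ : Bundle.RiemannianBundle (fun x : M => TangentSpace 𝓘(ℝ, ℂ) x) := ⟨g.toRiemannianMetric⟩
  exact Manifold.riemannianEDist_triangle

lemma SurfaceMetric.exists_dist_lt_subset [T2Space M] (g : SurfaceMetric M) {x : M} {s : Set M}
    (hs : s ∈ 𝓝 x) : ∃ c > 0, {y | g.dist x y < c} ⊆ s := by
  let _ : Bundle.RiemannianBundle (fun x : M => TangentSpace 𝓘(ℝ, ℂ) x) := ⟨g.toRiemannianMetric⟩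
  have _ : IsManifold 𝓘(ℝ, ℂ) 1 M := IsManifold.of_le (n := ∞) (by simp)
  have _ : LocallyCompactSpace M := ChartedSpace.locallyCompactSpace ℂ M
  have _ : IsContinuousRiemannianBundle ℂ (fun x : M => TangentSpace 𝓘(ℝ, ℂ) x) :=
    ⟨g.inner, g.contMDiff.continuous, fun _ _ _ => rfl⟩
  exact setOfPred_riemannianEDist_lt_subset_nhds' 𝓘(ℝ, ℂ) hs

lemma SurfaceMetric.dist_le_of_speed_le (g : SurfaceMetric M) {γ : ℝ → M} {a b C : ℝ}
    (hab : a ≤ b) (hC : 0 ≤ C)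
    (hγ : ∀ t ∈ Set.Icc a b, ContMDiffAt 𝓘(ℝ, ℝ) 𝓘(ℝ, ℂ) 1 γ t)
    (hspeed : ∀ t ∈ Set.Icc a b, g.val (γ t) (mfderiv 𝓘(ℝ, ℝ) 𝓘(ℝ, ℂ) γ t (1 : ℝ))
      (mfderiv 𝓘(ℝ, ℝ) 𝓘(ℝ, ℂ) γ t (1 : ℝ)) ≤ C ^ 2) :
    g.dist (γ a) (γ b) ≤ ENNReal.ofReal (C * (b - a)) := by
  let _ : Bundle.RiemannianBundle (fun x : M => TangentSpace 𝓘(ℝ, ℂ) x) := ⟨g.toRiemannianMetric⟩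
  refine (Manifold.riemannianEDist_le_pathELength (I := 𝓘(ℝ, ℂ)) (γ := γ)
    (fun t ht => (hγ t ht).contMDiffWithinAt) rfl rfl hab).trans ?_
  rw [Manifold.pathELength_eq_lintegral_mfderiv_Icc]
  calc _ ≤ ∫⁻ t in Set.Icc a b, ENNReal.ofReal C := by
        refine MeasureTheory.setLIntegral_mono measurable_const fun t ht => ?_
        rw [← ofReal_norm]
        refine ENNReal.ofReal_le_ofReal (abs_le_of_sq_le_sq' ?_ hC).2
        rw [← real_inner_self_eq_norm_sq]
        exact hspeed t ht
    _ = ENNReal.ofReal (C * (b - a)) := by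
        rw [MeasureTheory.setLIntegral_const, Real.volume_Icc, ← ENNReal.ofReal_mul hC]

/-- In a complete surface, curves of bounded speed on a finite interval have a limit. -/
lemma SurfaceMetric.IsComplete.exists_tendsto [T2Space M] {g : SurfaceMetric M}
    (hg : g.IsComplete) {γ : ℝ → M} {a b C : ℝ} (hab : a < b) (hC : 0 ≤ C)
    (hγ : ∀ s ∈ Set.Ioo a b, ∀ t ∈ Set.Ioo a b, s ≤ t →
      g.dist (γ s) (γ t) ≤ ENNReal.ofReal (C * (t - s))) :
    ∃ x, Filter.Tendsto γ (𝓝[<] b) (𝓝 x) := by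
  have hγ' : ∀ {δ s t : ℝ}, s ∈ Set.Ioo a b → t ∈ Set.Ioo a b → b - δ ≤ s → b - δ ≤ t →
      g.dist (γ s) (γ t) ≤ ENNReal.ofReal (C * δ) := by
    intro δ s t hs ht hsδ htδ
    rcases le_total s t with h | h
    · refine (hγ s hs t ht h).trans (ENNReal.ofReal_le_ofReal ?_)
      gcongr
      linarith [ht.2]
    · rw [g.dist_comm]
      refine (hγ t ht s hs h).trans (ENNReal.ofReal_le_ofReal ?_)
      gcongr
      linarith [hs.2]
  have hsmall : ∀ ε : ENNReal, 0 < ε → ∃ δ : ℝ, 0 < δ ∧ δ < b - a ∧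
      ENNReal.ofReal (C * δ) < ε := by
    intro ε hε
    have h1 : Filter.Tendsto (fun δ : ℝ => ENNReal.ofReal (C * δ)) (𝓝[>] 0) (𝓝 0) := by
      have : Continuous fun δ : ℝ => ENNReal.ofReal (C * δ) :=
        ENNReal.continuous_ofReal.comp (continuous_const.mul continuous_id)
      have h := this.tendsto 0
      simp only [mul_zero, ENNReal.ofReal_zero] at h
      exact h.mono_left nhdsWithin_le_nhds
    obtain ⟨δ, h2, h3⟩ := ((h1.eventually_lt_const hε).and
      (Ioo_mem_nhdsGT (sub_pos.2 hab))).exists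
    exact ⟨δ, h3.1, h3.2, h2⟩
  -- With `n + 2` rather than `n + 1` the term `u 0` already lies in the open interval.
  let u : ℕ → ℝ := fun n => b - (b - a) / (n + 2)
  have hu : ∀ n, u n ∈ Set.Ioo a b := by
    intro n
    have h1 : 0 < (b - a) / (n + 2) := div_pos (sub_pos.2 hab) (by positivity)
    have h2 : (b - a) / (n + 2) < b - a := div_lt_self (sub_pos.2 hab) (by
      have : (0 : ℝ) ≤ n := n.cast_nonneg
      linarith)
    exact ⟨by simp only [u]; linarith, by simp only [u]; linarith⟩
  have hulim : ∀ δ > 0, ∃ n₀, ∀ n ≥ n₀, b - δ ≤ u n := by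
    intro δ hδ
    obtain ⟨n₀, hn₀⟩ := exists_nat_gt ((b - a) / δ)
    refine ⟨n₀, fun n hn => ?_⟩
    have : (b - a) / (n + 2) ≤ δ := by
      rw [div_le_iff₀ (by positivity)]
      rw [div_lt_iff₀ hδ] at hn₀
      have : (n₀ : ℝ) ≤ n := by exact_mod_cast hn
      nlinarith
    simp only [u]; linarith
  obtain ⟨x, hx⟩ := hg (fun n => γ (u n)) (by
    intro ε hε
    obtain ⟨δ, hδ, -, hlt⟩ := hsmall ε hε
    obtain ⟨n₀, hn₀⟩ := hulim δ hδ
    exact ⟨n₀, fun m hm n hn => (hγ' (hu m) (hu n) (hn₀ m hm) (hn₀ n hn)).trans_lt hlt⟩)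
  refine ⟨x, fun s hs => ?_⟩
  obtain ⟨c, hc, hsub⟩ := g.exists_dist_lt_subset hs
  obtain ⟨δ, hδ, hδ2, hlt⟩ := hsmall (c / 2) (ENNReal.half_pos hc.ne')
  obtain ⟨n₀, hn₀⟩ := hulim δ hδ
  rw [Filter.mem_map]
  obtain ⟨n, hn1, hn2⟩ := ((hx.eventually_lt_const (ENNReal.half_pos hc.ne')).and
    (Filter.eventually_ge_atTop n₀)).exists
  filter_upwards [Ioo_mem_nhdsLT (show b - δ < b by linarith)] with t ht
  refine hsub ?_
  have h1 := hγ' (δ := δ) ⟨by linarith [ht.1], ht.2⟩ (hu n) ht.1.le (hn₀ n hn2)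
  calc g.dist x (γ t) ≤ g.dist x (γ (u n)) + g.dist (γ (u n)) (γ t) := g.dist_triangle _ _ _
    _ < c / 2 + c / 2 := by
        rw [g.dist_comm x, g.dist_comm _ (γ t)]
        exact ENNReal.add_lt_add hn1 (h1.trans_lt hlt)
    _ = c := ENNReal.add_halves c

end Distance

/-! ### Lifting rays of the disk to a complete surface -/

/-- Over an evenly covered neighbourhood of `x` the fibre coordinate of `Γ` is continuous with
values in a discrete space, hence constant near `b`; the limit lies on that sheet. -/
lemma IsCoveringMap.exists_tendsto_lift {E X : Type*} [TopologicalSpace E] [TopologicalSpace X]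
    {p : E → X} (hp : IsCoveringMap p) {Γ : ℝ → E} {a b : ℝ} {x : X} (hab : a < b)
    (hΓ : ContinuousOn Γ (Set.Ioo a b)) (h : Filter.Tendsto (p ∘ Γ) (𝓝[<] b) (𝓝 x)) :
    ∃ y, Filter.Tendsto Γ (𝓝[<] b) (𝓝 y) := by
  have hne : Nonempty (p ⁻¹' {x}) := by
    obtain ⟨-, U, hxU, hU, -, H, -⟩ := hp x
    obtain ⟨t, ht⟩ := (h.eventually (hU.mem_nhds hxU)).exists
    exact ⟨(H ⟨Γ t, ht⟩).2⟩
  have _ : DiscreteTopology (p ⁻¹' {x}) := (hp x).1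
  let e := (hp x).toTrivialization
  have hxe : x ∈ e.baseSet := (hp x).mem_toTrivialization_baseSet
  obtain ⟨t₁, ht₁, hsub⟩ := (mem_nhdsLT_iff_exists_Ioo_subset' hab).1
    (Filter.inter_mem (h.eventually (e.open_baseSet.mem_nhds hxe)) (Ioo_mem_nhdsLT hab))
  have hsrc : Set.MapsTo Γ (Set.Ioo t₁ b) e.source := fun t ht => e.mem_source.2 (hsub ht).1
  have hc : ContinuousOn (fun t => (e (Γ t)).2) (Set.Ioo t₁ b) := by
    refine continuous_snd.comp_continuousOn
      (ContinuousOn.comp (t := e.source) e.toOpenPartialHomeomorph.continuousOn (hΓ.mono fun t ht => (hsub ht).2) hsrc)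
  have ht₁b : t₁ < b := ht₁
  obtain ⟨m, hm⟩ : ∃ m, m ∈ Set.Ioo t₁ b := ⟨(t₁ + b) / 2, by constructor <;> linarith⟩
  set k := (e (Γ m)).2
  refine ⟨e.toOpenPartialHomeomorph.symm (x, k), ?_⟩
  have h1 : Filter.Tendsto (fun t => ((p ∘ Γ) t, k)) (𝓝[<] b) (𝓝 (x, k)) :=
    h.prodMk_nhds tendsto_const_nhds
  have h2 : ContinuousAt e.toOpenPartialHomeomorph.symm (x, k) :=
    e.toOpenPartialHomeomorph.continuousAt_symm (e.mem_target.2 hxe)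
  refine (h2.tendsto.comp h1).congr' ?_
  filter_upwards [Ioo_mem_nhdsLT ht₁b] with t ht
  have h3 : e (Γ t) = (p (Γ t), k) := Prod.ext (e.coe_fst (hsrc ht))
    (isPreconnected_Ioo.constant hc ht hm)
  change e.toOpenPartialHomeomorph.symm (p (Γ t), k) = _
  rw [← h3]
  exact e.toOpenPartialHomeomorph.left_inv (hsrc ht)

section Ray

variable {D : Type*} [TopologicalSpace D]

/-- A continuous lift of the ray through `w` over `[0, T]` that starts at `d`. -/
structure IsRayLift (F : D → ℂ) (d : D) (w : ℂ) (T : ℝ) (Γ : ℝ → D) : Prop where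
  continuousOn : ContinuousOn Γ (Set.Icc 0 T)
  zero : Γ 0 = d
  lift : ∀ t ∈ Set.Icc 0 T, F (Γ t) = t * w

lemma IsRayLift.mono {F : D → ℂ} {d : D} {w : ℂ} {T T' : ℝ} {Γ : ℝ → D}
    (h : IsRayLift F d w T Γ) (hT : T' ≤ T) : IsRayLift F d w T' Γ :=
  ⟨h.continuousOn.mono (Set.Icc_subset_Icc_right hT), h.zero,
    fun t ht => h.lift t ⟨ht.1, ht.2.trans hT⟩⟩

lemma IsRayLift.eqOn [T2Space D] {F : D → ℂ} (hF : IsLocalHomeomorph F) {d : D} {w : ℂ} {T : ℝ}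
    {Γ Γ' : ℝ → D} (h : IsRayLift F d w T Γ) (h' : IsRayLift F d w T Γ') :
    Set.EqOn Γ Γ' (Set.Icc 0 T) := by
  intro t ht
  refine T2Space.isSeparatedMap F |>.eqOn_of_comp_eqOn hF.isLocallyInjective isPreconnected_Icc
    h.continuousOn h'.continuousOn (fun s hs => ?_)
    (Set.left_mem_Icc.2 (ht.1.trans ht.2)) (h.zero.trans h'.zero.symm) ht
  exact (h.lift s hs).trans (h'.lift s hs).symm

variable [ChartedSpace ℂ D]

lemma IsRayLift.extend {F : D → ℂ} (hF : IsLocalDiffeomorph 𝓘(ℝ, ℂ) 𝓘(ℝ, ℂ) ∞ F) {d : D} {w : ℂ}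
    {T y : ℝ} (hT : 0 ≤ T) (hy : T < y) {Γ : ℝ → D} (h : IsRayLift F d w T Γ) :
    ∃ T' ∈ Set.Ioc T y, ∃ Γ', IsRayLift F d w T' Γ' := by
  have hloc := hF (Γ T)
  set s := hloc.localInverse with hs
  have hFT : F (Γ T) = T * w := h.lift T (Set.right_mem_Icc.2 hT)
  have hray : Continuous fun t : ℝ => (t : ℂ) * w := by fun_prop
  have hmem : ∀ᶠ t : ℝ in 𝓝[≥] T, (t : ℂ) * w ∈ s.source := by
    refine nhdsWithin_le_nhds (hray.continuousAt.eventually (s.open_source.mem_nhds ?_))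
    simp only [← hFT]; exact hloc.localInverse_mem_source
  obtain ⟨u, hu, hsub⟩ := mem_nhdsGE_iff_exists_Icc_subset.1
    (Filter.inter_mem hmem (Icc_mem_nhdsGE hy))
  have hTu : T < u := hu
  refine ⟨u, ⟨hu, (hsub (Set.right_mem_Icc.2 hTu.le)).2.2⟩,
    fun t => if t ≤ T then Γ t else s (t * w), ?_⟩
  have hsT : s ((T : ℂ) * w) = Γ T := by
    rw [← hFT]; exact hloc.localInverse_left_inv hloc.localInverse_mem_target
  have e1 : Set.EqOn (fun t : ℝ => if t ≤ T then Γ t else s (t * w)) Γ (Set.Icc 0 T) :=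
    fun t ht => if_pos ht.2
  have e2 : Set.EqOn (fun t : ℝ => if t ≤ T then Γ t else s (t * w)) (fun t : ℝ => s (t * w))
      (Set.Icc T u) := by
    intro t ht
    rcases ht.1.eq_or_lt with rfl | h1
    · simp [hsT]
    · exact if_neg h1.not_ge
  refine ⟨?_, (if_pos hT).trans h.zero, fun t ht => ?_⟩
  · rw [← Set.Icc_union_Icc_eq_Icc hT hTu.le]
    refine (h.continuousOn.congr e1).union_of_isClosed (ContinuousOn.congr ?_ e2) isClosed_Icc
      isClosed_Icc
    exact hloc.localInverse_contMDiffOn.continuousOn.comp hray.continuousOn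
      fun t ht => (hsub ht).1
  · rcases le_total t T with h1 | h1
    · exact (congrArg F (e1 ⟨ht.1, h1⟩)).trans (h.lift t ⟨ht.1, h1⟩)
    · exact (congrArg F (e2 ⟨h1, ht.2⟩)).trans
        (hloc.localInverse_right_inv (hsub ⟨h1, ht.2⟩).1)

variable {S : Type*} [TopologicalSpace S] [ChartedSpace ℂ S] [IsManifold 𝓘(ℝ, ℂ) ∞ S] [T2Space S]
  [IsManifold 𝓘(ℝ, ℂ) ∞ D]

/-- The curve `F ∘ Γ` is the ray, whose Poincaré speed is bounded because it stays in `‖z‖ ≤ ‖w‖`.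
As `F` is an isometry, `p ∘ Γ` has bounded speed in `S` and converges by completeness; the covering
property lifts the limit to `D`. -/
lemma IsRayLift.of_forall_lt [T2Space D] {g : SurfaceMetric S} (hg : g.IsComplete) {p : D → S}
    (hp : IsCoveringMap p) (hps : ContMDiff 𝓘(ℝ, ℂ) 𝓘(ℝ, ℂ) ∞ p) {F : D → ℂ}
    (hF : ∀ y, IsDiskIsometryAt (g.pull p) F y) {d : D} {w : ℂ} (hw : ‖w‖ < 1) {T : ℝ}
    (hT : 0 < T) (hT1 : T ≤ 1) (h : ∀ t ∈ Set.Ico 0 T, ∃ Γ, IsRayLift F d w t Γ) :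
    ∃ Γ, IsRayLift F d w T Γ := by
  have hloc : IsLocalDiffeomorph 𝓘(ℝ, ℂ) 𝓘(ℝ, ℂ) ∞ F := fun x =>
    IsDiskIsometryAt.isLocalDiffeomorphAt (Filter.Eventually.of_forall hF)
  have _ : Nonempty D := ⟨d⟩
  choose! Γ' hΓ' using h
  -- By uniqueness of lifts the diagonal agrees with each `Γ' t` on `[0, t]`, which glues the
  -- partial lifts.
  let Γ : ℝ → D := fun t => Γ' t t
  have hEq : ∀ t ∈ Set.Ico 0 T, Set.EqOn Γ (Γ' t) (Set.Icc 0 t) := by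
    intro t ht s hs
    exact IsRayLift.eqOn hloc.isLocalHomeomorph (hΓ' s ⟨hs.1, hs.2.trans_lt ht.2⟩)
      ((hΓ' t ht).mono hs.2) (Set.right_mem_Icc.2 hs.1)
  have hlift : ∀ t ∈ Set.Ico 0 T, F (Γ t) = t * w := fun t ht =>
    (hΓ' t ht).lift t (Set.right_mem_Icc.2 ht.1)
  have hcont : ContinuousOn Γ (Set.Ico 0 T) := by
    intro t ht
    obtain ⟨u, htu, huT⟩ := exists_between ht.2
    have hu : u ∈ Set.Ico 0 T := ⟨ht.1.trans htu.le, huT⟩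
    have h1 : ContinuousWithinAt Γ (Set.Icc 0 u) t :=
      ((hΓ' u hu).continuousOn.congr (hEq u hu)) t ⟨ht.1, htu.le⟩
    refine h1.mono_of_mem_nhdsWithin ?_
    filter_upwards [self_mem_nhdsWithin, mem_nhdsWithin_of_mem_nhds (Iio_mem_nhds htu)] with s hs hsu
    exact ⟨hs.1, le_of_lt hsu⟩
  have hΓ0 : Γ 0 = d := (hΓ' 0 ⟨le_rfl, hT⟩).zero
  have hder : ∀ t ∈ Set.Ioo 0 T, ContMDiffAt 𝓘(ℝ, ℝ) 𝓘(ℝ, ℂ) ∞ Γ t := by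
    intro t ht
    have hs := (hloc (Γ t)).localInverse_contMDiffAt
    rw [hlift t ⟨ht.1.le, ht.2⟩] at hs
    have hray : ContMDiffAt 𝓘(ℝ, ℝ) 𝓘(ℝ, ℂ) ∞ (fun s : ℝ => (s : ℂ) * w) t :=
      (Complex.ofRealCLM.contDiff.mul contDiff_const).contMDiff.contMDiffAt
    refine (ContMDiffAt.comp t hs hray).congr_of_eventuallyEq ?_
    have hΓt : ContinuousAt Γ t := hcont.continuousAt (Ico_mem_nhds ht.1 ht.2)
    filter_upwards [hΓt.eventually (hloc (Γ t)).localInverse_eventuallyEq_left,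
      Ico_mem_nhds ht.1 ht.2] with s h1 h2
    rw [Function.comp_apply, ← hlift s h2]
    exact h1.symm
  have hspeed : ∀ t ∈ Set.Ioo 0 T, g.val ((p ∘ Γ) t)
      (mfderiv 𝓘(ℝ, ℝ) 𝓘(ℝ, ℂ) (p ∘ Γ) t (1 : ℝ)) (mfderiv 𝓘(ℝ, ℝ) 𝓘(ℝ, ℂ) (p ∘ Γ) t (1 : ℝ)) ≤
        (2 / (1 - ‖w‖ ^ 2)) ^ 2 := by
    intro t ht
    set v : ℂ := mfderiv 𝓘(ℝ, ℝ) 𝓘(ℝ, ℂ) Γ t (1 : ℝ) with hv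
    have hd := (hder t ht).mdifferentiableAt (by simp)
    have e1 : mfderiv 𝓘(ℝ, ℝ) 𝓘(ℝ, ℂ) (p ∘ Γ) t (1 : ℝ) = surfDeriv p (Γ t) v := by
      rw [mfderiv_comp t (hps (Γ t)).mdiffAt hd]
      rfl
    have e2 : surfDeriv F (Γ t) v = w := by
      have h1 : mfderiv 𝓘(ℝ, ℝ) 𝓘(ℝ, ℂ) (F ∘ Γ) t (1 : ℝ) = surfDeriv F (Γ t) v := by
        rw [mfderiv_comp t (hF (Γ t)).smooth.mdiffAt hd]
        rfl
      have h2 : F ∘ Γ =ᶠ[𝓝 t] fun s : ℝ => (s : ℂ) * w := by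
        filter_upwards [Ico_mem_nhds ht.1 ht.2] with s hs using hlift s hs
      rw [← h1, h2.mfderiv_eq, mfderiv_eq_fderiv]
      have h3 : HasDerivAt (fun s : ℝ => (s : ℂ) * w) (1 * w) t :=
        (Complex.ofRealCLM.hasDerivAt (x := t)).mul_const w
      rw [one_mul] at h3
      exact h3.deriv
    have e3 := (hF (Γ t)).isometry v v
    rw [e1]
    change g.pull p (Γ t) v v ≤ _
    rw [← e3, e2, hlift t ⟨ht.1.le, ht.2⟩, poincareForm, real_inner_self_eq_norm_sq, norm_mul,
      Complex.norm_real, Real.norm_of_nonneg ht.1.le]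
    have hw0 := norm_nonneg w
    have h4 : t * ‖w‖ ≤ ‖w‖ := mul_le_of_le_one_left hw0 (ht.2.le.trans hT1)
    have h5 : 0 ≤ t * ‖w‖ := mul_nonneg ht.1.le hw0
    have h6 : 0 < 1 - ‖w‖ ^ 2 := by nlinarith
    have h7 : 1 - ‖w‖ ^ 2 ≤ 1 - (t * ‖w‖) ^ 2 := by nlinarith
    have h8 : ‖w‖ ^ 2 ≤ 1 := by nlinarith
    calc 4 / (1 - (t * ‖w‖) ^ 2) ^ 2 * ‖w‖ ^ 2 ≤ 4 / (1 - ‖w‖ ^ 2) ^ 2 * 1 := by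
          gcongr
      _ = (2 / (1 - ‖w‖ ^ 2)) ^ 2 := by rw [div_pow]; norm_num
  obtain ⟨x, hx⟩ := hg.exists_tendsto (γ := p ∘ Γ) (C := 2 / (1 - ‖w‖ ^ 2)) hT
    (div_nonneg zero_le_two (by nlinarith [norm_nonneg w])) (fun s hs t ht hst => by
      refine g.dist_le_of_speed_le hst (div_nonneg zero_le_two (by nlinarith [norm_nonneg w]))
        (fun u hu => ?_) fun u hu => hspeed u ⟨hs.1.trans_le hu.1, hu.2.trans_lt ht.2⟩
      exact ((hps (Γ u)).comp u (hder u ⟨hs.1.trans_le hu.1, hu.2.trans_lt ht.2⟩)).of_le (by simp))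
  obtain ⟨y, hy⟩ := hp.exists_tendsto_lift hT (hcont.mono Set.Ioo_subset_Ico_self) hx
  refine ⟨Function.update Γ T y, ?_, ?_, ?_⟩
  · rw [← Set.Ico_union_right hT.le, Set.union_singleton]
    intro t ht
    rcases eq_or_ne t T with rfl | hne
    · rw [continuousWithinAt_update_same]
      refine hy.mono_left (nhdsWithin_mono _ ?_)
      rintro s ⟨h1 | h1, h2⟩
      · exact absurd h1 h2
      · exact h1.2
    · rw [continuousWithinAt_update_of_ne hne]
      have htI : t ∈ Set.Ico 0 T := ht.resolve_left hne
      refine (hcont t htI).mono_of_mem_nhdsWithin ?_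
      filter_upwards [self_mem_nhdsWithin, mem_nhdsWithin_of_mem_nhds (Iio_mem_nhds htI.2)]
        with s h1 h2
      rcases h1 with h1 | h1
      · exact absurd h1 (ne_of_lt h2)
      · exact h1
  · rw [Function.update_of_ne hT.ne, hΓ0]
  · intro t ht
    rcases eq_or_ne t T with rfl | hne
    · rw [Function.update_self]
      have h1 : Filter.Tendsto (F ∘ Γ) (𝓝[<] t) (𝓝 (F y)) :=
        (hF y).smooth.continuousAt.tendsto.comp hy
      have h2 : Filter.Tendsto (fun s : ℝ => (s : ℂ) * w) (𝓝[<] t) (𝓝 (t * w)) := by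
        have : Continuous fun s : ℝ => (s : ℂ) * w := by fun_prop
        exact this.continuousAt.tendsto.mono_left nhdsWithin_le_nhds
      refine tendsto_nhds_unique h1 (h2.congr' ?_)
      filter_upwards [Ioo_mem_nhdsLT hT] with s hs using (hlift s ⟨hs.1.le, hs.2⟩).symm
    · rw [Function.update_of_ne hne]
      exact hlift t ⟨ht.1, lt_of_le_of_ne ht.2 hne⟩

/-- Continuity method: the times up to which a lift exists form a set that contains zero, is closed
by `IsRayLift.of_forall_lt`, and can be enlarged to the right by `IsRayLift.extend`. -/
theorem exists_isRayLift [T2Space D] {g : SurfaceMetric S} (hg : g.IsComplete) {p : D → S}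
    (hp : IsCoveringMap p) (hps : ContMDiff 𝓘(ℝ, ℂ) 𝓘(ℝ, ℂ) ∞ p) {F : D → ℂ}
    (hF : ∀ y, IsDiskIsometryAt (g.pull p) F y) {d : D} (hd : F d = 0) {w : ℂ} (hw : ‖w‖ < 1) :
    ∃ Γ, IsRayLift F d w 1 Γ := by
  have hloc : IsLocalDiffeomorph 𝓘(ℝ, ℂ) 𝓘(ℝ, ℂ) ∞ F := fun x =>
    IsDiskIsometryAt.isLocalDiffeomorphAt (Filter.Eventually.of_forall hF)
  let J : Set ℝ := {T | ∃ Γ, IsRayLift F d w T Γ}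
  have h0 : (0 : ℝ) ∈ J := ⟨fun _ => d, continuousOn_const, rfl, fun t ht => by
    have : t = 0 := le_antisymm ht.2 ht.1
    simp [this, hd]⟩
  have hclosed : IsClosed (J ∩ Set.Icc 0 1) := by
    refine isClosed_of_closure_subset fun T hT => ?_
    have hT01 : T ∈ Set.Icc (0 : ℝ) 1 :=
      closure_minimal Set.inter_subset_right isClosed_Icc hT
    refine ⟨?_, hT01⟩
    rcases hT01.1.eq_or_lt with h | hpos
    · rw [← h]; exact h0
    refine IsRayLift.of_forall_lt hg hp hps hF hw hpos hT01.2 fun t ht => ?_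
    obtain ⟨T', h1, ⟨Γ, hΓ⟩, -⟩ := mem_closure_iff.1 hT (Set.Ioi t) isOpen_Ioi ht.2
    exact ⟨Γ, hΓ.mono (le_of_lt h1)⟩
  have := hclosed.Icc_subset_of_forall_exists_gt h0 (by
    rintro T ⟨⟨Γ, hΓ⟩, hT⟩ y hy
    obtain ⟨T', hT', Γ', hΓ'⟩ := hΓ.extend hloc hT.1 hy
    exact ⟨T', ⟨Γ', hΓ'⟩, hT'⟩)
  exact this (Set.right_mem_Icc.2 zero_le_one)

end Ray

/-! ### Developing maps of complete surfaces are bijective -/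

/-- The endpoints of the lifted rays form a continuous section `σ` of `F` over the disk. Both `σ ∘
F` and the identity lift `F` and they agree at `d`, so they coincide on the connected `D`. -/
theorem bijOn_ball_of_isComplete {S D : Type*} [TopologicalSpace S] [ChartedSpace ℂ S]
    [IsManifold 𝓘(ℝ, ℂ) ∞ S] [T2Space S] [TopologicalSpace D] [ChartedSpace ℂ D]
    [IsManifold 𝓘(ℝ, ℂ) ∞ D] [T2Space D] [PreconnectedSpace D]
    {g : SurfaceMetric S} (hg : g.IsComplete) {p : D → S}
    (hp : IsCoveringMap p) (hps : ContMDiff 𝓘(ℝ, ℂ) 𝓘(ℝ, ℂ) ∞ p) {F : D → ℂ}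
    (hF : ∀ y, IsDiskIsometryAt (g.pull p) F y) {d : D} (hd : F d = 0) :
    Set.BijOn F Set.univ (Metric.ball 0 1) := by
  have hloc : IsLocalDiffeomorph 𝓘(ℝ, ℂ) 𝓘(ℝ, ℂ) ∞ F := fun x =>
    IsDiskIsometryAt.isLocalDiffeomorphAt (Filter.Eventually.of_forall hF)
  have hlh := hloc.isLocalHomeomorph
  have hFc : Continuous F := hlh.continuous
  have hsep : IsSeparatedMap F := T2Space.isSeparatedMap F
  have hmem : ∀ x, F x ∈ Metric.ball (0 : ℂ) 1 := fun x => by simpa using (hF x).norm_lt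
  have hray : ∀ w : Metric.ball (0 : ℂ) 1, ∃ Γ, IsRayLift F d w 1 Γ := fun w =>
    exists_isRayLift hg hp hps hF hd (mem_ball_zero_iff.1 w.2)
  choose Γ hΓ using hray
  let f : C(unitInterval × Metric.ball (0 : ℂ) 1, ℂ) := ⟨fun q => ((q.1 : ℝ) : ℂ) * q.2, by fun_prop⟩
  -- For a separated local homeomorphism, lifts that are continuous along each path and at time zero
  -- are jointly continuous.
  have hcont : Continuous fun q : unitInterval × Metric.ball (0 : ℂ) 1 => Γ q.2 q.1 := by
    refine hlh.continuous_lift hsep f ?_ ?_ fun w => ?_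
    · funext q
      exact (hΓ q.2).lift q.1 q.1.2
    · have : (fun w : Metric.ball (0 : ℂ) 1 => Γ w (0 : unitInterval)) = fun _ => d :=
        funext fun w => (hΓ w).zero
      change Continuous fun w : Metric.ball (0 : ℂ) 1 => Γ w (0 : unitInterval)
      rw [this]
      exact continuous_const
    · exact (hΓ w).continuousOn.comp_continuous continuous_subtype_val fun t => t.2
  let σ : Metric.ball (0 : ℂ) 1 → D := fun w => Γ w 1
  have hσ : Continuous σ :=
    hcont.comp (g := fun q : unitInterval × Metric.ball (0 : ℂ) 1 => Γ q.2 q.1)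
      (f := fun w => ((1 : unitInterval), w)) (by fun_prop)
  have hFσ : ∀ w, F (σ w) = w := fun w => by
    have := (hΓ w).lift 1 (Set.right_mem_Icc.2 zero_le_one)
    simpa using this
  have hσ0 : σ ⟨F d, hmem d⟩ = d := by
    have hconst : IsRayLift F d (⟨F d, hmem d⟩ : Metric.ball (0 : ℂ) 1) 1 fun _ => d :=
      ⟨continuousOn_const, rfl, fun t _ => by simp [hd]⟩
    exact (hΓ ⟨F d, hmem d⟩).eqOn hlh hconst (Set.right_mem_Icc.2 zero_le_one)
  have hid : (fun x => σ ⟨F x, hmem x⟩) = id :=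
    hsep.eq_of_comp_eq hlh.isLocallyInjective (hσ.comp (hFc.subtype_mk hmem)) continuous_id
      (funext fun x => hFσ _) d hσ0
  refine ⟨fun x _ => hmem x, fun x _ y _ hxy => ?_, fun w hw => ⟨σ ⟨w, hw⟩, trivial, hFσ _⟩⟩
  have hx := congrFun hid x
  have hy := congrFun hid y
  simp only [id] at hx hy
  rw [← hx, ← hy]
  congr 2

/-! ### Covering transformations -/

section Deck

variable {E X : Type*} [TopologicalSpace E] [TopologicalSpace X] {p : E → X}

/-- Points with different images are separated in the base, points of one fibre by sheets. This
supplies the Hausdorff property of `D`, which is not assumed. -/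
lemma IsCoveringMap.t2Space [T2Space X] (hp : IsCoveringMap p) : T2Space E := by
  refine ⟨fun x y hxy => ?_⟩
  by_cases h : p x = p y
  · exact hp.isSeparatedMap x y h hxy
  · obtain ⟨u, v, hu, hv, hxu, hyv, huv⟩ := t2_separation h
    exact ⟨p ⁻¹' u, p ⁻¹' v, hu.preimage hp.continuous, hv.preimage hp.continuous, hxu, hyv,
      huv.preimage p⟩

lemma IsCoveringMap.exists_homeomorph_lift [SimplyConnectedSpace E] [LocallyPathConnectedSpace E]
    (hp : IsCoveringMap p) {f g : C(X, X)} (hfg : ∀ x, f (g x) = x) (hgf : ∀ x, g (f x) = x)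
    {x y : E} (hxy : p y = f (p x)) : ∃ T : E ≃ₜ E, (∀ z, p (T z) = f (p z)) ∧ T x = y := by
  obtain ⟨T, ⟨hTx, hT⟩, -⟩ := hp.existsUnique_continuousMap_lifts
    (f.comp ⟨p, hp.continuous⟩) x y hxy
  obtain ⟨T', ⟨hTy, hT'⟩, -⟩ := hp.existsUnique_continuousMap_lifts
    (g.comp ⟨p, hp.continuous⟩) y x (by
      change p x = g (p y)
      rw [hxy, hgf])
  have h1 : ∀ z, p (T z) = f (p z) := congrFun hT
  have h2 : ∀ z, p (T' z) = g (p z) := congrFun hT'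
  have e1 : T' ∘ T = id := hp.eq_of_comp_eq (T'.continuous.comp T.continuous) continuous_id
    (funext fun z => by simp [h1, h2, hgf]) x (by simp [hTx, hTy])
  have e2 : T ∘ T' = id := hp.eq_of_comp_eq (T.continuous.comp T'.continuous) continuous_id
    (funext fun z => by simp [h1, h2, hfg]) y (by simp [hTx, hTy])
  exact ⟨⟨⟨T, T', congrFun e1, congrFun e2⟩, T.continuous, T'.continuous⟩, h1, hTx⟩

lemma IsCoveringMap.exists_deck [SimplyConnectedSpace E] [LocallyPathConnectedSpace E]
    (hp : IsCoveringMap p) {x y : E} (hxy : p y = p x) :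
    ∃ T : E ≃ₜ E, (∀ z, p (T z) = p z) ∧ T x = y :=
  hp.exists_homeomorph_lift (f := ContinuousMap.id X) (g := ContinuousMap.id X)
    (fun _ => rfl) (fun _ => rfl) hxy

/-- A covering transformation carries the lift of a path from `e` to the lift from `T e`; the claim
compares endpoints. -/
lemma IsCoveringMap.monodromy_deck (hp : IsCoveringMap p) (T : C(E, E)) (hT : ∀ z, p (T z) = p z)
    {x y : X} (γ : Path.Homotopic.Quotient x y) (e : p ⁻¹' {x}) :
    (hp.monodromy γ ⟨T e, (hT e).trans e.2⟩ : p ⁻¹' {y}).1 = T (hp.monodromy γ e).1 := by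
  obtain ⟨γ⟩ := γ
  have h0 : γ 0 = p e := γ.source.trans e.2.symm
  have key : T.comp (hp.liftPath γ e h0) = hp.liftPath γ (T e) (h0.trans (hT e).symm) := by
    rw [hp.eq_liftPath_iff']
    refine ⟨?_, by simp [hp.liftPath_zero]⟩
    funext t
    have := congrFun (hp.liftPath_lifts γ (e : E) h0) t
    simp only [Function.comp_apply, ContinuousMap.comp_apply] at this ⊢
    rw [hT, this]
  exact (congrArg (fun Γ : C(unitInterval, E) => Γ 1) key).symm

lemma IsCoveringMap.exists_monodromy_eq [PathConnectedSpace E] (hp : IsCoveringMap p) {x y : E}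
    (hxy : p y = p x) : ∃ γ : Path.Homotopic.Quotient (p x) (p x),
      (hp.monodromy γ ⟨x, rfl⟩ : p ⁻¹' {p x}).1 = y := by
  obtain ⟨Γ⟩ : Nonempty (Path x y) := ⟨PathConnectedSpace.somePath x y⟩
  let γ : Path (p x) (p x) := (Γ.map hp.continuous).cast rfl hxy.symm
  refine ⟨.mk γ, ?_⟩
  have key : (Γ : C(unitInterval, E)) = hp.liftPath γ x γ.source := by
    rw [hp.eq_liftPath_iff']
    exact ⟨rfl, Γ.source⟩
  have := congrArg (fun Γ : C(unitInterval, E) => Γ 1) key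
  exact this.symm.trans Γ.target

end Deck

/-! ### Lifts through local diffeomorphisms -/

section Lift

variable {N M P : Type*} [TopologicalSpace N] [ChartedSpace ℂ N]
  [TopologicalSpace M] [ChartedSpace ℂ M] [TopologicalSpace P] [ChartedSpace ℂ P]

lemma contMDiffAt_of_comp_isLocalDiffeomorphAt {p : M → P} {q : N → P} {ψ : N → M} {x : N}
    (hp : IsLocalDiffeomorphAt 𝓘(ℝ, ℂ) 𝓘(ℝ, ℂ) ∞ p (ψ x)) (hψ : ContinuousAt ψ x)
    (hq : ContMDiffAt 𝓘(ℝ, ℂ) 𝓘(ℝ, ℂ) ∞ q x) (h : ∀ y, p (ψ y) = q y) :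
    ContMDiffAt 𝓘(ℝ, ℂ) 𝓘(ℝ, ℂ) ∞ ψ x := by
  have hs := hp.localInverse_contMDiffAt
  rw [h x] at hs
  refine (hs.comp x hq).congr_of_eventuallyEq ?_
  filter_upwards [hψ.eventually hp.localInverse_eventuallyEq_left] with y hy
  rw [Function.comp_apply, ← h y]
  exact hy.symm

lemma surfDeriv_lift {p : M → P} {q : N → P} {ψ : N → M} {x : N}
    (hp : ContMDiffAt 𝓘(ℝ, ℂ) 𝓘(ℝ, ℂ) ∞ p (ψ x)) (hψ : ContMDiffAt 𝓘(ℝ, ℂ) 𝓘(ℝ, ℂ) ∞ ψ x)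
    (h : ∀ y, p (ψ y) = q y) : (surfDeriv p (ψ x)).comp (surfDeriv ψ x) = surfDeriv q x := by
  rw [← surfDeriv_comp_at x hp.mdiffAt hψ.mdiffAt]
  exact congrArg (fun f : N → P => surfDeriv f x) (funext h)

lemma det_surfDeriv_lift_pos {p : M → P} {q : N → P} {ψ : N → M} {x : N}
    (hp : ContMDiffAt 𝓘(ℝ, ℂ) 𝓘(ℝ, ℂ) ∞ p (ψ x)) (hψ : ContMDiffAt 𝓘(ℝ, ℂ) 𝓘(ℝ, ℂ) ∞ ψ x)
    (h : ∀ y, p (ψ y) = q y) (h1 : 0 < (surfDeriv p (ψ x)).det) (h2 : 0 < (surfDeriv q x).det) :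
    0 < (surfDeriv ψ x).det := by
  rw [← surfDeriv_lift hp hψ h, det_comp'] at h2
  exact pos_of_mul_pos_right h2 h1.le

end Lift

/-! ### Global rigidity -/

section Rigidity

variable {M : Type*} [TopologicalSpace M] [ChartedSpace ℂ M] [IsManifold 𝓘(ℝ, ℂ) ∞ M]
  [PreconnectedSpace M] {Q : M → ℂ → ℂ → ℝ}

/-- Local rigidity gives an element at each point; its uniqueness makes it locally constant, hence
constant by connectedness. -/
theorem exists_act_eq_of_isDiskIsometry {F₁ F₂ : M → ℂ} (h₁ : ∀ x, IsDiskIsometryAt Q F₁ x)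
    (h₂ : ∀ x, IsDiskIsometryAt Q F₂ x) : ∃ g : PSU11, ∀ x, F₂ x = g.act (F₁ x) := by
  choose g hg using fun x => IsDiskIsometryAt.exists_act_eq (x := x)
    (Filter.Eventually.of_forall h₁) (Filter.Eventually.of_forall h₂)
  have hloc : IsLocallyConstant g := by
    rw [IsLocallyConstant.iff_eventually_eq]
    intro x
    filter_upwards [(hg x).eventually_nhds] with y hy
    refine PSU11.eq_of_act_comp_eventuallyEq (Filter.Eventually.of_forall h₁) (x := y) ?_
    filter_upwards [hy, hg y] with z hz hz'
    rw [← hz, ← hz']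
  rcases isEmpty_or_nonempty M with hM | ⟨⟨x₀⟩⟩
  · exact ⟨1, fun x => isEmptyElim x⟩
  · refine ⟨g x₀, fun x => ?_⟩
    rw [hloc.apply_eq_of_preconnectedSpace x₀ x]
    exact (hg x).self_of_nhds

end Rigidity

/-- An element fixing the origin is a rotation, and one taking a positive direction to a positive
direction has angle zero. This gives the uniqueness of `f_h`. -/
lemma PSU11.eq_one_of_normalized {g : PSU11} (h0 : g.act 0 = 0) {c : ℂ} (hc : HasDerivAt g.act c 0)
    {r s : ℝ} (hr : 0 < r) (hs : 0 < s) (h : c * r = s) : g = 1 := by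
  obtain ⟨a, b, hab, hact⟩ := g.exists_rep
  have ha : a ≠ 0 := by
    rintro rfl
    simp only [norm_zero] at hab
    nlinarith [sq_nonneg ‖b‖]
  have hca : (starRingEnd ℂ) a ≠ 0 := by simpa using ha
  have hb : b = 0 := by
    rw [hact] at h0
    simpa [ha] using h0
  have hk : ∀ z, g.act z = a / (starRingEnd ℂ) a * z := fun z => by
    rw [hact, hb]
    simp only [map_zero, zero_mul, zero_add, add_zero]
    ring
  have hd : HasDerivAt g.act (a / (starRingEnd ℂ) a) 0 := by
    rw [funext hk]
    simpa using (hasDerivAt_id (0 : ℂ)).const_mul (a / (starRingEnd ℂ) a)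
  rw [hc.unique hd] at h
  have hn := congrArg norm h
  rw [norm_mul, norm_div, Complex.norm_conj, div_self (norm_ne_zero_iff.2 ha), one_mul,
    Complex.norm_real, Complex.norm_real, Real.norm_of_nonneg hr.le,
    Real.norm_of_nonneg hs.le] at hn
  have hone : a / (starRingEnd ℂ) a = 1 := by
    rw [hn] at h
    exact mul_right_cancel₀ (Complex.ofReal_ne_zero.2 hs.ne') (h.trans (one_mul _).symm)
  refine PSU11.eq_one_of_act (z := 0) (by simp) (Filter.Eventually.of_forall fun w => ?_)
  rw [hk, hone, one_mul]

/-! ### Normalised isometries and holonomy -/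

section Holonomy

variable {S D : Type*} [TopologicalSpace S] [ChartedSpace ℂ S]
  [TopologicalSpace D] [ChartedSpace ℂ D] {p : D → S} {d₀ : D}

lemma IsUniversalCovering.exists_isCoveringTransformation (hp : IsUniversalCovering p)
    (γ : PiOne S (p d₀)) : ∃ T, IsCoveringTransformation hp d₀ γ T := by
  have _ := hp.simplyConnected
  have _ : LocallyPathConnectedSpace D := ChartedSpace.locallyPathConnectedSpace ℂ D
  obtain ⟨T, hT, hT0⟩ := hp.isCoveringMap.exists_deck
    (x := d₀) (hp.isCoveringMap.monodromy γ.unop ⟨d₀, rfl⟩ : p ⁻¹' {p d₀}).2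
  exact ⟨T, hT, hT0⟩

lemma IsUniversalCovering.deck_eq (hp : IsUniversalCovering p) {T T' : D ≃ₜ D}
    (hT : ∀ x, p (T x) = p x) (hT' : ∀ x, p (T' x) = p x) {x : D} (h : T x = T' x) : T = T' := by
  have _ := hp.simplyConnected
  exact DFunLike.coe_injective (hp.isCoveringMap.eq_of_comp_eq T.continuous T'.continuous
    (funext fun x => (hT x).trans (hT' x).symm) x h)

/-- The lift of the concatenation follows `γ` to `T d₀` and then the translate by `T` of the lift of
`η`, so it ends at `T (T' d₀)`. Concatenation order is thus what makes the holonomy a homomorphism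
rather than an antihomomorphism. -/
lemma IsCoveringTransformation.mul {hp : IsUniversalCovering p} {γ η : PiOne S (p d₀)}
    {T T' : D ≃ₜ D} (hT : IsCoveringTransformation hp d₀ γ T)
    (hT' : IsCoveringTransformation hp d₀ η T') :
    IsCoveringTransformation hp d₀ (γ * η) (T'.trans T) := by
  refine ⟨fun x => (hT.proj _).trans (hT'.proj x), ?_⟩
  have h1 := hp.isCoveringMap.monodromy_deck ⟨T, T.continuous⟩ hT.proj
    (x := p d₀) (y := p d₀) η.unop ⟨d₀, rfl⟩
  have h2 : hp.isCoveringMap.monodromy (x := p d₀) (y := p d₀) (γ * η).unop ⟨d₀, rfl⟩ =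
      hp.isCoveringMap.monodromy (x := p d₀) (y := p d₀) η.unop
        (hp.isCoveringMap.monodromy (x := p d₀) (y := p d₀) γ.unop ⟨d₀, rfl⟩) := by
    have := congrArg (fun P : Equiv.Perm (p ⁻¹' {p d₀}) => P ⟨d₀, rfl⟩)
      (map_mul (hp.isCoveringMap.monodromyPerm (p d₀)) η.unop γ.unop)
    exact this
  rw [h2]
  have h3 : hp.isCoveringMap.monodromy (x := p d₀) (y := p d₀) γ.unop ⟨d₀, rfl⟩ =
      ⟨T d₀, (hT.proj d₀).trans rfl⟩ := Subtype.ext hT.base.symm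
  rw [h3]
  refine Eq.trans ?_ h1.symm
  exact congrArg T hT'.base

variable [IsManifold 𝓘(ℝ, ℂ) ∞ S] {v : TangentSpace 𝓘(ℝ, ℂ) d₀}

lemma IsNormalizedIsometry.isDiskIsometryAt {h : SurfaceMetric S} {f : D → ℂ}
    (hf : IsNormalizedIsometry p h d₀ v f) (x : D) : IsDiskIsometryAt (h.pull p) f x :=
  ⟨hf.smooth x, mem_ball_zero_iff.1 (hf.bijOn.mapsTo (Set.mem_univ x)), hf.orientation x,
    hf.isometry x⟩

/-- A lift `ψ` of a smooth orientation preserving map `φ` which pulls back `h₂` to `h₁`. -/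
lemma IsUniversalCovering.isDiskIsometryAt_comp_lift (hp : IsUniversalCovering p)
    {h₁ h₂ : SurfaceMetric S} {φ : S → S} (hφ : ContMDiff 𝓘(ℝ, ℂ) 𝓘(ℝ, ℂ) ∞ φ)
    (hφ' : IsOrientationPreserving φ) (hpull : IsPullback φ h₁ h₂) {ψ : D → D}
    (hψ : Continuous ψ) (h : ∀ x, p (ψ x) = φ (p x)) {F : D → ℂ}
    (hF : ∀ x, IsDiskIsometryAt (h₂.pull p) F x) (x : D) :
    IsDiskIsometryAt (h₁.pull p) (F ∘ ψ) x := by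
  have hps := hp.isLocalDiffeomorph.contMDiff
  have hq : ContMDiffAt 𝓘(ℝ, ℂ) 𝓘(ℝ, ℂ) ∞ (φ ∘ p) x := (hφ (p x)).comp x (hps x)
  have hψs : ContMDiffAt 𝓘(ℝ, ℂ) 𝓘(ℝ, ℂ) ∞ ψ x :=
    contMDiffAt_of_comp_isLocalDiffeomorphAt (hp.isLocalDiffeomorph (ψ x)) hψ.continuousAt hq h
  have hd : surfDeriv (φ ∘ p) x = (surfDeriv φ (p x)).comp (surfDeriv p x) :=
    surfDeriv_comp_at x (hφ (p x)).mdiffAt (hps x).mdiffAt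
  have hdet : 0 < (surfDeriv ψ x).det := by
    refine det_surfDeriv_lift_pos (q := φ ∘ p) (hps _) hψs h (hp.isOrientationPreserving _) ?_
    rw [hd, det_comp']
    exact mul_pos (hφ' _) (hp.isOrientationPreserving _)
  have hc := (hF (ψ x)).comp hψs hdet
  refine ⟨hc.smooth, hc.norm_lt, hc.det_pos, fun a b => ?_⟩
  have hl : ∀ a, surfDeriv p (ψ x) (surfDeriv ψ x a) = surfDeriv φ (p x) (surfDeriv p x a) :=
    fun a => congrArg (fun L : ℂ →L[ℝ] ℂ => L a)
      ((surfDeriv_lift (hps _) hψs h (q := φ ∘ p)).trans hd)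
  rw [hc.isometry, SurfaceMetric.pull, SurfaceMetric.pull, hl, hl, h, hpull]

lemma IsUniversalCovering.isDiskIsometryAt_comp_deck (hp : IsUniversalCovering p)
    {h : SurfaceMetric S} {T : D → D} (hT : Continuous T) (hpT : ∀ x, p (T x) = p x) {F : D → ℂ}
    (hF : ∀ x, IsDiskIsometryAt (h.pull p) F x) (x : D) :
    IsDiskIsometryAt (h.pull p) (F ∘ T) x :=
  hp.isDiskIsometryAt_comp_lift (φ := id) contMDiff_id
    (fun x => by rw [surfDeriv_id, det_id']; exact one_pos)
    (fun x v w => by rw [surfDeriv_id]; rfl) hT hpT hF x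

variable [IsManifold 𝓘(ℝ, ℂ) ∞ D]

lemma IsNormalizedIsometry.eq [PreconnectedSpace D] {h : SurfaceMetric S} {f₁ f₂ : D → ℂ}
    (h₁ : IsNormalizedIsometry p h d₀ v f₁) (h₂ : IsNormalizedIsometry p h d₀ v f₂) :
    f₁ = f₂ := by
  obtain ⟨g, hg⟩ := exists_act_eq_of_isDiskIsometry h₁.isDiskIsometryAt h₂.isDiskIsometryAt
  obtain ⟨r, hr, hr'⟩ := h₁.direction
  obtain ⟨s, hs, hs'⟩ := h₂.direction
  have h0 : ‖(0 : ℂ)‖ < 1 := by simp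
  obtain ⟨c, -, hc, -⟩ := g.hasDerivAt_act h0
  have hgs : ContMDiffAt 𝓘(ℝ, ℂ) 𝓘(ℝ, ℂ) ∞ g.act (f₁ d₀) :=
    (g.contDiffAt_act (by rw [h₁.base]; exact h0)).contMDiffAt
  have e : surfDeriv f₂ d₀ = (surfDeriv g.act (f₁ d₀)).comp (surfDeriv f₁ d₀) := by
    rw [← surfDeriv_comp_at d₀ hgs.mdiffAt (h₁.smooth d₀).mdiffAt]
    exact congrArg (fun f : D → ℂ => surfDeriv f d₀) (funext hg)
  have e' : ∀ u : ℂ, surfDeriv f₂ d₀ u = c * surfDeriv f₁ d₀ u := fun u => by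
    rw [e, ContinuousLinearMap.comp_apply, h₁.base, surfDeriv_eq_fderiv, hc.fderiv_real_apply]
  have hone : g = 1 := PSU11.eq_one_of_normalized
    (by rw [← h₁.base, ← hg, h₂.base, h₁.base]) hc hr hs (by rw [← hr', ← hs']; exact (e' v).symm)
  funext x
  rw [hg x, hone, PSU11.act_one]

theorem IsHolonomy.eq {hp : IsUniversalCovering p} {h : Hyp S} {ρ ρ' : PiOne S (p d₀) →* PSU11}
    (hρ : IsHolonomy hp d₀ v h ρ) (hρ' : IsHolonomy hp d₀ v h ρ') : ρ = ρ' := by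
  have _ := hp.simplyConnected
  obtain ⟨f, hf, H⟩ := hρ
  obtain ⟨f', hf', H'⟩ := hρ'
  obtain rfl := hf.eq hf'
  ext γ
  obtain ⟨T, hT, hT1⟩ := H γ
  obtain ⟨T', hT', hT1'⟩ := H' γ
  obtain rfl := hp.deck_eq hT.proj hT'.proj (hT.base.trans hT'.base.symm)
  exact PSU11.eq_of_act_comp_eventuallyEq (Filter.Eventually.of_forall hf.isDiskIsometryAt)
    (x := d₀) (Filter.Eventually.of_forall fun x => (hT1 x).symm.trans (hT1' x))

variable [T2Space S] [OrientedSurface S]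

/-- A developing map followed by the normalising element of `PSU11`. The normalisation comes before
bijectivity, whose proof lifts rays from the origin. -/
lemma IsUniversalCovering.exists_isNormalizedIsometry (hp : IsUniversalCovering p) (h : Hyp S)
    (hv : v ≠ 0) : ∃ f, IsNormalizedIsometry p h.1 d₀ v f := by
  have _ := hp.simplyConnected
  have _ : LocallyPathConnectedSpace D := ChartedSpace.locallyPathConnectedSpace ℂ D
  have _ : T2Space D := hp.isCoveringMap.t2Space
  have hps := hp.isLocalDiffeomorph.contMDiff
  obtain ⟨F, hF⟩ := exists_developing_map (Q := h.1.pull p) fun x =>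
    h.2.1.exists_local_isometry_pull hps hp.isOrientationPreserving x
  have hu : surfDeriv F d₀ v ≠ 0 := by
    intro h0
    have hdet := (hF d₀).det_pos
    have := (hF d₀).isometry v v
    have hp0 : surfDeriv p d₀ v ≠ 0 := by
      intro h1
      have hinj : Function.Injective (surfDeriv p d₀) :=
        (LinearMap.equivOfDetNeZero (surfDeriv p d₀ : ℂ →ₗ[ℝ] ℂ)
          (hp.isOrientationPreserving d₀).ne').injective
      exact hv (hinj (h1.trans (map_zero (surfDeriv p d₀)).symm))
    have hpos := h.1.val_self_pos (p d₀) hp0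
    rw [h0] at this
    simp only [poincareForm, inner_zero_left, mul_zero] at this
    exact hpos.ne this
  obtain ⟨g, hg0, hg⟩ := PSU11.exists_normalize (hF d₀).norm_lt hu
  have hgF : ∀ x, IsDiskIsometryAt (h.1.pull p) (g.act ∘ F) x := fun x => (hF x).act_comp g
  obtain ⟨c, -, hc, -⟩ := g.hasDerivAt_act (hF d₀).norm_lt
  obtain ⟨r, hr, hcr⟩ := hg c hc
  refine ⟨g.act ∘ F, fun x => (hgF x).smooth,
    bijOn_ball_of_isComplete h.2.2 hp.isCoveringMap hps hgF (d := d₀) hg0,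
    fun x => (hgF x).isometry, fun x => (hgF x).det_pos, hg0, r, hr, ?_⟩
  have e : ∀ u : ℂ, surfDeriv (g.act ∘ F) d₀ u = c * surfDeriv F d₀ u := fun u => by
    rw [surfDeriv_comp_at d₀ (g.contDiffAt_act (hF d₀).norm_lt).contMDiffAt.mdiffAt
      (hF d₀).smooth.mdiffAt, ContinuousLinearMap.comp_apply, surfDeriv_eq_fderiv,
      hc.fderiv_real_apply]
  exact (e v).trans hcr

/-- The holonomy homomorphism of a complete hyperbolic metric exists. -/
theorem IsUniversalCovering.exists_isHolonomy (hp : IsUniversalCovering p) (h : Hyp S)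
    (hv : v ≠ 0) : ∃ ρ, IsHolonomy hp d₀ v h ρ := by
  have _ := hp.simplyConnected
  obtain ⟨f, hf⟩ := hp.exists_isNormalizedIsometry h hv
  have hfD := hf.isDiskIsometryAt
  choose T hT using fun γ => hp.exists_isCoveringTransformation (d₀ := d₀) γ
  choose g hg using fun γ => exists_act_eq_of_isDiskIsometry hfD
    (hp.isDiskIsometryAt_comp_deck (T γ).continuous (hT γ).proj hfD)
  have hmul : ∀ γ η, g (γ * η) = g γ * g η := by
    intro γ η
    refine PSU11.eq_of_act_comp_eventuallyEq (Filter.Eventually.of_forall hfD) (x := d₀)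
      (Filter.Eventually.of_forall fun x => ?_)
    have e : T (γ * η) = (T η).trans (T γ) := hp.deck_eq (hT _).proj ((hT γ).mul (hT η)).proj
      ((hT _).base.trans ((hT γ).mul (hT η)).base.symm)
    rw [PSU11.act_mul _ _ (hfD x).norm_lt, ← hg, ← hg, Function.comp_apply, e,
      Function.comp_apply]
    exact hg γ (T η x)
  exact ⟨MonoidHom.mk' g hmul, f, hf, fun γ => ⟨T γ, hT γ, fun x => hg γ x⟩⟩

end Holonomy

/-! ### Geodesics of the disk -/

/-- The point dividing the hyperbolic geodesic from `z` to `w` in a ratio given by `t`. -/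
def diskGeodesic (t : ℝ) (z w : ℂ) : ℂ :=
  (t * ((w - z) / (1 - (starRingEnd ℂ) z * w)) + z) /
    (1 + (starRingEnd ℂ) z * (t * ((w - z) / (1 - (starRingEnd ℂ) z * w))))

lemma one_sub_conj_mul_ne_zero {z w : ℂ} (hz : ‖z‖ < 1) (hw : ‖w‖ < 1) :
    1 - (starRingEnd ℂ) z * w ≠ 0 := by
  intro h
  have h1 : ‖(starRingEnd ℂ) z * w‖ = 1 := by
    rw [← sub_eq_zero.1 h, norm_one]
  rw [norm_mul, Complex.norm_conj] at h1
  nlinarith [norm_nonneg z, norm_nonneg w]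

lemma norm_ofReal_mul_lt {t : ℝ} (ht : t ∈ Set.Icc (0 : ℝ) 1) {z : ℂ} (hz : ‖z‖ < 1) :
    ‖(t : ℂ) * z‖ < 1 := by
  rw [norm_mul, Complex.norm_real, Real.norm_of_nonneg ht.1]
  nlinarith [norm_nonneg z, ht.2]

/-- The formula for `diskGeodesic` is the radial contraction `w ↦ t w` conjugated by the translation
of `z` to the origin. The explicit formula serves continuity; this description serves equivariance.
-/
lemma PSU11.exists_act_diskGeodesic {z : ℂ} (hz : ‖z‖ < 1) : ∃ g : PSU11, g.act z = 0 ∧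
    (∀ w, ‖w‖ < 1 → g.act w = (w - z) / (1 - (starRingEnd ℂ) z * w)) ∧
    ∀ t ∈ Set.Icc (0 : ℝ) 1, ∀ w, ‖w‖ < 1 → diskGeodesic t z w = g⁻¹.act (t * g.act w) := by
  obtain ⟨g, hg⟩ := PSU11.exists_translate hz (c := 1) (by simp)
  obtain ⟨g', hg'⟩ := PSU11.exists_translate (w := -z) (by simpa using hz) (c := 1) (by simp)
  simp only [one_pow, one_mul, map_neg, sub_neg_eq_add, neg_mul] at hg hg'
  have hinv : g' * g = 1 := by
    refine PSU11.eq_one_of_act (z := 0) (by simp) ?_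
    filter_upwards [Metric.ball_mem_nhds (0 : ℂ) one_pos] with w hw
    have hw := mem_ball_zero_iff.1 hw
    rw [PSU11.act_mul _ _ hw, hg' _ (g.norm_act_lt hw), hg w hw]
    have h1 := one_sub_conj_mul_ne_zero hz hw
    have h2 := one_sub_conj_mul_ne_zero hz hz
    have e1 : (w - z) / (1 - (starRingEnd ℂ) z * w) + z =
        (1 - (starRingEnd ℂ) z * z) * w / (1 - (starRingEnd ℂ) z * w) := by
      rw [div_add' _ _ _ h1]
      congr 1
      ring
    have e2 : 1 + (starRingEnd ℂ) z * ((w - z) / (1 - (starRingEnd ℂ) z * w)) =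
        (1 - (starRingEnd ℂ) z * z) / (1 - (starRingEnd ℂ) z * w) := by
      rw [← mul_div_assoc, add_comm, div_add' _ _ _ h1]
      congr 1
      ring
    rw [e1, e2, div_div_div_cancel_right₀ h1, mul_div_cancel_left₀ _ h2]
  rw [mul_eq_one_iff_eq_inv] at hinv
  refine ⟨g, by rw [hg z hz, sub_self, zero_div], hg, fun t ht w hw => ?_⟩
  rw [← hinv, hg' _ (norm_ofReal_mul_lt ht (g.norm_act_lt hw)), hg w hw, diskGeodesic]

lemma norm_diskGeodesic_lt {t : ℝ} (ht : t ∈ Set.Icc (0 : ℝ) 1) {z w : ℂ} (hz : ‖z‖ < 1)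
    (hw : ‖w‖ < 1) : ‖diskGeodesic t z w‖ < 1 := by
  obtain ⟨g, -, -, hg⟩ := PSU11.exists_act_diskGeodesic hz
  rw [hg t ht w hw]
  exact PSU11.norm_act_lt _ (norm_ofReal_mul_lt ht (g.norm_act_lt hw))

lemma diskGeodesic_zero (z w : ℂ) : diskGeodesic 0 z w = z := by
  simp [diskGeodesic]

lemma diskGeodesic_one {z w : ℂ} (hz : ‖z‖ < 1) (hw : ‖w‖ < 1) : diskGeodesic 1 z w = w := by
  obtain ⟨g, -, -, hg⟩ := PSU11.exists_act_diskGeodesic hz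
  rw [hg 1 (by simp) w hw, Complex.ofReal_one, one_mul, PSU11.act_inv_act _ hw]

lemma PSU11.act_mul_of_act_zero {g : PSU11} (hg : g.act 0 = 0) (c z : ℂ) :
    g.act (c * z) = c * g.act z := by
  obtain ⟨a, b, hab, hact⟩ := g.exists_rep
  have ha : a ≠ 0 := by
    rintro rfl
    simp only [norm_zero] at hab
    nlinarith [sq_nonneg ‖b‖]
  have hb : b = 0 := by
    rw [hact] at hg
    simpa [ha] using hg
  simp only [hact, hb, map_zero, zero_mul, zero_add, add_zero]
  ring

/-- With `g` and `g'` the translations of `z` and `k z` to the origin, `g' k g⁻¹` fixes the origin.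
It is therefore a rotation and commutes with the contraction by `t`. -/
lemma PSU11.act_diskGeodesic (k : PSU11) {t : ℝ} (ht : t ∈ Set.Icc (0 : ℝ) 1) {z w : ℂ}
    (hz : ‖z‖ < 1) (hw : ‖w‖ < 1) :
    diskGeodesic t (k.act z) (k.act w) = k.act (diskGeodesic t z w) := by
  obtain ⟨g, hgz, -, hg⟩ := PSU11.exists_act_diskGeodesic hz
  obtain ⟨g', hgz', -, hg'⟩ := PSU11.exists_act_diskGeodesic (k.norm_act_lt hz)
  have h0 : ‖(0 : ℂ)‖ < 1 := by simp
  have hginv : g⁻¹.act 0 = z := by rw [← hgz, PSU11.act_inv_act _ hz]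
  have hr0 : (g' * k * g⁻¹).act 0 = 0 := by
    rw [PSU11.act_mul _ _ h0, hginv, PSU11.act_mul _ _ hz, hgz']
  have hgw := norm_ofReal_mul_lt ht (g.norm_act_lt hw)
  have e : g'.act (k.act w) = (g' * k * g⁻¹).act (g.act w) := by
    rw [← PSU11.act_mul _ _ hw, ← PSU11.act_mul _ _ hw]
    group
  rw [hg t ht w hw, hg' t ht _ (k.norm_act_lt hw), e, ← PSU11.act_mul_of_act_zero hr0,
    ← PSU11.act_mul _ _ hgw, ← PSU11.act_mul _ _ hgw]
  group

lemma continuousOn_diskGeodesic : ContinuousOn (fun q : ℝ × ℂ × ℂ => diskGeodesic q.1 q.2.1 q.2.2)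
    (Set.Icc 0 1 ×ˢ Metric.ball 0 1 ×ˢ Metric.ball 0 1) := by
  have hz : Continuous fun q : ℝ × ℂ × ℂ => (starRingEnd ℂ) q.2.1 :=
    Complex.continuous_conj.comp (by fun_prop)
  have h1 : ContinuousOn (fun q : ℝ × ℂ × ℂ => (q.1 : ℂ) *
      ((q.2.2 - q.2.1) / (1 - (starRingEnd ℂ) q.2.1 * q.2.2)))
      (Set.Icc 0 1 ×ˢ Metric.ball 0 1 ×ˢ Metric.ball 0 1) := by
    refine ContinuousOn.mul (by fun_prop) (ContinuousOn.div (by fun_prop) (by fun_prop) ?_)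
    rintro ⟨t, z, w⟩ ⟨-, hz, hw⟩
    exact one_sub_conj_mul_ne_zero (mem_ball_zero_iff.1 hz) (mem_ball_zero_iff.1 hw)
  refine ContinuousOn.div (h1.add (by fun_prop))
    (continuousOn_const.add (hz.continuousOn.mul h1)) ?_
  rintro ⟨t, z, w⟩ ⟨ht, hz, hw⟩
  have hz := mem_ball_zero_iff.1 hz
  have hw := mem_ball_zero_iff.1 hw
  obtain ⟨g, -, hg, -⟩ := PSU11.exists_act_diskGeodesic hz
  have := one_sub_conj_mul_ne_zero (z := -z) (by simpa using hz)
    (norm_ofReal_mul_lt ht (g.norm_act_lt hw))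
  rw [hg w hw, map_neg, neg_mul, sub_neg_eq_add] at this
  exact this

/-! ### Descent and lifting of self-maps along a covering -/

section Descent

variable {E X : Type*} [TopologicalSpace E] [TopologicalSpace X] {p : E → X}

lemma IsCoveringMap.surjective_of_pathConnectedSpace [PathConnectedSpace X] [Nonempty E]
    (hp : IsCoveringMap p) : Function.Surjective p := by
  intro x
  obtain ⟨e⟩ := ‹Nonempty E›
  let γ := PathConnectedSpace.somePath (p e) x
  refine ⟨hp.liftPath γ e γ.source 1, ?_⟩
  exact (congrFun (hp.liftPath_lifts γ e γ.source) 1).trans γ.target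

/-- A map homotopic to the identity has a lift commuting with all covering transformations. -/
lemma IsCoveringMap.exists_lift_of_homotopic_id (hp : IsCoveringMap p) {φ : C(X, X)}
    (h : φ.Homotopic (ContinuousMap.id X)) : ∃ ψ : C(E, E), (∀ x, p (ψ x) = φ (p x)) ∧
      ∀ T : C(E, E), (∀ x, p (T x) = p x) → ∀ x, ψ (T x) = T (ψ x) := by
  -- The homotopy is run from the identity of `X`, so that its lift can start at the identity of
  -- `E`.
  obtain ⟨H⟩ := h.symm
  let K : C(unitInterval × E, X) :=
    H.toContinuousMap.comp ((ContinuousMap.id _).prodMap ⟨p, hp.continuous⟩)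
  have hK : ∀ a, K (0, a) = p (ContinuousMap.id E a) := fun a => H.apply_zero (p a)
  let L := hp.liftHomotopy K (ContinuousMap.id E) hK
  have hL : ∀ q, p (L q) = K q := congrFun (hp.liftHomotopy_lifts K _ hK)
  have hL0 : ∀ a, L (0, a) = a := hp.liftHomotopy_zero K _ hK
  refine ⟨⟨fun a => L (1, a), by fun_prop⟩, fun a => (hL _).trans (H.apply_one (p a)),
    fun T hT a => ?_⟩
  -- The paths `L (t, T a)` and `T (L (t, a))` lift the same path and agree at time zero.
  have := hp.eq_of_comp_eq (A := unitInterval) (g₁ := fun t => L (t, T a))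
    (g₂ := fun t => T (L (t, a))) (by fun_prop) (by fun_prop)
    (funext fun t => by
      simp only [Function.comp_apply, hT, hL]
      change H (t, p (T a)) = H (t, p a)
      rw [hT]) 0 (by simp only [hL0])
  exact congrFun this 1

lemma IsCoveringMap.exists_descent (hp : IsCoveringMap p) (hs : Function.Surjective p) {ψ : C(E, E)}
    (h : ∀ x y, p x = p y → p (ψ x) = p (ψ y)) : ∃ φ : C(X, X), ∀ x, φ (p x) = p (ψ x) := by
  have hq : Topology.IsQuotientMap (⟨p, hp.continuous⟩ : C(E, X)) := hp.isQuotientMap hs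
  let P : C(E, X) := ⟨p, hp.continuous⟩
  exact ⟨hq.lift (P.comp ψ) h, fun x => DFunLike.congr_fun (hq.lift_comp (P.comp ψ) h) x⟩

/-- A covering is open, so its product with the identity of the interval is again a quotient map,
through which the homotopy factors. -/
lemma IsCoveringMap.homotopic_id_of_descent (hp : IsCoveringMap p) (hs : Function.Surjective p)
    {φ : C(X, X)} {K : C(unitInterval × E, E)} (h0 : ∀ x, K (0, x) = x)
    (h1 : ∀ x, p (K (1, x)) = φ (p x)) (h : ∀ t x y, p x = p y → p (K (t, x)) = p (K (t, y))) :
    φ.Homotopic (ContinuousMap.id X) := by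
  let P : C(E, X) := ⟨p, hp.continuous⟩
  let IP : C(unitInterval × E, unitInterval × X) := (ContinuousMap.id _).prodMap P
  have hq : Topology.IsQuotientMap IP :=
    (IsOpenQuotientMap.id.prodMap ⟨hs, hp.continuous, hp.isOpenMap⟩).isQuotientMap
  have hcomp : ∀ a b, IP a = IP b → (P.comp K) a = (P.comp K) b := by
    rintro ⟨t, x⟩ ⟨s, y⟩ hab
    obtain ⟨rfl, hxy⟩ := Prod.mk.inj hab
    exact h t x y hxy
  have hl : ∀ t x, hq.lift (P.comp K) hcomp (t, p x) = p (K (t, x)) := fun t x =>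
    DFunLike.congr_fun (hq.lift_comp (P.comp K) hcomp) (t, x)
  refine ContinuousMap.Homotopic.symm ⟨⟨hq.lift (P.comp K) hcomp, fun x => ?_, fun x => ?_⟩⟩
  · obtain ⟨x, rfl⟩ := hs x
    change hq.lift (P.comp K) hcomp (0, p x) = p x
    rw [hl, h0]
  · obtain ⟨x, rfl⟩ := hs x
    change hq.lift (P.comp K) hcomp (1, p x) = φ (p x)
    rw [hl, h1]

end Descent

/-! ### Conjugate holonomies -/

section Conjugacy

variable {S D : Type*} [TopologicalSpace S] [ChartedSpace ℂ S]
  [TopologicalSpace D] [ChartedSpace ℂ D] {p : D → S} {d₀ : D}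

/-- Projecting a path from `d₀` to `T d₀` yields the loop: every covering transformation is some
`T_γ`, so the holonomy sees all of them. -/
lemma IsUniversalCovering.exists_coveringTransformation_eq (hp : IsUniversalCovering p)
    {T : D ≃ₜ D} (hT : ∀ x, p (T x) = p x) :
    ∃ γ : PiOne S (p d₀), ∀ T', IsCoveringTransformation hp d₀ γ T' → T' = T := by
  have _ := hp.simplyConnected
  obtain ⟨γ, hγ⟩ := hp.isCoveringMap.exists_monodromy_eq (hT d₀)
  exact ⟨MulOpposite.op γ, fun T' hT' => hp.deck_eq hT'.proj hT (hT'.base.trans hγ)⟩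

variable [IsManifold 𝓘(ℝ, ℂ) ∞ S] {v : TangentSpace 𝓘(ℝ, ℂ) d₀} [IsManifold 𝓘(ℝ, ℂ) ∞ D]

/-- Holonomies of equivalent metrics are conjugate. -/
theorem IsHolonomy.exists_conj_of_isPullback {hp : IsUniversalCovering p} {h₁ h₂ : Hyp S}
    {ρ₁ ρ₂ : PiOne S (p d₀) →* PSU11} (H₁ : IsHolonomy hp d₀ v h₁ ρ₁)
    (H₂ : IsHolonomy hp d₀ v h₂ ρ₂) {φ : S ≃ₘ^∞⟮𝓘(ℝ, ℂ), 𝓘(ℝ, ℂ)⟯ S} (hφ : φ ∈ diffPlusZero S)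
    (hpull : IsPullback φ h₁.1 h₂.1) : ∃ g : PSU11, ∀ γ, ρ₂ γ = g * ρ₁ γ * g⁻¹ := by
  have _ := hp.simplyConnected
  obtain ⟨f₁, hf₁, H₁⟩ := H₁
  obtain ⟨f₂, hf₂, H₂⟩ := H₂
  obtain ⟨ψ, hψ, hψT⟩ := hp.isCoveringMap.exists_lift_of_homotopic_id hφ.2
  have hd₁ := hf₁.isDiskIsometryAt
  -- Both `f₁` and `f₂ ∘ ψ` are isometries for the lift of `h₁`. Evaluating `f₂ (ψ (T x))` in two
  -- ways then gives `ρ₂ γ * g = g * ρ₁ γ`.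
  obtain ⟨g, hg⟩ := exists_act_eq_of_isDiskIsometry hd₁
    (hp.isDiskIsometryAt_comp_lift φ.contMDiff hφ.1 hpull ψ.continuous hψ hf₂.isDiskIsometryAt)
  refine ⟨g, fun γ => eq_mul_inv_of_mul_eq ?_⟩
  obtain ⟨T, hT, hT₁⟩ := H₁ γ
  obtain ⟨T', hT', hT₂⟩ := H₂ γ
  obtain rfl := hp.deck_eq hT.proj hT'.proj (hT.base.trans hT'.base.symm)
  refine PSU11.eq_of_act_comp_eventuallyEq (Filter.Eventually.of_forall hd₁) (x := d₀)
    (Filter.Eventually.of_forall fun x => ?_)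
  rw [PSU11.act_mul _ _ (hd₁ x).norm_lt, PSU11.act_mul _ _ (hd₁ x).norm_lt, ← hT₁, ← hg, ← hg,
    Function.comp_apply, Function.comp_apply, ← hT₂]
  exact congrArg f₂ (hψT ⟨T, T.continuous⟩ hT.proj x).symm

end Conjugacy

/-! ### Equivariant isometries -/

/-- The geodesic homotopy between the identity and an equivariant isometry. -/
lemma exists_equivariant_homotopy {E : Type*} [TopologicalSpace E]
    {e₁ e₂ : E ≃ₜ Metric.ball (0 : ℂ) 1} :
    ∃ K : C(unitInterval × E, E), (∀ x, K (0, x) = x) ∧ (∀ x, K (1, x) = e₂.symm (e₁ x)) ∧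
      ∀ (T : E → E) (k : PSU11), (∀ x, (e₁ (T x) : ℂ) = k.act (e₁ x)) →
        (∀ x, (e₂ (T x) : ℂ) = k.act (e₂ x)) → ∀ t x, K (t, T x) = T (K (t, x)) := by
  have h₁ : ∀ x, ‖(e₁ x : ℂ)‖ < 1 := fun x => mem_ball_zero_iff.1 (e₁ x).2
  have h₂ : ∀ x, ‖(e₂ x : ℂ)‖ < 1 := fun x => mem_ball_zero_iff.1 (e₂ x).2
  have hm : ∀ q : unitInterval × E,
      diskGeodesic q.1 (e₂ q.2) (e₁ q.2) ∈ Metric.ball (0 : ℂ) 1 := fun q =>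
    mem_ball_zero_iff.2 (norm_diskGeodesic_lt q.1.2 (h₂ _) (h₁ _))
  have hc : Continuous fun q : unitInterval × E => diskGeodesic q.1 (e₂ q.2) (e₁ q.2) :=
    continuousOn_diskGeodesic.comp_continuous
      (f := fun q : unitInterval × E => ((q.1 : ℝ), ((e₂ q.2 : ℂ), (e₁ q.2 : ℂ)))) (by fun_prop)
      fun q => ⟨q.1.2, (e₂ q.2).2, (e₁ q.2).2⟩
  -- In the coordinate `e₂`, the point `x` moves along the geodesic from `e₂ x` to `e₁ x`.
  let K : C(unitInterval × E, E) :=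
    ⟨fun q => e₂.symm ⟨_, hm q⟩, e₂.symm.continuous.comp (hc.subtype_mk hm)⟩
  have hK : ∀ q, (e₂ (K q) : ℂ) = diskGeodesic q.1 (e₂ q.2) (e₁ q.2) := fun q =>
    congrArg Subtype.val (e₂.apply_symm_apply _)
  refine ⟨K, fun x => e₂.injective (Subtype.ext ?_), fun x => e₂.injective (Subtype.ext ?_),
    fun T k hT₁ hT₂ t x => e₂.injective (Subtype.ext ?_)⟩
  · rw [hK]
    exact diskGeodesic_zero _ _
  · rw [hK, e₂.apply_symm_apply]
    exact diskGeodesic_one (h₂ x) (h₁ x)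
  · rw [hK (t, T x), hT₂ (K (t, x)), hK (t, x)]
    simp only [hT₁, hT₂]
    exact k.act_diskGeodesic t.2 (h₂ x) (h₁ x)

section DiskHomeomorph

variable {E : Type*} [TopologicalSpace E] [ChartedSpace ℂ E] [IsManifold 𝓘(ℝ, ℂ) ∞ E]
  {Q : E → ℂ → ℂ → ℝ}

lemma exists_homeomorph_ball {F : E → ℂ} (hF : ∀ x, IsDiskIsometryAt Q F x)
    (hb : Set.BijOn F Set.univ (Metric.ball 0 1)) :
    ∃ e : E ≃ₜ Metric.ball (0 : ℂ) 1, ∀ x, (e x : ℂ) = F x := by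
  have hloc : IsLocalDiffeomorph 𝓘(ℝ, ℂ) 𝓘(ℝ, ℂ) ∞ F := fun x =>
    IsDiskIsometryAt.isLocalDiffeomorphAt (Filter.Eventually.of_forall hF)
  have hm : ∀ x, F x ∈ Metric.ball (0 : ℂ) 1 := fun x => hb.mapsTo (Set.mem_univ x)
  let G : E → Metric.ball (0 : ℂ) 1 := fun x => ⟨F x, hm x⟩
  have hG : Function.Bijective G :=
    ⟨fun x y hxy => hb.injOn (Set.mem_univ x) (Set.mem_univ y) (congrArg Subtype.val hxy),
      fun z => (hb.surjOn z.2).imp fun x hx => Subtype.ext hx.2⟩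
  have hc : Continuous G := hloc.contMDiff.continuous.subtype_mk hm
  have ho : IsOpenMap G := fun U hU => by
    have := (hloc.isOpenMap U hU).preimage (continuous_subtype_val (p := (· ∈ Metric.ball (0:ℂ) 1)))
    convert this using 1
    ext z
    simp [G, Subtype.ext_iff]
  exact ⟨(Equiv.ofBijective G hG).toHomeomorphOfContinuousOpen hc ho, fun x => rfl⟩

end DiskHomeomorph

section Descent

variable {N M : Type*} [TopologicalSpace N] [ChartedSpace ℂ N]
  [TopologicalSpace M] [ChartedSpace ℂ M]

lemma contMDiffAt_of_comp_right {p : N → M} {φ : M → M} {x : N}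
    (hp : IsLocalDiffeomorphAt 𝓘(ℝ, ℂ) 𝓘(ℝ, ℂ) ∞ p x)
    (h : ContMDiffAt 𝓘(ℝ, ℂ) 𝓘(ℝ, ℂ) ∞ (φ ∘ p) x) :
    ContMDiffAt 𝓘(ℝ, ℂ) 𝓘(ℝ, ℂ) ∞ φ (p x) := by
  have hx : hp.localInverse (p x) = x := hp.localInverse_left_inv hp.localInverse_mem_target
  rw [← hx] at h
  refine (h.comp (p x) hp.localInverse_contMDiffAt).congr_of_eventuallyEq ?_
  filter_upwards [hp.localInverse_eventuallyEq_right] with y hy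
  simp only [Function.comp_apply, id] at hy ⊢
  rw [hy]

end Descent

/-! ### Metrics with conjugate holonomies -/

section Injectivity

variable {S D : Type*} [TopologicalSpace S] [ChartedSpace ℂ S]
  [TopologicalSpace D] [ChartedSpace ℂ D] {p : D → S}

lemma IsUniversalCovering.contMDiff_descent (hp : IsUniversalCovering p)
    (hs : Function.Surjective p) {φ : S → S} {ψ : D → D} (hψ : ContMDiff 𝓘(ℝ, ℂ) 𝓘(ℝ, ℂ) ∞ ψ)
    (h : ∀ x, φ (p x) = p (ψ x)) : ContMDiff 𝓘(ℝ, ℂ) 𝓘(ℝ, ℂ) ∞ φ := by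
  intro y
  obtain ⟨x, rfl⟩ := hs y
  refine contMDiffAt_of_comp_right (hp.isLocalDiffeomorph x) ?_
  rw [show φ ∘ p = p ∘ ψ from funext h]
  exact (hp.isLocalDiffeomorph.contMDiff _).comp x (hψ x)

variable [IsManifold 𝓘(ℝ, ℂ) ∞ S] [IsManifold 𝓘(ℝ, ℂ) ∞ D]

/-- If isometries `F₁` and `F₂` of the universal covering onto the disk, for the lifts of two
metrics, have the same equivariance under covering transformations, the metrics are equivalent. -/
theorem IsUniversalCovering.exists_isPullback_of_equivariant (hp : IsUniversalCovering p)
    (hs : Function.Surjective p) {h₁ h₂ : SurfaceMetric S} {F₁ F₂ : D → ℂ}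
    (hF₁ : ∀ x, IsDiskIsometryAt (h₁.pull p) F₁ x) (hF₂ : ∀ x, IsDiskIsometryAt (h₂.pull p) F₂ x)
    (hb₁ : Set.BijOn F₁ Set.univ (Metric.ball 0 1)) (hb₂ : Set.BijOn F₂ Set.univ (Metric.ball 0 1))
    (hequiv : ∀ T : D ≃ₜ D, (∀ x, p (T x) = p x) → ∃ k : PSU11, ∀ x,
      F₁ (T x) = k.act (F₁ x) ∧ F₂ (T x) = k.act (F₂ x)) :
    ∃ φ ∈ diffPlusZero S, IsPullback φ h₁ h₂ := by
  have _ := hp.simplyConnected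
  have _ : LocallyPathConnectedSpace D := ChartedSpace.locallyPathConnectedSpace ℂ D
  have hps := hp.isLocalDiffeomorph.contMDiff
  obtain ⟨e₁, he₁⟩ := exists_homeomorph_ball hF₁ hb₁
  obtain ⟨e₂, he₂⟩ := exists_homeomorph_ball hF₂ hb₂
  obtain ⟨K, hK0, hK1, hKT⟩ := exists_equivariant_homotopy (e₁ := e₁) (e₂ := e₂)
  -- The homotopy with the roles exchanged is needed for its endpoint, the inverse of the endpoint
  -- of `K`.
  obtain ⟨L, -, hL1, hLT⟩ := exists_equivariant_homotopy (e₁ := e₂) (e₂ := e₁)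
  have hdeck : ∀ x y, p x = p y → ∃ T : D ≃ₜ D, (∀ z, p (T z) = p z) ∧ T x = y ∧
      (∀ t z, K (t, T z) = T (K (t, z))) ∧ ∀ t z, L (t, T z) = T (L (t, z)) := by
    intro x y hxy
    obtain ⟨T, hT, hTx⟩ := hp.isCoveringMap.exists_deck hxy.symm
    obtain ⟨k, hk⟩ := hequiv T hT
    have k₁ : ∀ x, (e₁ (T x) : ℂ) = k.act (e₁ x) := fun x => by rw [he₁, he₁, (hk x).1]
    have k₂ : ∀ x, (e₂ (T x) : ℂ) = k.act (e₂ x) := fun x => by rw [he₂, he₂, (hk x).2]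
    exact ⟨T, hT, hTx, hKT T k k₁ k₂, hLT T k k₂ k₁⟩
  have hK : ∀ t x y, p x = p y → p (K (t, x)) = p (K (t, y)) := by
    intro t x y hxy
    obtain ⟨T, hT, rfl, hT', -⟩ := hdeck x y hxy
    rw [hT', hT]
  have hL : ∀ t x y, p x = p y → p (L (t, x)) = p (L (t, y)) := by
    intro t x y hxy
    obtain ⟨T, hT, rfl, -, hT'⟩ := hdeck x y hxy
    rw [hT', hT]
  let ψ : C(D, D) := ⟨fun x => K (1, x), by fun_prop⟩
  let ψ' : C(D, D) := ⟨fun x => L (1, x), by fun_prop⟩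
  have hψψ' : ∀ x, ψ (ψ' x) = x := fun x => by
    change K (1, L (1, x)) = x
    rw [hK1, hL1, e₁.apply_symm_apply, e₂.symm_apply_apply]
  have hψ'ψ : ∀ x, ψ' (ψ x) = x := fun x => by
    change L (1, K (1, x)) = x
    rw [hK1, hL1, e₂.apply_symm_apply, e₁.symm_apply_apply]
  have hψF : ∀ x, F₂ (ψ x) = F₁ x := fun x => by
    change F₂ (K (1, x)) = F₁ x
    rw [hK1, ← he₂, e₂.apply_symm_apply, he₁]
  have hψF' : ∀ x, F₁ (ψ' x) = F₂ x := fun x => by rw [← hψF, hψψ']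
  have hψs : ContMDiff 𝓘(ℝ, ℂ) 𝓘(ℝ, ℂ) ∞ ψ := fun x => contMDiffAt_of_comp_isLocalDiffeomorphAt
    (IsDiskIsometryAt.isLocalDiffeomorphAt (Filter.Eventually.of_forall hF₂))
    ψ.continuous.continuousAt (hF₁ x).smooth hψF
  have hψs' : ContMDiff 𝓘(ℝ, ℂ) 𝓘(ℝ, ℂ) ∞ ψ' := fun x => contMDiffAt_of_comp_isLocalDiffeomorphAt
    (IsDiskIsometryAt.isLocalDiffeomorphAt (Filter.Eventually.of_forall hF₁))
    ψ'.continuous.continuousAt (hF₂ x).smooth hψF'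
  obtain ⟨φ, hφ⟩ := hp.isCoveringMap.exists_descent hs (ψ := ψ) (hK 1)
  obtain ⟨φ', hφ'⟩ := hp.isCoveringMap.exists_descent hs (ψ := ψ') (hL 1)
  have hφs := hp.contMDiff_descent hs hψs hφ
  let Φ : S ≃ₘ^∞⟮𝓘(ℝ, ℂ), 𝓘(ℝ, ℂ)⟯ S :=
    { toFun := φ
      invFun := φ'
      left_inv := fun y => by
        obtain ⟨x, rfl⟩ := hs y
        rw [hφ, hφ', hψ'ψ]
      right_inv := fun y => by
        obtain ⟨x, rfl⟩ := hs y
        rw [hφ', hφ, hψψ']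
      contMDiff_toFun := hφs
      contMDiff_invFun := hp.contMDiff_descent hs hψs' hφ' }
  have hd : ∀ x, (surfDeriv φ (p x)).comp (surfDeriv p x) =
      (surfDeriv p (ψ x)).comp (surfDeriv ψ x) := fun x => by
    rw [← surfDeriv_comp_at x (hφs _).mdiffAt (hps x).mdiffAt,
      ← surfDeriv_comp_at x (hps _).mdiffAt (hψs x).mdiffAt]
    exact congrArg (fun f : D → S => surfDeriv f x) (funext hφ)
  refine ⟨Φ, ⟨fun y => ?_, ?_⟩, fun y a b => ?_⟩
  · obtain ⟨x, rfl⟩ := hs y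
    have hdet := congrArg ContinuousLinearMap.det (hd x)
    rw [det_comp', det_comp'] at hdet
    refine pos_of_mul_pos_left (b := (surfDeriv p x).det) ?_
      (hp.isOrientationPreserving x).le
    change 0 < (surfDeriv φ (p x)).det * _
    rw [hdet]
    exact mul_pos (hp.isOrientationPreserving _) (det_surfDeriv_lift_pos (hF₂ _).smooth (hψs x) hψF
      (hF₂ _).det_pos (hF₁ x).det_pos)
  -- The homotopy `K` respects the fibres of `p` at every time, and so descends.
  · exact hp.isCoveringMap.homotopic_id_of_descent hs hK0 (fun x => (hφ x).symm) hK
  · obtain ⟨x, rfl⟩ := hs y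
    have hsurj : Function.Surjective (surfDeriv p x) :=
      (LinearMap.equivOfDetNeZero (surfDeriv p x : ℂ →ₗ[ℝ] ℂ)
        (hp.isOrientationPreserving x).ne').surjective
    obtain ⟨a, rfl⟩ := hsurj a
    obtain ⟨b, rfl⟩ := hsurj b
    have hl : ∀ a, surfDeriv φ (p x) (surfDeriv p x a) = surfDeriv p (ψ x) (surfDeriv ψ x a) :=
      fun a => congrArg (fun L : ℂ →L[ℝ] ℂ => L a) (hd x)
    have hl' : ∀ a, surfDeriv F₂ (ψ x) (surfDeriv ψ x a) = surfDeriv F₁ x a :=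
      fun a => congrArg (fun L : ℂ →L[ℝ] ℂ => L a)
        (surfDeriv_lift (hF₂ _).smooth (hψs x) hψF)
    change _ = h₂.val (φ (p x)) (surfDeriv φ (p x) _) (surfDeriv φ (p x) _)
    have e₁ := (hF₁ x).isometry a b
    have e₂ := (hF₂ (ψ x)).isometry (surfDeriv ψ x a) (surfDeriv ψ x b)
    rw [hl', hl', hψF, e₁, SurfaceMetric.pull, SurfaceMetric.pull] at e₂
    rw [hl, hl, hφ, e₂]

variable {d₀ : D} {v : TangentSpace 𝓘(ℝ, ℂ) d₀}

/-- Metrics with conjugate holonomies are equivalent. -/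
theorem IsHolonomy.exists_isPullback_of_conj {hp : IsUniversalCovering p}
    (hs : Function.Surjective p) {h₁ h₂ : Hyp S} {ρ₁ ρ₂ : PiOne S (p d₀) →* PSU11}
    (H₁ : IsHolonomy hp d₀ v h₁ ρ₁) (H₂ : IsHolonomy hp d₀ v h₂ ρ₂) {g : PSU11}
    (hg : ∀ γ, ρ₂ γ = g * ρ₁ γ * g⁻¹) : ∃ φ ∈ diffPlusZero S, IsPullback φ h₁.1 h₂.1 := by
  obtain ⟨f₁, hf₁, H₁⟩ := H₁
  obtain ⟨f₂, hf₂, H₂⟩ := H₂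
  have hd₁ := hf₁.isDiskIsometryAt
  have hgb : Set.BijOn g.act (Metric.ball 0 1) (Metric.ball 0 1) := by
    refine Set.InvOn.bijOn (f' := g⁻¹.act) ⟨fun z hz => ?_, fun z hz => ?_⟩ (fun z hz => ?_)
      fun z hz => ?_
    · exact g.act_inv_act (mem_ball_zero_iff.1 hz)
    · exact g.act_act_inv (mem_ball_zero_iff.1 hz)
    · exact mem_ball_zero_iff.2 (g.norm_act_lt (mem_ball_zero_iff.1 hz))
    · exact mem_ball_zero_iff.2 (g⁻¹.norm_act_lt (mem_ball_zero_iff.1 hz))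
  -- Replacing `f₁` by `g.act ∘ f₁` conjugates its holonomy into `ρ₂`, so both isometries have the
  -- same equivariance.
  refine hp.exists_isPullback_of_equivariant hs (fun x => (hd₁ x).act_comp g)
    hf₂.isDiskIsometryAt (hgb.comp hf₁.bijOn) hf₂.bijOn fun T hT => ?_
  obtain ⟨γ, hγ⟩ := hp.exists_coveringTransformation_eq (d₀ := d₀) hT
  obtain ⟨T₁, hT₁, e₁⟩ := H₁ γ
  obtain ⟨T₂, hT₂, e₂⟩ := H₂ γ
  obtain rfl := hγ _ hT₁
  obtain rfl := hγ _ hT₂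
  refine ⟨ρ₂ γ, fun x => ⟨?_, e₂ x⟩⟩
  have hx := (hd₁ x).norm_lt
  rw [Function.comp_apply, Function.comp_apply, e₁, ← PSU11.act_mul _ _ hx,
    ← PSU11.act_mul _ _ hx, hg]
  group

end Injectivity

/-! ### The induced map on the Fricke space -/

theorem proposition1p2
    {S : Type*} [TopologicalSpace S] [T2Space S] [SecondCountableTopology S] [ConnectedSpace S]
    [ChartedSpace ℂ S] [IsManifold 𝓘(ℝ, ℂ) ∞ S] [OrientedSurface S]
    (hS : Nonempty (Hyp S))
    {D : Type*} [TopologicalSpace D] [ChartedSpace ℂ D] [IsManifold 𝓘(ℝ, ℂ) ∞ D]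
    [OrientedSurface D]
    {p : D → S} (hp : IsUniversalCovering p) (d₀ : D)
    (v : TangentSpace 𝓘(ℝ, ℂ) d₀) (hv : v ≠ 0) :
    ∃ δ : Hyp S → (PiOne S (p d₀) →* PSU11),
      (∀ h ρ, IsHolonomy hp d₀ v h ρ ↔ ρ = δ h) ∧
      ∃ δ' : FrickeSpace S → RepSpace (PiOne S (p d₀)),
        (∀ h, δ' (FrickeSpace.mk h) = RepSpace.mk (δ h)) ∧
        Function.Injective δ' := by
  have _ : LocallyPathConnectedSpace S := ChartedSpace.locallyPathConnectedSpace ℂ S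
  have _ : PathConnectedSpace S := pathConnectedSpace_iff_connectedSpace.2 inferInstance
  have _ : Nonempty D := ⟨d₀⟩
  choose δ hδ using fun h : Hyp S => hp.exists_isHolonomy (d₀ := d₀) h hv
  refine ⟨δ, fun h ρ => ⟨fun H => H.eq (hδ h), fun H => H ▸ hδ h⟩,
    Quotient.lift (fun h => RepSpace.mk (δ h)) ?_, fun h => rfl, ?_⟩
  · rintro h₁ h₂ ⟨φ, hφ, hpull⟩
    exact Quotient.sound ((hδ h₁).exists_conj_of_isPullback (hδ h₂) hφ hpull)
  · intro a b
    induction a using Quotient.inductionOn with | _ h₁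
    induction b using Quotient.inductionOn with | _ h₂
    intro hab
    obtain ⟨g, hg⟩ := Quotient.exact hab
    exact Quotient.sound ((hδ h₁).exists_isPullback_of_conj
      hp.isCoveringMap.surjective_of_pathConnectedSpace (hδ h₂) hg)

end
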